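/- **Setting.** Let $d\ge 1$, $\mathcal X\subseteq\mathbb R^d$, $\mu$ a probability measure on $\mathcal X$, $\|\cdot\|$ and $\langle\cdot,\cdot\rangle$ the norm and inner product of $L^2(\mathcal X,\mu)$, $\sigma^2>0$ and $\gamma\in(0,1)$. For $f_0\in L^2(\mathcal X,\mu)$ let $\mathrm P_0$ be the law of $(\boldsymbol x,\boldsymbol y)\in\mathcal X^n\times\mathbb R^n$ under the model $y_i=f_0(x_i)+\varepsilon_i$, $i=1,\dots,n$, with $x_i\sim\mu$ i.i.d. and, independently of the design, $\varepsilon_i\sim N(0,\sigma^2)$ i.i.d. Let $(\varphi_j)_{j\ge1}$ be measurable functions with $\sup_{j,x}|\varphi_j(x)|<\infty$ that form an orthonormal basis of $L^2(\mathcal X,\mu)$, and for $\beta>0$ let $$\mathcal S^\beta=\Big\{f\in L^2(\mathcal X,\mu):\ \sum_{j\ge1}j^{2\beta/d}\langle f,\varphi_j\rangle^2<\infty\Big\}.$$ Let $\alpha>0$, $\tau_n=n^{-1/(d+2\alpha)}\log n$, and let $\lambda_{n,j}\asymp\exp(-\tau_nj^{1/d})$, with constants that do not depend on $n\ge2$ and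 $j\ge1$. Let the prior $\Pi$ on $f$ be the centered Gaussian process with covariance kernel $k_n(x,x')=\sum_{j\ge1}\lambda_{n,j}\varphi_j(x)\varphi_j(x')$, that is, the law of $\sum_j\theta_j\varphi_j$ with independent $\theta_j\sim N(0,\lambda_{n,j})$, and let $\Pi(\cdot\mid\boldsymbol x,\boldsymbol y)$ be the posterior, whose density with respect to $\Pi$ is proportional to $\exp\big(-\tfrac1{2\sigma^2}\sum_{i=1}^n(y_i-f(x_i))^2\big)$. Let $m=m_n\asymp n^r$ for some $r\in(0,1/2)$, and let $\boldsymbol u=(\langle f,\varphi_1\rangle,\dots,\langle f,\varphi_m\rangle)$. The variational posterior $\Psi(\cdot\mid\boldsymbol x,\boldsymbol y)$ is the minimizer of $\Psi\mapsto D_{\mathrm{KL}}(\Psi\,\|\,\Pi(\cdot\mid\boldsymbol x,\boldsymbol y))$ over the laws $\Psi=\int\Pi(\cdot\mid\boldsymbol u)\,d\Psi_{\boldsymbol u}(\boldsymbol u)$, where $\Psi_{\boldsymbol u}$ is any non-degenerate Gaussian law on $\mathbb R^m$. Let $\hat f_m^{\mathrm v}$ be its mean and let the radius $\rho_n=\rho_n(\boldsymbol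 x,\boldsymbol y)$ satisfy $\Psi(\|f-\hat f_m^{\mathrm v}\|\le\rho_n\mid\boldsymbol x,\boldsymbol y)=1-\gamma$. **Claim.** As $n\to\infty$: 1. If $r\ge d/(d+2\alpha)$ and $\beta\ge\alpha$, then for every (essentially) bounded $f_0\in\mathcal S^\beta$ and every sequence $M_n\to\infty$, $\ \mathrm P_0(\|\hat f_m^{\mathrm v}-f_0\|\le M_n\rho_n)\to1$. 2. If $r<d/(d+2\alpha)$, then for every (essentially) bounded $f_0\in L^2(\mathcal X,\mu)$, $\ \mathrm P_0(\|\hat f_m^{\mathrm v}-f_0\|\le\rho_n)\to1$. 3. If $\alpha>\beta>0$ and $m_n\ge n^{d/(d+2\alpha)}$ for all $n\ge2$, then there exists $f_0\in\mathcal S^\beta$ such that $\ \mathrm P_0(\|\hat f_m^{\mathrm v}-f_0\|\le M\rho_n)\to0$ for every $M>0$. -/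

import Mathlib

open MeasureTheory ProbabilityTheory Filter Topology
open scoped NNReal ENNReal

namespace VBGP

noncomputable section

/-- The Hilbert space `L²(𝓧, μ)`. -/
abbrev L2 {𝓧 : Type*} [MeasurableSpace 𝓧] (μ : Measure 𝓧) : Type _ := Lp ℝ 2 μ

instance instMeasurableSpaceL2 {𝓧 : Type*} [MeasurableSpace 𝓧] (μ : Measure 𝓧) :
    MeasurableSpace (Lp ℝ 2 μ) := borel _

instance instBorelSpaceL2 {𝓧 : Type*} [MeasurableSpace 𝓧] (μ : Measure 𝓧) :
    BorelSpace (Lp ℝ 2 μ) := ⟨rfl⟩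

instance instStandardBorelSpaceL2 {𝓧 : Type*} [MeasurableSpace 𝓧]
    [MeasurableSpace.CountablyGenerated 𝓧] (μ : Measure 𝓧) [SFinite μ] :
    StandardBorelSpace (Lp ℝ 2 μ) := by
  have : Fact ((2 : ℝ≥0∞) ≠ ∞) := ⟨ENNReal.ofNat_ne_top⟩
  infer_instance

/-- The bounded elements of `L²(𝓧, μ)`. -/
def IsBounded {𝓧 : Type*} [MeasurableSpace 𝓧] {μ : Measure 𝓧} (f : L2 μ) : Prop :=
  ∃ B : ℝ, ∀ᵐ x ∂μ, |f x| ≤ B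

/-- The functions `φ 0, φ 1, …` are measurable, uniformly bounded on all of `𝓧`, and their classes
are the members of the orthonormal basis `e` of `L²(𝓧, μ)`. The functions themselves are needed
because they are evaluated at the design points. The `j`-th basis function of the mathematical
text, `j = 1, 2, …`, is the one with index `j - 1` here. -/
structure IsBoundedEigenbasis {𝓧 : Type*} [MeasurableSpace 𝓧] {μ : Measure 𝓧}
    (φ : ℕ → 𝓧 → ℝ) (e : HilbertBasis ℕ ℝ (L2 μ)) : Prop where
  measurable : ∀ j, Measurable (φ j)
  coe_eq : ∀ j, (e j : 𝓧 → ℝ) =ᵐ[μ] φ j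
  bounded : ∃ C : ℝ, ∀ j x, |φ j x| ≤ C

/-- The Sobolev-type space `𝒮^β = {f : ∑_{j ≥ 1} j^(2β/d) ⟨f, φ_j⟩² < ∞}`. -/
def sobolev {𝓧 : Type*} [MeasurableSpace 𝓧] {μ : Measure 𝓧} (e : HilbertBasis ℕ ℝ (L2 μ))
    (d : ℕ) (β : ℝ) : Set (L2 μ) :=
  {f | Summable fun j : ℕ => ((j : ℝ) + 1) ^ (2 * β / (d : ℝ)) * (inner ℝ (e j) f) ^ 2}

/-- The rescaling sequence `τ_n = n^(-1/(d+2α)) log n`. -/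
def rescaling (d : ℕ) (α : ℝ) (n : ℕ) : ℝ :=
  (n : ℝ) ^ (-(1 / ((d : ℝ) + 2 * α))) * Real.log n

section Data

variable {𝓧 : Type*} [MeasurableSpace 𝓧]

/-- The law `P₀` of the data `(x, y)` of size `n`: the design points `x_i` are i.i.d. with law `μ`,
the errors `ε_i` are i.i.d. `N(0, σ²)` and independent of the design, `y_i = f₀(x_i) + ε_i`. -/
def dataLaw (μ : Measure 𝓧) [IsProbabilityMeasure μ] (σ : ℝ≥0) (f₀ : L2 μ) (n : ℕ) :
    Measure ((Fin n → 𝓧) × (Fin n → ℝ)) :=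
  ((Measure.pi fun _ : Fin n => μ).prod
      (Measure.pi fun _ : Fin n => gaussianReal 0 (σ ^ 2))).map
    fun p => (p.1, fun i => f₀ (p.1 i) + p.2 i)

end Data

section Prior

variable {𝓧 : Type*} [MeasurableSpace 𝓧] {μ : Measure 𝓧}

/-- The centered Gaussian process prior on `L²(𝓧, μ)` with covariance kernel
`k(x, x') = ∑_j lam j * φ_j x * φ_j x'`: the law of `∑_j θ_j φ_j` with independent
`θ_j ∼ N(0, lam j)`. -/
def prior (e : HilbertBasis ℕ ℝ (L2 μ)) (lam : ℕ → ℝ≥0) : Measure (L2 μ) :=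
  (Measure.infinitePi fun j => gaussianReal 0 (lam j)).map fun θ : ℕ → ℝ => ∑' j, θ j • e j

instance instIsFiniteMeasurePrior (e : HilbertBasis ℕ ℝ (L2 μ)) (lam : ℕ → ℝ≥0) :
    IsFiniteMeasure (prior e lam) := by
  unfold prior; infer_instance

/-- The value `f(x) = ∑_j ⟨f, φ_j⟩ φ_j(x)` of the Gaussian process at the point `x`. When the
`φ_j` are uniformly bounded and `∑_j √(lam j) < ∞`, the series converges absolutely for
prior-almost every `f`, for each `x`. -/
def evalAt (φ : ℕ → 𝓧 → ℝ) (e : HilbertBasis ℕ ℝ (L2 μ)) (f : L2 μ) (x : 𝓧) : ℝ :=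
  ∑' j, inner ℝ (e j) f * φ j x

/-- The log-likelihood of `f` given the data, up to a constant that does not depend on `f`. -/
def logLik (φ : ℕ → 𝓧 → ℝ) (e : HilbertBasis ℕ ℝ (L2 μ)) (σ : ℝ≥0) {n : ℕ}
    (x : Fin n → 𝓧) (y : Fin n → ℝ) (f : L2 μ) : ℝ :=
  -(∑ i, (y i - evalAt φ e f (x i)) ^ 2) / (2 * (σ : ℝ) ^ 2)

/-- The true posterior `Π(· ∣ x, y)`, by Bayes' formula: its density with respect to the prior is
proportional to the likelihood. -/
def posterior (φ : ℕ → 𝓧 → ℝ) (e : HilbertBasis ℕ ℝ (L2 μ)) (lam : ℕ → ℝ≥0) (σ : ℝ≥0) {n : ℕ}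
    (x : Fin n → 𝓧) (y : Fin n → ℝ) : Measure (L2 μ) :=
  (prior e lam).tilted (logLik φ e σ x y)

/-- The population spectral features `u_j = ⟨f, φ_j⟩`, for the first `m` basis functions. -/
def features (e : HilbertBasis ℕ ℝ (L2 μ)) (m : ℕ) (f : L2 μ) : EuclideanSpace ℝ (Fin m) :=
  WithLp.toLp 2 fun j : Fin m => inner ℝ (e j) f

/-- The variational class: the laws `∫ Π(· ∣ u) dΨ_u(u)`, where `Π(· ∣ u)` is the prior conditional
on the inducing variables `u` and `Ψ_u` is a non-degenerate Gaussian law on `ℝᵐ`. -/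
def variationalClass [MeasurableSpace.CountablyGenerated 𝓧] [SFinite μ]
    (e : HilbertBasis ℕ ℝ (L2 μ)) (lam : ℕ → ℝ≥0) (m : ℕ) : Set (Measure (L2 μ)) :=
  {Ψ | ∃ (a : EuclideanSpace ℝ (Fin m)) (S : Matrix (Fin m) (Fin m) ℝ), S.PosDef ∧
    Ψ = (multivariateGaussian a S).bind (condDistrib id (features e m) (prior e lam))}

/-- `Ψ` is the variational posterior: it minimizes the Kullback-Leibler divergence to the true
posterior over the variational class. -/
def IsVariationalPosterior [MeasurableSpace.CountablyGenerated 𝓧] [SFinite μ]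
    (φ : ℕ → 𝓧 → ℝ) (e : HilbertBasis ℕ ℝ (L2 μ)) (lam : ℕ → ℝ≥0) (σ : ℝ≥0) (m : ℕ) {n : ℕ}
    (x : Fin n → 𝓧) (y : Fin n → ℝ) (Ψ : Measure (L2 μ)) : Prop :=
  Ψ ∈ variationalClass e lam m ∧
    ∀ Ψ' ∈ variationalClass e lam m,
      InformationTheory.klDiv Ψ (posterior φ e lam σ x y) ≤
        InformationTheory.klDiv Ψ' (posterior φ e lam σ x y)

/-- The mean of a law on `L²(𝓧, μ)`. -/
def meanOf (Ψ : Measure (L2 μ)) : L2 μ := ∫ f, f ∂Ψ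

/-- `ρ` is the radius of the `(1 - γ)`-credible ball of `Ψ` centered at the mean of `Ψ`. -/
def IsCredibleRadius (γ : ℝ) (Ψ : Measure (L2 μ)) (ρ : ℝ) : Prop :=
  Ψ {f | ‖f - meanOf Ψ‖ ≤ ρ} = ENNReal.ofReal (1 - γ)

end Prior

end

end VBGP

/-! The variational posterior is computable. Under the prior the coordinates of `f` are independent,
so `Π(· ∣ u)` keeps `u` as the first `m` coordinates and draws the others afresh from the prior
(`bind_condDistrib`). Under any member of the class, the expected log-likelihood of `f` equals that
of the regression on the first `m` features minus a tail variance that does not depend on the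
member: the cross term vanishes, the tail being centered and independent of `u`
(`integral_headLik_sub_logLik`). Minimising the divergence is therefore conjugate Bayesian
regression on `m` features, and the minimiser has feature law `N(P⁻¹Φᵀy/σ², P⁻¹)`, `P = diag(1/λ_j)
+ ΦᵀΦ/σ²`, and prior tail (`eq_of_isVariationalPosterior`).

Since `m²/n → 0`, the matrix `ΦᵀΦ` agrees with `n · I` up to a factor 2 with probability tending to
one (`lintegral_gramDefect_le`, `gramBounds_of_gramDefect_le`). On that event `P⁻¹` has the order of
the diagonal matrix with entries `(1/λ_j + n/σ²)⁻¹`. The squared radius is bounded below by a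
Gaussian small-ball estimate, applied to head or tail (`smallBall`), and above by Markov's
inequality (`credible_radius_sq_le`).

Put `J = n^(d/(d+2α))`. Then `λ_j ≍ n^(-t)` with `t = (j/J)^(1/d)`, so `λ_j` crosses the noise level
`1/n` at `j = J`; moreover `∑ min(λ_j, 1/n) ≲ J/n`, and `J/n = J^(-2α/d)` is the squared bias of a
function of smoothness `α` truncated at `J`. The three claims follow.

For `m ≳ J` and `f₀` of smoothness at least `α`, an energy estimate around a truncation of `f₀`
gives a squared error `O(J/n)` in probability (`norm_meanOf_sub_sq_le`), while the first `k ≍ J`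
features alone give `ρ² ≳ J/n` (`lt_radius_sq`).

For `r < d/(d+2α)`, the eigenvalues with `m ≤ j < 2m` are bounded below, so the prior tail forces
`ρ² ≳ m → ∞`, whereas the squared error stays bounded in probability.

For `β < s < α`, take squared coefficients `j^(-1-2s/d)`. At indices from about `4^d J` on, `λ_j ≲
n⁻⁴` and the posterior mean is negligible there. This leaves a squared error `≳ J^(-2s/d)`, which is
eventually larger than any multiple of `J^(-2α/d) = J/n ≳ ρ²` (`lt_norm_meanOf_sub_sq`,
`radius_sq_le_effDim`). -/

namespace VBGP

set_option linter.unusedSectionVars false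

/-! ### Exponential tilting: change of variables and normalisation. -/

section Tilting

variable {α β : Type*} [MeasurableSpace α] [MeasurableSpace β]

lemma map_tilted_comp (μ : Measure α) {g : α → β} (hg : Measurable g) {h : β → ℝ}
    (hh : Measurable h) : (μ.tilted (fun x => h (g x))).map g = (μ.map g).tilted h := by
  ext s hs
  rw [Measure.map_apply hg hs, tilted_apply' _ _ (hg hs), tilted_apply' _ _ hs,
    integral_map hg.aemeasurable (by fun_prop), setLIntegral_map hs (by fun_prop) hg]

/-- The normalising integral absorbs `c`. This disposes of the Jacobian when Lebesgue measure is
pushed through an affine map. -/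
lemma tilted_smul_measure (μ : Measure α) {c : ℝ≥0∞} (hc : c ≠ 0) (hc' : c ≠ ∞) (h : α → ℝ) :
    (c • μ).tilted h = μ.tilted h := by
  have hcpos : 0 < c.toReal := ENNReal.toReal_pos hc hc'
  have hinv : ENNReal.ofReal c.toReal⁻¹ = c⁻¹ := by
    rw [ENNReal.ofReal_inv_of_pos hcpos, ENNReal.ofReal_toReal hc']
  ext s hs
  rw [tilted_apply' _ _ hs, tilted_apply' _ _ hs, Measure.restrict_smul, lintegral_smul_measure,
    integral_smul_measure]
  have (x : α) : ENNReal.ofReal (Real.exp (h x) / c.toReal • ∫ x, Real.exp (h x) ∂μ)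
      = c⁻¹ * ENNReal.ofReal (Real.exp (h x) / ∫ x, Real.exp (h x) ∂μ) := by
    rw [← hinv, ← ENNReal.ofReal_mul (by positivity), smul_eq_mul]
    congr 1
    rw [div_mul_eq_div_div]
    ring
  simp_rw [this]
  rw [lintegral_const_mul' _ _ (by simp [hc]), smul_eq_mul, ← mul_assoc,
    ENNReal.mul_inv_cancel hc hc', one_mul]

lemma tilted_add_const (μ : Measure α) (h : α → ℝ) (c : ℝ) :
    μ.tilted (fun x => h x + c) = μ.tilted h := by
  unfold Measure.tilted
  congr with x
  simp_rw [Real.exp_add, integral_mul_const]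
  rw [mul_div_mul_right _ _ (Real.exp_pos c).ne']

lemma prod_tilted_left (μ : Measure α) (ν : Measure β) [SFinite μ] [IsProbabilityMeasure ν]
    {h : α → ℝ} (hh : Measurable h) :
    (μ.tilted h).prod ν = (μ.prod ν).tilted (fun p => h p.1) := by
  have : ∫ p : α × β, Real.exp (h p.1) ∂(μ.prod ν) = ∫ x, Real.exp (h x) ∂μ := by
    have := integral_prod_mul (μ := μ) (ν := ν) (fun x => Real.exp (h x)) (fun _ => (1 : ℝ))
    simpa using this
  unfold Measure.tilted
  rw [prod_withDensity_left (by fun_prop), this]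

end Tilting

/-! ### Gaussian laws on `ℝᵐ` as tilted Lebesgue measures. -/

section Gaussian

open Matrix

/-- The characteristic functions agree: the Fourier integral of the Gaussian factor carries the same
power of `2π` as the normalising integral, and the two cancel. -/
lemma stdGaussian_eq_tilted (E : Type*) [NormedAddCommGroup E] [InnerProductSpace ℝ E]
    [FiniteDimensional ℝ E] [MeasurableSpace E] [BorelSpace E] :
    Integrable (fun x : E => Real.exp (-‖x‖ ^ 2 / 2)) ∧
    stdGaussian E = (volume : Measure E).tilted fun x => -‖x‖ ^ 2 / 2 := by
  have hint : Integrable (fun x : E => Real.exp (-‖x‖ ^ 2 / 2)) := by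
    have h := GaussianFourier.integrable_cexp_neg_mul_sq_norm_add (b := 1 / 2) (V := E)
      (by norm_num) 0 0
    have := h.norm
    refine this.congr (ae_of_all _ fun x => ?_)
    simp only [Complex.norm_exp]
    congr 1
    have : (-(1 / 2 : ℂ) * (‖x‖ : ℂ) ^ 2 + 0 * (inner ℝ (0 : E) x : ℝ))
      = ((-‖x‖ ^ 2 / 2 : ℝ) : ℂ) := by
      push_cast; ring
    rw [this, Complex.ofReal_re]
  refine ⟨hint, ?_⟩
  have hP := isProbabilityMeasure_tilted hint
  refine Measure.ext_of_charFun ?_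
  ext t
  rw [charFun_stdGaussian, charFun_apply, integral_tilted]
  have h1 := GaussianFourier.integral_cexp_neg_mul_sq_norm_add (b := 1 / 2) (V := E)
    (by norm_num) Complex.I t
  have h0 := GaussianFourier.integral_rexp_neg_mul_sq_norm (b := 1 / 2) (V := E) (by norm_num)
  have h0' : ∫ x : E, Real.exp (-‖x‖ ^ 2 / 2)
      = (Real.pi / (1 / 2)) ^ (Module.finrank ℝ E / 2 : ℝ) := by
    rw [← h0]; congr with x; congr 1; ring
  have hpos : 0 < ∫ x : E, Real.exp (-‖x‖ ^ 2 / 2) := integral_exp_pos hint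
  have h2 : ∀ x : E, (Real.exp (-‖x‖ ^ 2 / 2) / ∫ x : E, Real.exp (-‖x‖ ^ 2 / 2)) •
      Complex.exp ((inner ℝ x t : ℝ) * Complex.I) =
      ((∫ x : E, Real.exp (-‖x‖ ^ 2 / 2) : ℝ) : ℂ)⁻¹ *
        Complex.exp (-(1 / 2) * (‖x‖ : ℂ) ^ 2 + Complex.I * (inner ℝ t x : ℝ)) := by
    intro x
    rw [Complex.exp_add, Complex.real_smul]
    push_cast
    rw [real_inner_comm t x, mul_comm Complex.I, show -(1 / 2 : ℂ) * (‖x‖ : ℂ) ^ 2 = -(‖x‖ : ℂ) ^ 2 / 2 by ring]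
    ring
  simp_rw [h2]
  rw [integral_const_mul, h1]
  have h3 : ((∫ x : E, Real.exp (-‖x‖ ^ 2 / 2) : ℝ) : ℂ)
      = (Real.pi / (1 / 2)) ^ (Module.finrank ℝ E / 2 : ℂ) := by
    rw [h0', Complex.ofReal_cpow (by positivity)]
    push_cast; rfl
  rw [← h3, ← mul_assoc, inv_mul_cancel₀ (by exact_mod_cast hpos.ne'), one_mul]
  congr 1
  rw [Complex.I_sq]; ring

variable {m : ℕ}

/-- Up to an additive constant, the log-density of the Gaussian law on `ℝᵐ` with mean `a` and
precision matrix `P`. -/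
noncomputable def gaussLogDensity (a : EuclideanSpace ℝ (Fin m)) (P : Matrix (Fin m) (Fin m) ℝ)
    (x : EuclideanSpace ℝ (Fin m)) : ℝ :=
  -(((x - a).ofLp ⬝ᵥ P *ᵥ (x - a).ofLp) / 2)

lemma measurable_gaussLogDensity (a : EuclideanSpace ℝ (Fin m)) (P : Matrix (Fin m) (Fin m) ℝ) :
    Measurable (gaussLogDensity a P) := by
  refine Continuous.measurable ?_
  unfold gaussLogDensity Matrix.mulVec dotProduct
  fun_prop

-- With `R = √(P⁻¹)`, the map `z ↦ a + R z` sends the standard Gaussian to this law. It turns the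
-- quadratic exponent into `-‖z‖²/2`, because `R P R = 1`, and Lebesgue measure into a multiple of
-- itself, which tilting ignores.
open scoped MatrixOrder in
lemma multivariateGaussian_eq_tilted (a : EuclideanSpace ℝ (Fin m))
    {P : Matrix (Fin m) (Fin m) ℝ} (hP : P.PosDef) :
    Integrable (fun x => Real.exp (gaussLogDensity a P x)) ∧
    multivariateGaussian a P⁻¹ = volume.tilted (gaussLogDensity a P) := by
  set R := CFC.sqrt P⁻¹ with hR
  have hRR : R * R = P⁻¹ := CFC.sqrt_mul_sqrt_self _ hP.inv.posSemidef.nonneg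
  have hRsymm : Rᵀ = R := by
    have := (CFC.sqrt_nonneg P⁻¹).isSelfAdjoint
    simpa [IsSelfAdjoint, star_eq_conjTranspose, conjTranspose_eq_transpose_of_trivial] using this
  have hPdet : IsUnit P.det := hP.det_pos.ne'.isUnit
  have hdet : R.det ≠ 0 := by
    intro h0
    have : (P⁻¹).det = 0 := by rw [← hRR, det_mul, h0, zero_mul]
    exact hP.inv.det_pos.ne' this
  have hRPR : R * P * R = 1 := by
    have h1 : R * (R * P) = 1 := by rw [← mul_assoc, hRR, nonsing_inv_mul _ hPdet]
    exact mul_eq_one_comm.mp h1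
  set T : EuclideanSpace ℝ (Fin m) →ₗ[ℝ] EuclideanSpace ℝ (Fin m) :=
    ((toEuclideanCLM (𝕜 := ℝ) R : EuclideanSpace ℝ (Fin m) →L[ℝ] EuclideanSpace ℝ (Fin m)) :
      EuclideanSpace ℝ (Fin m) →ₗ[ℝ] EuclideanSpace ℝ (Fin m)) with hT
  have hTapp : ∀ z, (T z).ofLp = R *ᵥ z.ofLp := by
    intro z; simp [hT]
  have hTdet : LinearMap.det T ≠ 0 := by
    have hinj : Function.Injective T := by
      intro z w h
      have := congrArg (fun v => R⁻¹ *ᵥ v.ofLp) h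
      simp only [hTapp, mulVec_mulVec, nonsing_inv_mul _ hdet.isUnit, one_mulVec] at this
      exact WithLp.ofLp_injective _ this
    have hunit : IsUnit T := (LinearMap.isUnit_iff_ker_eq_bot T).2 (LinearMap.ker_eq_bot.2 hinj)
    exact (hunit.map LinearMap.det).ne_zero
  have hmap : (volume : Measure (EuclideanSpace ℝ (Fin m))).map (fun z => a + T z)
      = ENNReal.ofReal |(LinearMap.det T)⁻¹| • volume := by
    have h1 := Measure.map_linearMap_addHaar_eq_smul_addHaar
      (volume : Measure (EuclideanSpace ℝ (Fin m))) hTdet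
    rw [show (fun z => a + T z) = (fun z => a + z) ∘ T from rfl,
      ← Measure.map_map (by fun_prop) (LinearMap.continuous_of_finiteDimensional T).measurable,
      h1, Measure.map_smul, map_add_left_eq_self]
  have hTm : Measurable (fun z => a + T z) :=
    ((LinearMap.continuous_of_finiteDimensional T).const_add a |>.measurable)
  have hcomp : ∀ z, gaussLogDensity a P (a + T z) = -‖z‖ ^ 2 / 2 := by
    intro z
    unfold gaussLogDensity
    rw [add_sub_cancel_left, hTapp, mulVec_mulVec, dotProduct_mulVec, vecMul_mulVec,
      ← dotProduct_mulVec, hRsymm, ← mul_assoc, hRPR, one_mulVec, EuclideanSpace.real_norm_sq_eq,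
      neg_div]
    congr 2
    exact Finset.sum_congr rfl fun i _ => (sq _).symm
  have hc : ENNReal.ofReal |(LinearMap.det T)⁻¹| ≠ 0 := by
    simpa using hTdet
  obtain ⟨hint, hstd⟩ := stdGaussian_eq_tilted (EuclideanSpace ℝ (Fin m))
  constructor
  · have : Integrable (fun x => Real.exp (gaussLogDensity a P x))
        ((volume : Measure (EuclideanSpace ℝ (Fin m))).map (fun z => a + T z)) := by
      rw [integrable_map_measure]
      · simpa [Function.comp_def, hcomp] using hint
      · exact ((measurable_gaussLogDensity a P).exp).aestronglyMeasurable
      · exact hTm.aemeasurable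
    rw [hmap, integrable_smul_measure hc ENNReal.ofReal_ne_top] at this
    exact this
  · have h1 := map_tilted_comp volume hTm (measurable_gaussLogDensity a P)
    simp_rw [hcomp] at h1
    rw [← hstd, hmap, tilted_smul_measure _ hc ENNReal.ofReal_ne_top] at h1
    rw [← h1, multivariateGaussian]
    rfl

/-- Conditional laws given the features are determined only almost everywhere for the prior; this
carries them over to every non-degenerate Gaussian law of the features. -/
lemma multivariateGaussian_absolutelyContinuous (a b : EuclideanSpace ℝ (Fin m))
    {S R : Matrix (Fin m) (Fin m) ℝ} (hS : S.PosDef) (hR : R.PosDef) :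
    multivariateGaussian a S ≪ multivariateGaussian b R := by
  have h1 := multivariateGaussian_eq_tilted a hS.inv
  have h2 := multivariateGaussian_eq_tilted b hR.inv
  rw [nonsing_inv_nonsing_inv _ hS.det_pos.ne'.isUnit] at h1
  rw [nonsing_inv_nonsing_inv _ hR.det_pos.ne'.isUnit] at h2
  rw [h1.2, h2.2]
  exact (tilted_absolutelyContinuous _ _).trans (absolutelyContinuous_tilted h2.1)

/-- Conjugacy: exponential tilting by a quadratic function. -/
lemma multivariateGaussian_tilted {a b : EuclideanSpace ℝ (Fin m)}
    {P Q : Matrix (Fin m) (Fin m) ℝ} (hP : P.PosDef) (hQ : Q.PosDef)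
    {h : EuclideanSpace ℝ (Fin m) → ℝ} {c : ℝ}
    (hh : ∀ u, gaussLogDensity b Q u + h u = gaussLogDensity a P u + c) :
    (multivariateGaussian b Q⁻¹).tilted h = multivariateGaussian a P⁻¹ := by
  obtain ⟨hi, hd⟩ := multivariateGaussian_eq_tilted b hQ
  rw [hd, tilted_tilted hi, (multivariateGaussian_eq_tilted a hP).2,
    ← tilted_add_const volume (gaussLogDensity a P) c]
  congr 1
  ext u
  exact hh u

end Gaussian

/-! ### Minimality of the Kullback-Leibler divergence. -/

section KullbackLeibler

open InformationTheory

variable {α : Type*} [MeasurableSpace α]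

/-- If the expectation of `h - ℓ` is the same under `Ψ` as under `ν.tilted h`, and `Ψ` is at least
as close to `ν.tilted ℓ` as `ν.tilted h` is, then `Ψ = ν.tilted h`. -/
lemma eq_tilted_of_klDiv_le {ν Ψ : Measure α} [IsProbabilityMeasure ν] [IsProbabilityMeasure Ψ]
    {ℓ h : α → ℝ} (hℓ : Integrable (fun x => Real.exp (ℓ x)) ν)
    (hh : Integrable (fun x => Real.exp (h x)) ν) (hΨ : Ψ ≪ ν)
    (hℓΨ : Integrable ℓ Ψ) (hhΨ : Integrable h Ψ)
    (hℓQ : Integrable ℓ (ν.tilted h)) (hhQ : Integrable h (ν.tilted h))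
    (hdiff : ∫ x, (h x - ℓ x) ∂Ψ = ∫ x, (h x - ℓ x) ∂(ν.tilted h))
    (hle : klDiv Ψ (ν.tilted ℓ) ≤ klDiv (ν.tilted h) (ν.tilted ℓ)) :
    Ψ = ν.tilted h := by
  have := isProbabilityMeasure_tilted hℓ
  have := isProbabilityMeasure_tilted hh
  have hQ : ν.tilted h ≪ ν := tilted_absolutelyContinuous _ _
  have hllrQ : llr (ν.tilted h) ν =ᵐ[ν.tilted h]
      fun x => h x - Real.log (∫ x, Real.exp (h x) ∂ν) :=
    hQ.ae_le (log_rnDeriv_tilted_left_self hh)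
  have hiQ : Integrable (llr (ν.tilted h) ν) (ν.tilted h) :=
    (integrable_congr hllrQ).2 (hhQ.sub (integrable_const _))
  have hQP : ν.tilted h ≪ ν.tilted ℓ := hQ.trans (absolutelyContinuous_tilted hℓ)
  have hΨP : Ψ ≪ ν.tilted ℓ := hΨ.trans (absolutelyContinuous_tilted hℓ)
  have hΨQ : Ψ ≪ ν.tilted h := hΨ.trans (absolutelyContinuous_tilted hh)
  have hiQP := integrable_llr_tilted_right hQ hℓQ hiQ hℓ
  have htop : klDiv (ν.tilted h) (ν.tilted ℓ) ≠ ∞ := klDiv_ne_top hQP hiQP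
  -- The comparison makes the divergence of `Ψ` finite, and this supplies the integrability of `llr
  -- Ψ ν` that the splittings below need.
  have htop' : klDiv Ψ (ν.tilted ℓ) ≠ ∞ := ne_top_of_le_ne_top htop hle
  have hiΨP := (klDiv_ne_top_iff.1 htop').2
  have hiΨ : Integrable (llr Ψ ν) Ψ := by
    have h1 := (integrable_congr (llr_tilted_right hΨ hℓ)).1 hiΨP
    refine (h1.add (hℓΨ.sub (integrable_const (Real.log (∫ z, Real.exp (ℓ z) ∂ν))))).congr
      (ae_of_all _ fun x => ?_)
    simp only [Pi.add_apply, Pi.sub_apply]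
    ring
  have hle' := ENNReal.toReal_mono htop hle
  rw [toReal_klDiv_of_measure_eq hΨP (by simp), toReal_klDiv_of_measure_eq hQP (by simp),
    integral_llr_tilted_right hΨ hℓΨ hℓ hiΨ, integral_llr_tilted_right hQ hℓQ hℓ hiQ,
    integral_congr_ae hllrQ, integral_sub hhQ (integrable_const _)] at hle'
  rw [integral_sub hhΨ hℓΨ, integral_sub hhQ hℓQ] at hdiff
  have hiΨQ := integrable_llr_tilted_right hΨ hhΨ hiΨ hh
  -- The divergences of `Ψ` to `ν.tilted h` and to `ν.tilted ℓ` differ by `∫ (h - ℓ) ∂Ψ` and the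
  -- log-normalisers. By `hdiff` the difference is the same for `ν.tilted h` in place of `Ψ`, whose
  -- divergence to itself is zero.
  have hkl : (klDiv Ψ (ν.tilted h)).toReal ≤ 0 := by
    rw [toReal_klDiv_of_measure_eq hΨQ (by simp), integral_llr_tilted_right hΨ hhΨ hh hiΨ]
    simp only [integral_const, probReal_univ, smul_eq_mul, one_mul] at hle'
    linarith
  have h0 : klDiv Ψ (ν.tilted h) = 0 := by
    have := le_antisymm hkl ENNReal.toReal_nonneg
    exact ((ENNReal.toReal_eq_zero_iff _).1 this).resolve_right (klDiv_ne_top hΨQ hiΨQ)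
  exact klDiv_eq_zero_iff.1 h0

end KullbackLeibler

/-! ### The Gaussian prior, its coordinates, and resampling of the first `m` of them. -/

section Prior

variable {𝓧 : Type*} [MeasurableSpace 𝓧] {μ : Measure 𝓧}

/-- The law of the coordinates of the Gaussian process prior. -/
noncomputable abbrev coordLaw (lam : ℕ → ℝ≥0) : Measure (ℕ → ℝ) :=
  Measure.infinitePi fun j => gaussianReal 0 (lam j)

/-- The coordinates of an element of `L²` in the basis `e`. -/
noncomputable def coords (e : HilbertBasis ℕ ℝ (L2 μ)) (f : L2 μ) : ℕ → ℝ := fun j => inner ℝ (e j) f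

/-- The projection onto the span of the first `m` basis functions. -/
noncomputable def headProj (e : HilbertBasis ℕ ℝ (L2 μ)) (m : ℕ) (f : L2 μ) : L2 μ :=
  ∑ j : Fin m, (inner ℝ (e j) f : ℝ) • e j

/-- Replace the first `m` coordinates of `f` by `u`. -/
noncomputable def resample (e : HilbertBasis ℕ ℝ (L2 μ)) (m : ℕ)
    (p : EuclideanSpace ℝ (Fin m) × L2 μ) : L2 μ :=
  ∑ j : Fin m, p.1 j • e j + (p.2 - headProj e m p.2)

lemma lintegral_sq_gaussianReal (v : ℝ≥0) :
    ∫⁻ x, ENNReal.ofReal (x ^ 2) ∂(gaussianReal 0 v) = v := by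
  have hi : Integrable (fun x : ℝ => x ^ 2) (gaussianReal 0 v) :=
    (IsGaussian.memLp_two_id (μ := gaussianReal 0 v)).integrable_sq
  rw [← ofReal_integral_eq_lintegral_ofReal hi (ae_of_all _ fun x => sq_nonneg x)]
  have := variance_id_gaussianReal (μ := 0) (v := v)
  rw [variance_of_integral_eq_zero (by fun_prop) (by simp)] at this
  simp only [id] at this
  rw [this, ENNReal.ofReal_coe_nnreal]

lemma lintegral_coord_sq (lam : ℕ → ℝ≥0) (j : ℕ) :
    ∫⁻ θ, ENNReal.ofReal (θ j ^ 2) ∂(coordLaw lam) = lam j := by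
  rw [← lintegral_sq_gaussianReal (lam j),
    ← Measure.infinitePi_map_eval (fun j => gaussianReal 0 (lam j)) j,
    lintegral_map (by fun_prop) (by fun_prop)]

lemma summable_of_tsum_ofReal_ne_top {f : ℕ → ℝ} (h0 : ∀ j, 0 ≤ f j)
    (h : ∑' j, ENNReal.ofReal (f j) ≠ ∞) : Summable f := by
  have := ENNReal.summable_toReal h
  simpa [ENNReal.toReal_ofReal (h0 _)] using this

lemma ae_summable_sq {lam : ℕ → ℝ≥0} (hs : Summable lam) :
    ∀ᵐ θ ∂(coordLaw lam), Summable fun j => θ j ^ 2 := by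
  have h1 : ∫⁻ θ, ∑' j, ENNReal.ofReal (θ j ^ 2) ∂(coordLaw lam) ≠ ∞ := by
    rw [lintegral_tsum
      (fun j => ((measurable_pi_apply j).pow_const 2).ennreal_ofReal.aemeasurable)]
    simp_rw [lintegral_coord_sq]
    exact ENNReal.tsum_coe_ne_top_iff_summable.2 hs
  filter_upwards [ae_lt_top (by fun_prop) h1] with θ hθ
  exact summable_of_tsum_ofReal_ne_top (fun j => sq_nonneg _) hθ.ne

lemma hasSum_and_coords (e : HilbertBasis ℕ ℝ (L2 μ)) {θ : ℕ → ℝ}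
    (hθ : Summable fun j => θ j ^ 2) :
    Summable (fun j => θ j • e j) ∧ coords e (∑' j, θ j • e j) = θ := by
  have hmem : Memℓp θ 2 := by
    refine memℓp_gen ?_
    simpa using hθ
  have h := e.hasSum_repr_symm ⟨θ, hmem⟩
  refine ⟨h.summable, ?_⟩
  ext j
  rw [coords, h.tsum_eq, ← e.repr_apply_apply]
  simp

lemma measurable_coords (e : HilbertBasis ℕ ℝ (L2 μ)) : Measurable (coords e) := by
  refine measurable_pi_iff.2 fun j => Continuous.measurable ?_
  unfold coords
  fun_prop

lemma tsum_coords (e : HilbertBasis ℕ ℝ (L2 μ)) (f : L2 μ) : ∑' j, coords e f j • e j = f := by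
  have := e.hasSum_repr f
  simp_rw [e.repr_apply_apply] at this
  exact this.tsum_eq

/-- Off the square-summable sequences `tsum` may take its default value, so measurability is
obtained almost everywhere only, from the partial sums. -/
lemma aemeasurable_series (e : HilbertBasis ℕ ℝ (L2 μ)) {lam : ℕ → ℝ≥0} (hs : Summable lam) :
    AEMeasurable (fun θ : ℕ → ℝ => ∑' j, θ j • e j) (coordLaw lam) := by
  refine aemeasurable_of_tendsto_metrizable_ae atTop
    (f := fun n θ => ∑ j ∈ Finset.range n, θ j • e j) (fun n => ?_) ?_
  · exact (Continuous.measurable (by fun_prop)).aemeasurable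
  · filter_upwards [ae_summable_sq hs] with θ hθ
    exact (hasSum_and_coords e hθ).1.hasSum.tendsto_sum_nat

lemma isProbabilityMeasure_prior (e : HilbertBasis ℕ ℝ (L2 μ)) {lam : ℕ → ℝ≥0} (hs : Summable lam) :
    IsProbabilityMeasure (prior e lam) :=
  Measure.isProbabilityMeasure_map (aemeasurable_series e hs)

lemma prior_map_coords (e : HilbertBasis ℕ ℝ (L2 μ)) {lam : ℕ → ℝ≥0} (hs : Summable lam) :
    (prior e lam).map (coords e) = coordLaw lam := by
  rw [prior, AEMeasurable.map_map_of_aemeasurable (measurable_coords e).aemeasurable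
    (aemeasurable_series e hs)]
  conv_rhs => rw [← Measure.map_id (μ := coordLaw lam)]
  refine Measure.map_congr ?_
  filter_upwards [ae_summable_sq hs] with θ hθ
  exact (hasSum_and_coords e hθ).2

/-- An element of `L²` is recovered from its coordinates, so invariance properties of the prior can
be checked on the product measure `coordLaw`. -/
lemma eq_prior_of_map_coords (e : HilbertBasis ℕ ℝ (L2 μ)) {lam : ℕ → ℝ≥0} (hs : Summable lam)
    {P : Measure (L2 μ)} (hP : P.map (coords e) = coordLaw lam) : P = prior e lam := by
  have hm := aemeasurable_series e hs
  rw [prior, show (Measure.infinitePi fun j => gaussianReal 0 (lam j)) = _ from hP.symm,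
    AEMeasurable.map_map_of_aemeasurable (by rwa [hP])
    (measurable_coords e).aemeasurable]
  have : (fun θ : ℕ → ℝ => ∑' j, θ j • e j) ∘ coords e = id := by
    ext1 f; exact tsum_coords e f
  rw [this, Measure.map_id]

lemma prior_map_neg (e : HilbertBasis ℕ ℝ (L2 μ)) {lam : ℕ → ℝ≥0} (hs : Summable lam) :
    (prior e lam).map (fun f => -f) = prior e lam := by
  refine eq_prior_of_map_coords e hs ?_
  have h1 : coords e ∘ (fun f => -f) = (fun θ j => -θ j) ∘ coords e := by
    ext f j; simp [coords]
  rw [Measure.map_map (measurable_coords e) (Continuous.measurable (by fun_prop)), h1,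
    ← Measure.map_map (by fun_prop) (measurable_coords e), prior_map_coords e hs,
    Measure.infinitePi_map_pi (f := fun _ x => -x) _ (fun j => by fun_prop)]
  simp [gaussianReal_map_neg]

lemma continuous_headProj (e : HilbertBasis ℕ ℝ (L2 μ)) (m : ℕ) : Continuous (headProj e m) := by
  unfold headProj; fun_prop

lemma continuous_resample (e : HilbertBasis ℕ ℝ (L2 μ)) (m : ℕ) : Continuous (resample e m) := by
  have := continuous_headProj e m
  unfold resample; fun_prop

lemma measurable_resample (e : HilbertBasis ℕ ℝ (L2 μ)) (m : ℕ) : Measurable (resample e m) :=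
  (continuous_resample e m).measurable

lemma coords_sum_fin (e : HilbertBasis ℕ ℝ (L2 μ)) (m : ℕ) (u : Fin m → ℝ) (j : ℕ) :
    coords e (∑ i : Fin m, u i • e i) j = if h : j < m then u ⟨j, h⟩ else 0 := by
  unfold coords
  rw [inner_sum]
  simp_rw [inner_smul_right, orthonormal_iff_ite.1 e.orthonormal]
  split_ifs with h
  · rw [Finset.sum_eq_single ⟨j, h⟩] <;> simp
    intro i hi hne
    exact absurd (Fin.ext hne.symm) hi
  · refine Finset.sum_eq_zero fun i _ => ?_
    rw [if_neg (by have := i.2; omega), mul_zero]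

lemma coords_tail (e : HilbertBasis ℕ ℝ (L2 μ)) (m : ℕ) (f : L2 μ) (j : ℕ) :
    coords e (f - headProj e m f) j = if j < m then 0 else coords e f j := by
  have := coords_sum_fin e m (fun i => inner ℝ (e i) f) j
  unfold headProj
  simp only [coords, inner_sub_right] at this ⊢
  rw [this]
  split_ifs <;> simp

lemma coords_resample (e : HilbertBasis ℕ ℝ (L2 μ)) (m : ℕ) (p : EuclideanSpace ℝ (Fin m) × L2 μ)
    (j : ℕ) : coords e (resample e m p) j = if h : j < m then p.1 ⟨j, h⟩ else coords e p.2 j := by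
  have h1 := coords_sum_fin e m p.1 j
  have h2 := coords_tail e m p.2 j
  have : coords e (resample e m p) j
      = coords e (∑ i : Fin m, p.1 i • e i) j + coords e (p.2 - headProj e m p.2) j := by
    simp only [coords, resample, inner_add_right]
  rw [this, h1, h2]
  split_ifs <;> simp

lemma features_resample (e : HilbertBasis ℕ ℝ (L2 μ)) (m : ℕ)
    (p : EuclideanSpace ℝ (Fin m) × L2 μ) : features e m (resample e m p) = p.1 := by
  ext i
  have := coords_resample e m p i
  simpa [features, coords] using this

open Matrix in
lemma posDef_diagonal_coe {m : ℕ} {lam : ℕ → ℝ≥0} (hpos : ∀ j, 0 < lam j) :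
    (diagonal fun j : Fin m => (lam j : ℝ)).PosDef :=
  posDef_diagonal_iff.2 fun j => by exact_mod_cast hpos j

open Matrix in
lemma map_pi_eq_multivariateGaussian {m : ℕ} {lam : ℕ → ℝ≥0} :
    (Measure.pi fun j : Fin m => gaussianReal 0 (lam j)).map (WithLp.toLp 2)
      = multivariateGaussian 0 (diagonal fun j : Fin m => (lam j : ℝ)) := by
  have hpsd : (diagonal fun j : Fin m => (lam j : ℝ)).PosSemidef :=
    posSemidef_diagonal_iff.2 fun j => (lam j).2
  have : IsProbabilityMeasure ((Measure.pi fun j : Fin m => gaussianReal 0 (lam j)).map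
    (WithLp.toLp 2)) := Measure.isProbabilityMeasure_map (by fun_prop)
  apply Measure.ext_of_charFun (E := EuclideanSpace ℝ (Fin m))
  ext t
  simp_rw [charFun_multivariateGaussian hpsd, charFun_pi, charFun_gaussianReal,
    ← Complex.exp_sum]
  congr 1
  simp only [dotProduct, mulVec_diagonal, inner_zero_right]
  push_cast
  rw [Finset.sum_div, zero_mul, zero_sub, ← Finset.sum_neg_distrib]
  refine Finset.sum_congr rfl fun i _ => ?_
  ring

/-- Independence of the coordinates: an independent copy of the first `m` can be substituted without
changing the law. On a finite box the preimage is a product of a box in `Fin m → ℝ` and a box in the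
coordinates `j ≥ m`. -/
lemma override_law (lam : ℕ → ℝ≥0) (m : ℕ) :
    (((Measure.pi fun j : Fin m => gaussianReal 0 (lam j)).prod (coordLaw lam)).map
      fun p : (Fin m → ℝ) × (ℕ → ℝ) => fun j => if h : j < m then p.1 ⟨j, h⟩ else p.2 j)
      = coordLaw lam := by
  have hmeas : Measurable fun p : (Fin m → ℝ) × (ℕ → ℝ) =>
      fun j => if h : j < m then p.1 ⟨j, h⟩ else p.2 j := by
    refine measurable_pi_iff.2 fun j => ?_
    split_ifs <;> fun_prop
  refine Measure.eq_infinitePi _ fun s t ht => ?_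
  rw [Measure.map_apply hmeas (MeasurableSet.pi s.countable_toSet fun j _ => ht j)]
  have hpre : (fun p : (Fin m → ℝ) × (ℕ → ℝ) =>
      fun j => if h : j < m then p.1 ⟨j, h⟩ else p.2 j) ⁻¹' (Set.pi s t)
      = (Set.pi Set.univ fun i : Fin m => if (i : ℕ) ∈ s then t i else Set.univ) ×ˢ
        (Set.pi (s.filter fun j => ¬ j < m : Finset ℕ) t) := by
    ext p
    simp only [Set.mem_preimage, Set.mem_pi, Set.mem_prod, Finset.mem_coe, Finset.mem_filter,
      Set.mem_univ, true_implies]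
    constructor
    · intro h
      refine ⟨fun i => ?_, fun j hj => ?_⟩
      · split_ifs with hi
        · simpa using h i hi
        · trivial
      · simpa [hj.2] using h j hj.1
    · rintro ⟨h1, h2⟩ j hj
      split_ifs with hjm
      · simpa [hj] using h1 ⟨j, hjm⟩
      · exact h2 j ⟨hj, hjm⟩
  rw [hpre, Measure.prod_prod, Measure.pi_pi, Measure.infinitePi_pi _ (fun j _ => ht j)]
  have h1 : ∀ i : Fin m, gaussianReal 0 (lam i) (if (i : ℕ) ∈ s then t i else Set.univ)
      = (fun j : ℕ => if j ∈ s then gaussianReal 0 (lam j) (t j) else 1) i := by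
    intro i
    by_cases hi : (i : ℕ) ∈ s <;> simp [hi]
  simp_rw [h1]
  rw [Fin.prod_univ_eq_prod_range (fun j : ℕ => if j ∈ s then gaussianReal 0 (lam j) (t j) else 1) m,
    ← Finset.prod_filter, ← Finset.prod_filter_mul_prod_filter_not s (fun j => j < m)]
  congr 2
  ext j
  simp [and_comm]

open Matrix in
lemma map_resample_prior (e : HilbertBasis ℕ ℝ (L2 μ)) {lam : ℕ → ℝ≥0} (hs : Summable lam) (m : ℕ) :
    ((multivariateGaussian 0 (diagonal fun j : Fin m => (lam j : ℝ))).prod (prior e lam)).map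
      (resample e m) = prior e lam := by
  have := isProbabilityMeasure_prior e hs
  refine eq_prior_of_map_coords e hs ?_
  rw [Measure.map_map (measurable_coords e) (measurable_resample e m)]
  have h1 : coords e ∘ resample e m = (fun p : (Fin m → ℝ) × (ℕ → ℝ) =>
      fun j => if h : j < m then p.1 ⟨j, h⟩ else p.2 j) ∘ Prod.map WithLp.ofLp (coords e) := by
    ext p j
    simpa using coords_resample e m p j
  have hmeas : Measurable fun p : (Fin m → ℝ) × (ℕ → ℝ) =>
      fun j => if h : j < m then p.1 ⟨j, h⟩ else p.2 j := by
    refine measurable_pi_iff.2 fun j => ?_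
    split_ifs <;> fun_prop
  rw [h1, ← Measure.map_map hmeas (by have := measurable_coords e; fun_prop),
    ← Measure.map_prod_map _ _ (by fun_prop) (measurable_coords e), prior_map_coords e hs,
    ← map_pi_eq_multivariateGaussian, Measure.map_map (by fun_prop) (by fun_prop)]
  have : (WithLp.ofLp : EuclideanSpace ℝ (Fin m) → _) ∘ (WithLp.toLp 2) = id := rfl
  rw [this, Measure.map_id, override_law]

open Matrix in
lemma prior_map_features (e : HilbertBasis ℕ ℝ (L2 μ)) {lam : ℕ → ℝ≥0} (hs : Summable lam) (m : ℕ) :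
    (prior e lam).map (features e m)
      = multivariateGaussian 0 (diagonal fun j : Fin m => (lam j : ℝ)) := by
  have := isProbabilityMeasure_prior e hs
  have hf : Measurable (features e m) := by
    refine Continuous.measurable ?_
    unfold features; fun_prop
  conv_lhs => rw [← map_resample_prior e hs m]
  rw [Measure.map_map hf (measurable_resample e m)]
  have : features e m ∘ resample e m = Prod.fst := by
    ext1 p; exact features_resample e m p
  rw [this, Measure.map_fst_prod]
  simp

/-! ### The prior conditional on the features. -/

section Class

/-- The kernel `Π(· ∣ u)` obtained by resampling. -/
noncomputable def resampleKernel (e : HilbertBasis ℕ ℝ (L2 μ)) (lam : ℕ → ℝ≥0) (m : ℕ) :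
    Kernel (EuclideanSpace ℝ (Fin m)) (L2 μ) :=
  (Kernel.id ×ₖ Kernel.const _ (prior e lam)).map (resample e m)

lemma resampleKernel_apply (e : HilbertBasis ℕ ℝ (L2 μ)) (lam : ℕ → ℝ≥0) (m : ℕ)
    (u : EuclideanSpace ℝ (Fin m)) {s : Set (L2 μ)} (hs : MeasurableSet s) :
    resampleKernel e lam m u s = prior e lam {f | resample e m (u, f) ∈ s} := by
  rw [resampleKernel, Kernel.map_apply' _ (measurable_resample e m) _ hs, Kernel.prod_apply,
    Measure.prod_apply (measurable_resample e m hs)]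
  simp only [Kernel.id_apply, Kernel.const_apply]
  rw [lintegral_dirac]
  rfl

lemma bind_resampleKernel (e : HilbertBasis ℕ ℝ (L2 μ)) (lam : ℕ → ℝ≥0) (m : ℕ)
    (N : Measure (EuclideanSpace ℝ (Fin m))) [SFinite N] :
    N.bind (resampleKernel e lam m) = (N.prod (prior e lam)).map (resample e m) := by
  ext s hs
  rw [Measure.bind_apply hs (Kernel.aemeasurable _), Measure.map_apply (measurable_resample e m) hs,
    Measure.prod_apply (measurable_resample e m hs)]
  refine lintegral_congr fun u => ?_
  rw [resampleKernel_apply e lam m u hs]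
  rfl

variable [MeasurableSpace.CountablyGenerated 𝓧] [SFinite μ]

-- By `map_resample_prior`, the pair `(features f, f)` under the prior has the law of `(u, resample
-- (u, f))` with `u` and `f` independent. This exhibits a disintegration, and conditional
-- distributions are almost everywhere unique.
open Matrix in
lemma condDistrib_features (e : HilbertBasis ℕ ℝ (L2 μ)) {lam : ℕ → ℝ≥0} (hs : Summable lam)
    (m : ℕ) : condDistrib id (features e m) (prior e lam)
      =ᵐ[multivariateGaussian 0 (diagonal fun j : Fin m => (lam j : ℝ))]
        resampleKernel e lam m := by
  have := isProbabilityMeasure_prior e hs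
  have hf : Measurable (features e m) := by
    refine Continuous.measurable ?_
    unfold features; fun_prop
  rw [← prior_map_features e hs m]
  have : IsMarkovKernel (resampleKernel e lam m) :=
    Kernel.IsMarkovKernel.map _ (measurable_resample e m)
  refine condDistrib_ae_eq_of_measure_eq_compProd _ (by fun_prop) ?_
  rw [prior_map_features e hs m]
  conv_lhs => rw [← map_resample_prior e hs m]
  rw [Measure.map_map (by fun_prop) (measurable_resample e m)]
  have h1 : (fun f : L2 μ => (features e m f, id f)) ∘ resample e m
      = fun p => (p.1, resample e m p) := by
    ext1 p; simp [features_resample]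
  have hm : Measurable (fun p => (p.1, resample e m p)) :=
    measurable_fst.prodMk (measurable_resample e m)
  rw [h1]
  ext s hs
  rw [Measure.map_apply hm hs, Measure.compProd_apply hs, Measure.prod_apply (hm hs)]
  refine lintegral_congr fun u => ?_
  rw [resampleKernel_apply e lam m u (measurable_prodMk_left hs)]
  rfl

open Matrix in
/-- Members of the variational class, as laws of resampled functions. -/
lemma bind_condDistrib (e : HilbertBasis ℕ ℝ (L2 μ)) {lam : ℕ → ℝ≥0} (hs : Summable lam)
    (hpos : ∀ j, 0 < lam j) {m : ℕ} (a : EuclideanSpace ℝ (Fin m)) {S : Matrix (Fin m) (Fin m) ℝ}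
    (hS : S.PosDef) :
    (multivariateGaussian a S).bind (condDistrib id (features e m) (prior e lam))
      = ((multivariateGaussian a S).prod (prior e lam)).map (resample e m) := by
  rw [← bind_resampleKernel]
  refine Measure.bind_congr_right ?_
  exact (multivariateGaussian_absolutelyContinuous a 0 hS (posDef_diagonal_coe hpos)).ae_le
    (condDistrib_features e hs m)

end Class

end Prior

/-! ### Series functionals of the prior, in particular point evaluation. -/

section Moments

variable {𝓧 : Type*} [MeasurableSpace 𝓧] {μ : Measure 𝓧}

lemma summable_of_summable_sqrt {lam : ℕ → ℝ≥0} (hr : Summable fun j => NNReal.sqrt (lam j)) :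
    Summable lam := by
  refine NNReal.summable_of_le (fun j => ?_) (hr.mul_left (∑' j, NNReal.sqrt (lam j)))
  conv_lhs => rw [← NNReal.mul_self_sqrt (lam j)]
  exact mul_le_mul_left (hr.le_tsum j fun _ _ => zero_le) _

lemma lintegral_prior_coord_sq (e : HilbertBasis ℕ ℝ (L2 μ)) {lam : ℕ → ℝ≥0} (hs : Summable lam)
    (j : ℕ) : ∫⁻ f, ENNReal.ofReal (coords e f j ^ 2) ∂(prior e lam) = lam j := by
  rw [← lintegral_coord_sq lam j, ← prior_map_coords e hs,
    lintegral_map (((measurable_pi_apply j).pow_const 2).ennreal_ofReal) (measurable_coords e)]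

lemma measurable_coord (e : HilbertBasis ℕ ℝ (L2 μ)) (j : ℕ) : Measurable fun f => coords e f j :=
  (measurable_pi_apply j).comp (measurable_coords e)

lemma hasSum_coords_sq (e : HilbertBasis ℕ ℝ (L2 μ)) (f : L2 μ) :
    HasSum (fun j => coords e f j ^ 2) (‖f‖ ^ 2) := by
  have := e.hasSum_inner_mul_inner f f
  rw [real_inner_self_eq_norm_sq] at this
  refine this.congr_fun fun j => ?_
  rw [coords, sq, real_inner_comm f]

lemma lintegral_norm_tail_sq (e : HilbertBasis ℕ ℝ (L2 μ)) {lam : ℕ → ℝ≥0} (hs : Summable lam)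
    (m : ℕ) : ∫⁻ f, ENNReal.ofReal (‖f - headProj e m f‖ ^ 2) ∂(prior e lam)
      = ∑' j, if j < m then 0 else (lam j : ℝ≥0∞) := by
  have h1 : ∀ f : L2 μ, ENNReal.ofReal (‖f - headProj e m f‖ ^ 2)
      = ∑' j, if j < m then 0 else ENNReal.ofReal (coords e f j ^ 2) := by
    intro f
    have h := hasSum_coords_sq e (f - headProj e m f)
    rw [← h.tsum_eq, ENNReal.ofReal_tsum_of_nonneg (fun j => sq_nonneg _) h.summable]
    refine tsum_congr fun j => ?_
    rw [coords_tail]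
    split_ifs <;> simp
  simp_rw [h1]
  rw [lintegral_tsum]
  · refine tsum_congr fun j => ?_
    split_ifs
    · simp
    · exact lintegral_prior_coord_sq e hs j
  · intro j
    split_ifs
    · fun_prop
    · exact ((measurable_coord e j).pow_const 2).ennreal_ofReal.aemeasurable

/-- The linear functional `f ↦ ∑_j ⟨f, φ_j⟩ w_j`. -/
noncomputable def linFun (e : HilbertBasis ℕ ℝ (L2 μ)) (w : ℕ → ℝ) (f : L2 μ) : ℝ :=
  ∑' j, coords e f j * w j

lemma linFun_neg (e : HilbertBasis ℕ ℝ (L2 μ)) (w : ℕ → ℝ) (f : L2 μ) :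
    linFun e w (-f) = -linFun e w f := by
  simp only [linFun, coords, inner_neg_right, neg_mul, tsum_neg]

lemma integral_linFun (e : HilbertBasis ℕ ℝ (L2 μ)) {lam : ℕ → ℝ≥0} (hs : Summable lam)
    (w : ℕ → ℝ) : ∫ f, linFun e w f ∂(prior e lam) = 0 := by
  have h : ∫ f, linFun e w f ∂(prior e lam) = ∫ f, linFun e w (-f) ∂(prior e lam) := by
    conv_lhs => rw [← prior_map_neg e hs]
    exact (MeasurableEquiv.neg (L2 μ)).measurableEmbedding.integral_map _
  simp_rw [linFun_neg] at h
  rw [integral_neg] at h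
  exact self_eq_neg.1 h

/-- The weighted sum of squared coordinates that controls the series `∑_j |⟨f, φ_j⟩|`. -/
noncomputable def weightedSq (e : HilbertBasis ℕ ℝ (L2 μ)) (lam : ℕ → ℝ≥0) (f : L2 μ) (j : ℕ) : ℝ :=
  coords e f j ^ 2 / Real.sqrt (lam j)

lemma lintegral_tsum_weightedSq (e : HilbertBasis ℕ ℝ (L2 μ)) {lam : ℕ → ℝ≥0}
    (hs : Summable lam) :
    ∫⁻ f, ∑' j, ENNReal.ofReal (weightedSq e lam f j) ∂(prior e lam)
      = ∑' j, (NNReal.sqrt (lam j) : ℝ≥0∞) := by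
  have hmeas : ∀ j, Measurable fun f : L2 μ => ENNReal.ofReal (coords e f j ^ 2) := fun j =>
    ((measurable_coord e j).pow_const 2).ennreal_ofReal
  have hw : ∀ j (f : L2 μ), ENNReal.ofReal (weightedSq e lam f j)
      = ENNReal.ofReal (coords e f j ^ 2) * ENNReal.ofReal (Real.sqrt (lam j))⁻¹ := by
    intro j f
    rw [weightedSq, div_eq_mul_inv, ENNReal.ofReal_mul (sq_nonneg _)]
  simp_rw [hw]
  rw [lintegral_tsum fun j => ((hmeas j).mul_const _).aemeasurable]
  refine tsum_congr fun j => ?_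
  rw [lintegral_mul_const _ (hmeas j), lintegral_prior_coord_sq e hs,
    ← ENNReal.ofReal_coe_nnreal, ← ENNReal.ofReal_mul (by positivity),
    ← ENNReal.ofReal_coe_nnreal, Real.coe_sqrt, ← div_eq_mul_inv, Real.div_sqrt]

lemma ae_summable_weightedSq (e : HilbertBasis ℕ ℝ (L2 μ)) {lam : ℕ → ℝ≥0}
    (hr : Summable fun j => NNReal.sqrt (lam j)) :
    ∀ᵐ f ∂(prior e lam), Summable (weightedSq e lam f) := by
  have h1 : ∫⁻ f, ∑' j, ENNReal.ofReal (weightedSq e lam f j) ∂(prior e lam) ≠ ∞ := by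
    rw [lintegral_tsum_weightedSq e (summable_of_summable_sqrt hr)]
    exact ENNReal.tsum_coe_ne_top_iff_summable.2 hr
  have hm : Measurable fun f => ∑' j, ENNReal.ofReal (weightedSq e lam f j) := by
    refine Measurable.tsum fun j => ?_
    exact (((measurable_coord e j).pow_const 2).div_const _).ennreal_ofReal
  filter_upwards [ae_lt_top hm h1] with f hf
  exact summable_of_tsum_ofReal_ne_top (fun j => by unfold weightedSq; positivity) hf.ne

/-- Cauchy-Schwarz with weights `√λ_j`, which suits the prior: each factor on the right then has
expectation `∑ √λ_j`, so summability of `√λ_j` is all that is needed. -/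
lemma summable_abs_coords (e : HilbertBasis ℕ ℝ (L2 μ)) {lam : ℕ → ℝ≥0}
    (hr : Summable fun j => NNReal.sqrt (lam j)) (hpos : ∀ j, 0 < lam j) {f : L2 μ}
    (hf : Summable (weightedSq e lam f)) :
    Summable (fun j => |coords e f j|) ∧ (∑' j, |coords e f j|) ^ 2
      ≤ (∑' j, Real.sqrt (lam j)) * ∑' j, weightedSq e lam f j := by
  have hr' : Summable fun j => Real.sqrt (lam j) := by
    simpa using NNReal.summable_coe.2 hr
  have h0 : ∀ j, 0 ≤ weightedSq e lam f j := fun j => by unfold weightedSq; positivity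
  have hfin : ∀ u : Finset ℕ, ∑ j ∈ u, |coords e f j|
      ≤ Real.sqrt ((∑' j, Real.sqrt (lam j)) * ∑' j, weightedSq e lam f j) := by
    intro u
    refine Real.le_sqrt_of_sq_le ?_
    have := Finset.sum_sq_le_sum_mul_sum_of_sq_le_mul u (r := fun j => |coords e f j|)
      (f := fun j => Real.sqrt (lam j)) (g := weightedSq e lam f)
      (fun j _ => Real.sqrt_nonneg _) (fun j _ => h0 j) (fun j _ => by
        have : Real.sqrt (lam j) ≠ 0 := (Real.sqrt_pos.2 (by exact_mod_cast hpos j)).ne'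
        rw [weightedSq, sq_abs]
        field_simp
        rfl)
    refine this.trans (mul_le_mul (hr'.sum_le_tsum _ fun j _ => Real.sqrt_nonneg _)
      (hf.sum_le_tsum _ fun j _ => h0 j) (Finset.sum_nonneg fun j _ => h0 j)
      (tsum_nonneg fun j => Real.sqrt_nonneg _))
  refine ⟨summable_of_sum_le (fun j => abs_nonneg _) hfin, ?_⟩
  have h1 := Real.tsum_le_of_sum_le (fun j => abs_nonneg (coords e f j)) hfin
  have h2 := pow_le_pow_left₀ (tsum_nonneg fun j => abs_nonneg (coords e f j)) h1 2
  rwa [Real.sq_sqrt (mul_nonneg (tsum_nonneg fun j => Real.sqrt_nonneg _) (tsum_nonneg h0))] at h2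

lemma summable_linFun (e : HilbertBasis ℕ ℝ (L2 μ)) {w : ℕ → ℝ} {C : ℝ} (hw : ∀ j, |w j| ≤ C)
    {f : L2 μ} (hf : Summable fun j => |coords e f j|) :
    Summable (fun j => coords e f j * w j) ∧ |linFun e w f| ≤ C * ∑' j, |coords e f j| := by
  have hle : ∀ j, ‖coords e f j * w j‖ ≤ C * |coords e f j| := fun j => by
    rw [Real.norm_eq_abs, abs_mul, mul_comm]
    exact mul_le_mul_of_nonneg_right (hw j) (abs_nonneg _)
  have hs := Summable.of_norm_bounded (hf.mul_left C) hle
  refine ⟨hs, ?_⟩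
  rw [← tsum_mul_left]
  exact tsum_of_norm_bounded (hf.mul_left C).hasSum hle

/-- The square is at most `C² ∑ √λ_j` times the sum of `weightedSq`, whose prior expectation is
again `∑ √λ_j`. Applied to `w j = φ j x`, it makes the log-likelihood integrable. -/
lemma memLp_linFun (e : HilbertBasis ℕ ℝ (L2 μ)) {lam : ℕ → ℝ≥0}
    (hr : Summable fun j => NNReal.sqrt (lam j)) (hpos : ∀ j, 0 < lam j)
    {w : ℕ → ℝ} {C : ℝ} (hw : ∀ j, |w j| ≤ C) : MemLp (linFun e w) 2 (prior e lam) := by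
  have hs := summable_of_summable_sqrt hr
  have hae := ae_summable_weightedSq e hr
  have hm : AEStronglyMeasurable (linFun e w) (prior e lam) := by
    refine aestronglyMeasurable_of_tendsto_ae atTop
      (f := fun n f => ∑ j ∈ Finset.range n, coords e f j * w j) (fun n => ?_) ?_
    · exact (Finset.measurable_sum _
        fun j _ => (measurable_coord e j).mul_const _).aestronglyMeasurable
    · filter_upwards [hae] with f hf
      exact (summable_linFun e hw (summable_abs_coords e hr hpos hf).1).1.hasSum.tendsto_sum_nat
  rw [memLp_two_iff_integrable_sq hm]
  set A := C ^ 2 * ∑' j, Real.sqrt (lam j) with hA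
  have hw0 : ∀ f j, 0 ≤ weightedSq e lam f j := fun f j => by unfold weightedSq; positivity
  refine ⟨hm.pow 2, ?_⟩
  refine lt_of_le_of_lt (lintegral_mono_ae (g := fun f =>
    ENNReal.ofReal A * ∑' j, ENNReal.ofReal (weightedSq e lam f j)) ?_) ?_
  · filter_upwards [hae] with f hf
    obtain ⟨h1, h2⟩ := summable_abs_coords e hr hpos hf
    rw [← ENNReal.ofReal_tsum_of_nonneg (hw0 f) hf,
      ← ENNReal.ofReal_mul (mul_nonneg (sq_nonneg _) (tsum_nonneg fun j => Real.sqrt_nonneg _)),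
      ← ofReal_norm, Real.norm_eq_abs, abs_pow]
    refine ENNReal.ofReal_le_ofReal ?_
    have h3 := pow_le_pow_left₀ (abs_nonneg _) (summable_linFun e hw h1).2 2
    rw [mul_pow] at h3
    rw [mul_assoc]
    exact h3.trans (mul_le_mul_of_nonneg_left h2 (sq_nonneg _))
  · rw [lintegral_const_mul' _ _ ENNReal.ofReal_ne_top, lintegral_tsum_weightedSq e hs]
    exact ENNReal.mul_lt_top ENNReal.ofReal_lt_top
      (ENNReal.tsum_coe_ne_top_iff_summable.2 hr).lt_top

lemma evalAt_eq_linFun (φ : ℕ → 𝓧 → ℝ) (e : HilbertBasis ℕ ℝ (L2 μ)) (f : L2 μ) (x : 𝓧) :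
    evalAt φ e f x = linFun e (fun j => φ j x) f := rfl

/-- The weights of the part of a series functional that does not depend on the first `m`
coordinates. -/
def tailWeight (m : ℕ) (w : ℕ → ℝ) (j : ℕ) : ℝ := if j < m then 0 else w j

lemma abs_tailWeight_le {m : ℕ} {w : ℕ → ℝ} {C : ℝ} (hw : ∀ j, |w j| ≤ C) (j : ℕ) :
    |tailWeight m w j| ≤ C := by
  unfold tailWeight
  split_ifs
  · simpa using (abs_nonneg _).trans (hw j)
  · exact hw j

lemma linFun_resample (e : HilbertBasis ℕ ℝ (L2 μ)) {w : ℕ → ℝ} {C : ℝ} (hw : ∀ j, |w j| ≤ C)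
    {m : ℕ} (u : EuclideanSpace ℝ (Fin m)) {f : L2 μ} (hf : Summable fun j => |coords e f j|) :
    linFun e w (resample e m (u, f)) = ∑ i : Fin m, u i * w i + linFun e (tailWeight m w) f := by
  have h1 : HasSum (fun j : ℕ => if h : j < m then u ⟨j, h⟩ * w j else 0)
      (∑ i : Fin m, u i * w i) := by
    have : ∑ i : Fin m, u i * w i
        = ∑ j ∈ Finset.range m, (fun j : ℕ => if h : j < m then u ⟨j, h⟩ * w j else 0) j := by
      rw [← Fin.sum_univ_eq_sum_range]
      exact Finset.sum_congr rfl fun i _ => by simp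
    rw [this]
    refine hasSum_sum_of_ne_finset_zero fun j hj => ?_
    rw [dif_neg (by simpa using hj)]
  have h2 := (summable_linFun e (abs_tailWeight_le (m := m) hw) hf).1.hasSum
  refine Eq.trans (tsum_congr fun j => ?_) (h1.add h2).tsum_eq
  rw [coords_resample]
  unfold tailWeight
  split_ifs <;> simp

end Moments

/-! ### Conjugate Gaussian regression on the first `m` features. -/

section Precision

open Matrix

variable {𝓧 : Type*} {n : ℕ}

/-- The values of the first `m` basis functions at the design points. -/
def designMatrix (φ : ℕ → 𝓧 → ℝ) (m : ℕ) (x : Fin n → 𝓧) : Matrix (Fin n) (Fin m) ℝ :=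
  of fun i j => φ j (x i)

/-- The precision matrix of the variational posterior of the features. -/
noncomputable def precision (φ : ℕ → 𝓧 → ℝ) (lam : ℕ → ℝ≥0) (σ : ℝ≥0) (m : ℕ) (x : Fin n → 𝓧) :
    Matrix (Fin m) (Fin m) ℝ :=
  diagonal (fun j : Fin m => (lam j : ℝ)⁻¹) +
    ((σ : ℝ) ^ 2)⁻¹ • ((designMatrix φ m x)ᵀ * designMatrix φ m x)

/-- The mean of the variational posterior of the features. -/
noncomputable def featureMean (φ : ℕ → 𝓧 → ℝ) (lam : ℕ → ℝ≥0) (σ : ℝ≥0) (m : ℕ) (x : Fin n → 𝓧)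
    (y : Fin n → ℝ) : EuclideanSpace ℝ (Fin m) :=
  WithLp.toLp 2 ((precision φ lam σ m x)⁻¹ *ᵥ (((σ : ℝ) ^ 2)⁻¹ • ((designMatrix φ m x)ᵀ *ᵥ y)))

/-- The regression function with coefficients `u`, at the design points. -/
def predict (φ : ℕ → 𝓧 → ℝ) {m : ℕ} (x : Fin n → 𝓧) (u : Fin m → ℝ) (i : Fin n) : ℝ :=
  ∑ j : Fin m, u j * φ j (x i)

lemma designMatrix_mulVec (φ : ℕ → 𝓧 → ℝ) {m : ℕ} (x : Fin n → 𝓧) (u : Fin m → ℝ) :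
    designMatrix φ m x *ᵥ u = predict φ x u := by
  ext i
  simp [designMatrix, predict, mulVec, dotProduct, mul_comm]

variable {φ : ℕ → 𝓧 → ℝ} {lam : ℕ → ℝ≥0} {σ : ℝ≥0} {m : ℕ}

lemma posDef_precision (hpos : ∀ j, 0 < lam j) (x : Fin n → 𝓧) :
    (precision φ lam σ m x).PosDef := by
  refine PosDef.add_posSemidef (posDef_diagonal_iff.2 fun j => ?_) (PosSemidef.smul ?_ ?_)
  · have := hpos j
    positivity
  · simpa [conjTranspose_eq_transpose_of_trivial] using
      posSemidef_conjTranspose_mul_self (designMatrix φ m x)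
  · positivity

lemma dotProduct_precision (x : Fin n → 𝓧) (w v : Fin m → ℝ) :
    w ⬝ᵥ precision φ lam σ m x *ᵥ v
      = ∑ j : Fin m, w j * v j / lam j + (∑ i, predict φ x w i * predict φ x v i) / (σ : ℝ) ^ 2 := by
  rw [precision, add_mulVec, dotProduct_add, smul_mulVec, dotProduct_smul, ← mulVec_mulVec,
    dotProduct_mulVec w (designMatrix φ m x)ᵀ, vecMul_transpose, designMatrix_mulVec,
    designMatrix_mulVec]
  congr 1
  · simp only [dotProduct, mulVec_diagonal]
    exact Finset.sum_congr rfl fun j _ => by ring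
  · rw [smul_eq_mul, div_eq_inv_mul]; rfl

lemma precision_mulVec_featureMean (hpos : ∀ j, 0 < lam j) (x : Fin n → 𝓧) (y : Fin n → ℝ) :
    precision φ lam σ m x *ᵥ (featureMean φ lam σ m x y).ofLp
      = ((σ : ℝ) ^ 2)⁻¹ • ((designMatrix φ m x)ᵀ *ᵥ y) := by
  rw [featureMean, mulVec_mulVec,
    mul_nonsing_inv _ (posDef_precision hpos x).det_pos.ne'.isUnit, one_mulVec]

/-- The normal equations. -/
lemma normal_equations (hpos : ∀ j, 0 < lam j) (x : Fin n → 𝓧) (y : Fin n → ℝ) (w : Fin m → ℝ) :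
    ∑ j : Fin m, w j * featureMean φ lam σ m x y j / lam j
      + (∑ i, predict φ x w i * predict φ x (featureMean φ lam σ m x y).ofLp i) / (σ : ℝ) ^ 2
      = (∑ i, predict φ x w i * y i) / (σ : ℝ) ^ 2 := by
  rw [← dotProduct_precision (φ := φ) (lam := lam) (σ := σ), precision_mulVec_featureMean hpos,
    dotProduct_smul, dotProduct_mulVec w, vecMul_transpose, designMatrix_mulVec, smul_eq_mul,
    div_eq_inv_mul]
  rfl

lemma precision_symm (x : Fin n → 𝓧) (w v : Fin m → ℝ) :
    w ⬝ᵥ precision φ lam σ m x *ᵥ v = v ⬝ᵥ precision φ lam σ m x *ᵥ w := by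
  rw [dotProduct_precision, dotProduct_precision]
  simp_rw [mul_comm]

/-- The log-likelihood of the regression function with coefficients `u`. -/
noncomputable def headLik (φ : ℕ → 𝓧 → ℝ) (σ : ℝ≥0) {m : ℕ} (x : Fin n → 𝓧) (y : Fin n → ℝ)
    (u : EuclideanSpace ℝ (Fin m)) : ℝ :=
  -(∑ i, (y i - predict φ x u.ofLp i) ^ 2) / (2 * (σ : ℝ) ^ 2)

lemma headLik_nonpos (x : Fin n → 𝓧) (y : Fin n → ℝ) (u : EuclideanSpace ℝ (Fin m)) :
    headLik φ σ x y u ≤ 0 := by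
  unfold headLik
  rw [neg_div, neg_nonpos]
  positivity

lemma continuous_predict (x : Fin n → 𝓧) (i : Fin n) :
    Continuous fun u : EuclideanSpace ℝ (Fin m) => predict φ x u.ofLp i := by
  unfold predict; fun_prop

lemma measurable_headLik (x : Fin n → 𝓧) (y : Fin n → ℝ) :
    Measurable (headLik (m := m) φ σ x y) := by
  refine Continuous.measurable ?_
  have := fun i => continuous_predict (φ := φ) (m := m) x i
  unfold headLik; fun_prop

/-- Completing the square: the normal equations tested with `u` match the terms linear in `u`. What
remains is the constant `c`, which normalisation removes. -/
lemma multivariateGaussian_tilted_headLik (hpos : ∀ j, 0 < lam j) (x : Fin n → 𝓧)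
    (y : Fin n → ℝ) :
    (multivariateGaussian 0 (diagonal fun j : Fin m => (lam j : ℝ))).tilted (headLik φ σ x y)
      = multivariateGaussian (featureMean φ lam σ m x y) (precision φ lam σ m x)⁻¹ := by
  have hQ : (diagonal fun j : Fin m => (lam j : ℝ)⁻¹).PosDef :=
    posDef_diagonal_iff.2 fun j => by have := hpos j; positivity
  have hinv : (diagonal fun j : Fin m => (lam j : ℝ)) = (diagonal fun j : Fin m => (lam j : ℝ)⁻¹)⁻¹ := by
    refine (inv_eq_left_inv ?_).symm
    rw [diagonal_mul_diagonal, ← diagonal_one]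
    congr 1
    ext j
    exact mul_inv_cancel₀ (by have := (hpos j).ne'; exact_mod_cast this)
  rw [hinv]
  set a := featureMean φ lam σ m x y with ha
  set P := precision φ lam σ m x with hPdef
  refine multivariateGaussian_tilted (posDef_precision hpos x) hQ
    (c := (a.ofLp ⬝ᵥ P *ᵥ a.ofLp) / 2 - (∑ i, y i ^ 2) / (2 * (σ : ℝ) ^ 2)) fun u => ?_
  unfold gaussLogDensity headLik
  rw [sub_zero, WithLp.ofLp_sub, mulVec_sub, dotProduct_sub, sub_dotProduct, sub_dotProduct,
    precision_symm x a.ofLp u.ofLp, dotProduct_precision x u.ofLp a.ofLp,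
    normal_equations hpos x y u.ofLp, dotProduct_precision x u.ofLp u.ofLp]
  have h1 : ∑ i, (y i - predict φ x u.ofLp i) ^ 2 = ∑ i, y i ^ 2
      - 2 * ∑ i, predict φ x u.ofLp i * y i + ∑ i, predict φ x u.ofLp i * predict φ x u.ofLp i := by
    rw [Finset.mul_sum, ← Finset.sum_sub_distrib, ← Finset.sum_add_distrib]
    exact Finset.sum_congr rfl fun i _ => by ring
  have h2 : u.ofLp ⬝ᵥ (diagonal fun j : Fin m => (lam j : ℝ)⁻¹) *ᵥ u.ofLp
      = ∑ j : Fin m, u.ofLp j * u.ofLp j / lam j := by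
    simp only [dotProduct, mulVec_diagonal]
    exact Finset.sum_congr rfl fun j _ => by ring
  rw [h1, h2]
  ring

end Precision

/-! ### The variational posterior is the conjugate posterior with the prior tail. -/

section Identification

open Matrix

variable {𝓧 : Type*} [MeasurableSpace 𝓧] {μ : Measure 𝓧}

variable {φ : ℕ → 𝓧 → ℝ} {e : HilbertBasis ℕ ℝ (L2 μ)} {lam : ℕ → ℝ≥0} {σ : ℝ≥0} {m n : ℕ}

lemma measurable_features (e : HilbertBasis ℕ ℝ (L2 μ)) (m : ℕ) : Measurable (features e m) := by
  refine Continuous.measurable ?_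
  unfold features; fun_prop

/-- After resampling, the tilt depends on the independent factor `u` only, so it updates the law of
the features and leaves the tail alone. -/
lemma tilted_headLik_features (hs : Summable lam) (hpos : ∀ j, 0 < lam j) (x : Fin n → 𝓧)
    (y : Fin n → ℝ) :
    (prior e lam).tilted (fun f => headLik φ σ x y (features e m f))
      = ((multivariateGaussian (featureMean φ lam σ m x y) (precision φ lam σ m x)⁻¹).prod
          (prior e lam)).map (resample e m) := by
  have := isProbabilityMeasure_prior e hs
  conv_lhs => rw [← map_resample_prior e hs m]
  rw [← map_tilted_comp _ (measurable_resample e m)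
    (h := fun f => headLik φ σ x y (features e m f))
    ((measurable_headLik x y).comp (measurable_features e m))]
  simp_rw [features_resample]
  rw [← prod_tilted_left _ _ (measurable_headLik x y), multivariateGaussian_tilted_headLik hpos]

lemma aestronglyMeasurable_logLik {C : ℝ} (hφ : ∀ j x, |φ j x| ≤ C)
    (hr : Summable fun j => NNReal.sqrt (lam j)) (hpos : ∀ j, 0 < lam j) (x : Fin n → 𝓧)
    (y : Fin n → ℝ) : AEStronglyMeasurable (logLik φ e σ x y) (prior e lam) := by
  have := fun i => (memLp_linFun e hr hpos (fun j => hφ j (x i))).1.aemeasurable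
  refine AEMeasurable.aestronglyMeasurable ?_
  unfold logLik
  simp_rw [evalAt_eq_linFun]
  fun_prop

/-- Under the law of resampled functions, the expected difference of the two log-likelihoods does
not depend on the law of the features. -/
lemma integral_headLik_sub_logLik {C : ℝ} (hφ : ∀ j x, |φ j x| ≤ C)
    (hr : Summable fun j => NNReal.sqrt (lam j)) (hpos : ∀ j, 0 < lam j)
    (x : Fin n → 𝓧) (y : Fin n → ℝ) (N : Measure (EuclideanSpace ℝ (Fin m))) [IsGaussian N]
    (hN : N ≪ multivariateGaussian 0 (diagonal fun j : Fin m => (lam j : ℝ))) :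
    let Ψ := (N.prod (prior e lam)).map (resample e m)
    Ψ ≪ prior e lam ∧ Integrable (logLik φ e σ x y) Ψ ∧
      Integrable (fun f => headLik φ σ x y (features e m f)) Ψ ∧
      ∫ f, (headLik φ σ x y (features e m f) - logLik φ e σ x y f) ∂Ψ
        = (∑ i, ∫ f, linFun e (tailWeight m fun j => φ j (x i)) f ^ 2 ∂(prior e lam))
          / (2 * (σ : ℝ) ^ 2) := by
  intro Ψ
  have hs := summable_of_summable_sqrt hr
  have := isProbabilityMeasure_prior e hs
  have hac : Ψ ≪ prior e lam := by
    conv_rhs => rw [← map_resample_prior e hs m]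
    exact (hN.prod Measure.AbsolutelyContinuous.rfl).map (measurable_resample e m)
  set t : Fin n → L2 μ → ℝ := fun i => linFun e (tailWeight m fun j => φ j (x i)) with ht
  set A : Fin n → EuclideanSpace ℝ (Fin m) → ℝ := fun i u => y i - predict φ x u.ofLp i with hA
  have htL : ∀ i, MemLp (t i) 2 (prior e lam) := fun i =>
    memLp_linFun e hr hpos (abs_tailWeight_le fun j => hφ j (x i))
  have hAL : ∀ i, MemLp (A i) 2 N := by
    intro i
    have hid : MemLp (fun u : EuclideanSpace ℝ (Fin m) => u) 2 N := IsGaussian.memLp_two_id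
    have hj : ∀ j : Fin m, MemLp (fun u : EuclideanSpace ℝ (Fin m) => u j * φ j (x i)) 2 N :=
      fun j => by
        have := (ContinuousLinearMap.comp_memLp' (EuclideanSpace.proj (𝕜 := ℝ) j) hid).mul_const
          (φ j (x i))
        exact this
    exact (memLp_const (y i)).sub (memLp_finsetSum Finset.univ fun j _ => hj j)
  have hAL' : ∀ i, MemLp (fun p : EuclideanSpace ℝ (Fin m) × L2 μ => A i p.1) 2
      (N.prod (prior e lam)) := fun i => (hAL i).comp_fst _
  have htL' : ∀ i, MemLp (fun p : EuclideanSpace ℝ (Fin m) × L2 μ => t i p.2) 2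
      (N.prod (prior e lam)) := fun i => (htL i).comp_snd _
  have hDL : ∀ i, Integrable (fun p : EuclideanSpace ℝ (Fin m) × L2 μ => (A i p.1 - t i p.2) ^ 2)
      (N.prod (prior e lam)) := fun i => ((hAL' i).sub (htL' i)).integrable_sq
  have hgood : ∀ᵐ p ∂(N.prod (prior e lam)), ∀ i,
      evalAt φ e (resample e m p) (x i) = predict φ x p.1.ofLp i + t i p.2 := by
    have h1 : ∀ᵐ p ∂(N.prod (prior e lam)), Summable (weightedSq e lam p.2) :=
      Measure.quasiMeasurePreserving_snd.ae (ae_summable_weightedSq e hr)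
    filter_upwards [h1] with p hp i
    exact linFun_resample e (fun j => hφ j (x i)) p.1 (summable_abs_coords e hr hpos hp).1
  have hℓ : (fun p => logLik φ e σ x y (resample e m p)) =ᵐ[N.prod (prior e lam)]
      fun p => -(∑ i, (A i p.1 - t i p.2) ^ 2) / (2 * (σ : ℝ) ^ 2) := by
    filter_upwards [hgood] with p hp
    unfold logLik
    simp_rw [hp, hA, sub_sub]
  have hh : (fun p => headLik φ σ x y (features e m (resample e m p)))
      = fun p => -(∑ i, (A i p.1) ^ 2) / (2 * (σ : ℝ) ^ 2) := by
    ext p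
    rw [features_resample]; rfl
  have hℓm : AEStronglyMeasurable (logLik φ e σ x y) Ψ :=
    (aestronglyMeasurable_logLik hφ hr hpos x y).mono_ac hac
  have hhm : Measurable (fun f => headLik φ σ x y (features e m f)) :=
    (measurable_headLik x y).comp (measurable_features e m)
  have hres := measurable_resample e m
  have hiℓ : Integrable (logLik φ e σ x y) Ψ := by
    rw [integrable_map_measure hℓm hres.aemeasurable]
    exact (integrable_congr hℓ).2
      ((integrable_finsetSum _ fun i _ => hDL i).neg.div_const _)
  have hih : Integrable (fun f => headLik φ σ x y (features e m f)) Ψ := by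
    rw [integrable_map_measure hhm.aestronglyMeasurable hres.aemeasurable]
    simp only [Function.comp_def]
    rw [hh]
    exact (integrable_finsetSum _ fun i _ => (hAL' i).integrable_sq).neg.div_const _
  refine ⟨hac, hiℓ, hih, ?_⟩
  have hmapint := integral_map (f := fun f => headLik φ σ x y (features e m f) - logLik φ e σ x y f)
    hres.aemeasurable (hih.sub hiℓ).1
  rw [hmapint]
  -- Expanding `(A - t)²` cancels `A²`. The cross term `A t` will integrate to zero, as `t` is
  -- centered and independent of the features; `t²` involves the prior alone.
  have hdiff : (fun p => headLik φ σ x y (features e m (resample e m p))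
      - logLik φ e σ x y (resample e m p)) =ᵐ[N.prod (prior e lam)]
      fun p => (∑ i, (t i p.2 ^ 2 - 2 * (A i p.1 * t i p.2))) / (2 * (σ : ℝ) ^ 2) := by
    filter_upwards [hℓ] with p hp
    rw [hp, congrFun hh p, ← sub_div, neg_sub_neg, ← Finset.sum_sub_distrib]
    congr 1
    exact Finset.sum_congr rfl fun i _ => by ring
  rw [integral_congr_ae hdiff, integral_div]
  have hAt : ∀ i, Integrable (fun p : EuclideanSpace ℝ (Fin m) × L2 μ => A i p.1 * t i p.2)
      (N.prod (prior e lam)) := fun i =>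
    ((hAL i).integrable (by simp)).mul_prod ((htL i).integrable (by simp))
  have hsub : ∀ i, Integrable (fun p : EuclideanSpace ℝ (Fin m) × L2 μ =>
      t i p.2 ^ 2 - 2 * (A i p.1 * t i p.2)) (N.prod (prior e lam)) := fun i =>
    ((htL' i).integrable_sq).sub ((hAt i).const_mul 2)
  rw [integral_finsetSum _ fun i _ => hsub i]
  congr 1
  refine Finset.sum_congr rfl fun i _ => ?_
  rw [integral_sub (htL' i).integrable_sq ((hAt i).const_mul 2), integral_const_mul,
    integral_prod_mul (A i) (t i), ht, integral_linFun e hs, mul_zero, mul_zero, sub_zero,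
    integral_fun_snd (fun f => linFun e (tailWeight m fun j => φ j (x i)) f ^ 2)]
  simp

/-- The conjugate law is itself in the class, so the minimiser `Ψ` does at least as well. The
expectation of `headLik - logLik` agrees under both, and `eq_tilted_of_klDiv_le` then leaves no room
for another minimiser. -/
lemma eq_of_isVariationalPosterior [MeasurableSpace.CountablyGenerated 𝓧] [SFinite μ]
    {C : ℝ} (hφ : ∀ j x, |φ j x| ≤ C)
    (hr : Summable fun j => NNReal.sqrt (lam j)) (hpos : ∀ j, 0 < lam j)
    {x : Fin n → 𝓧} {y : Fin n → ℝ} {Ψ : Measure (L2 μ)}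
    (hΨ : IsVariationalPosterior φ e lam σ m x y Ψ) :
    Ψ = ((multivariateGaussian (featureMean φ lam σ m x y) (precision φ lam σ m x)⁻¹).prod
          (prior e lam)).map (resample e m) := by
  have hs := summable_of_summable_sqrt hr
  have := isProbabilityMeasure_prior e hs
  have hPd := (posDef_precision (φ := φ) (lam := lam) (σ := σ) (m := m) hpos x).inv
  have hdiag := posDef_diagonal_coe (m := m) hpos
  obtain ⟨⟨a, S, hS, hΨeq⟩, hmin⟩ := hΨ
  have hle := hmin _ ⟨featureMean φ lam σ m x y, (precision φ lam σ m x)⁻¹, hPd, rfl⟩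
  rw [bind_condDistrib e hs hpos a hS] at hΨeq
  rw [bind_condDistrib e hs hpos _ hPd, ← tilted_headLik_features hs hpos] at hle
  rw [← tilted_headLik_features hs hpos]
  obtain ⟨h1, h2, h3, h4⟩ := integral_headLik_sub_logLik (e := e) (σ := σ) hφ hr hpos x y
    (multivariateGaussian a S) (multivariateGaussian_absolutelyContinuous a 0 hS hdiag)
  obtain ⟨h1', h2', h3', h4'⟩ := integral_headLik_sub_logLik (e := e) (σ := σ) hφ hr hpos x y
    (multivariateGaussian (featureMean φ lam σ m x y) (precision φ lam σ m x)⁻¹)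
    (multivariateGaussian_absolutelyContinuous _ 0 hPd hdiag)
  rw [← tilted_headLik_features hs hpos] at h2' h3' h4'
  rw [← hΨeq] at h1 h2 h3 h4
  have : IsProbabilityMeasure Ψ := by
    rw [hΨeq]
    exact Measure.isProbabilityMeasure_map (measurable_resample e m).aemeasurable
  refine eq_tilted_of_klDiv_le ?_ ?_ h1 h2 h3 h2' h3' (h4.trans h4'.symm) hle
  · refine Integrable.of_bound
      (Real.continuous_exp.comp_aestronglyMeasurable (aestronglyMeasurable_logLik hφ hr hpos x y)) 1
      (ae_of_all _ fun f => ?_)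
    rw [Real.norm_eq_abs, abs_of_pos (Real.exp_pos _), Real.exp_le_one_iff, logLik, neg_div,
      neg_nonpos]
    positivity
  · refine Integrable.of_bound
      (((measurable_headLik x y).comp (measurable_features e m)).exp.aestronglyMeasurable) 1
      (ae_of_all _ fun f => ?_)
    rw [Real.norm_eq_abs, abs_of_pos (Real.exp_pos _), Real.exp_le_one_iff]
    exact headLik_nonpos x y _

end Identification

/-! ### Gaussian small-ball probabilities. -/

section SmallBall

/-- The Laplace transform of `Z²` at `1`, for a standard normal `Z`. -/
noncomputable def normalLaplace : ℝ := ∫ z, Real.exp (-z ^ 2) ∂(gaussianReal 0 1)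

lemma integrable_exp_neg_mul_sq {s : ℝ} (hs : 0 ≤ s) (ν : Measure ℝ) [IsFiniteMeasure ν] :
    Integrable (fun z => Real.exp (-(s * z ^ 2))) ν := by
  refine Integrable.of_bound (by fun_prop) 1 (ae_of_all _ fun z => ?_)
  rw [Real.norm_eq_abs, abs_of_pos (Real.exp_pos _), Real.exp_le_one_iff]
  have := mul_nonneg hs (sq_nonneg z)
  linarith

lemma normalLaplace_pos : 0 < normalLaplace := by
  have := integrable_exp_neg_mul_sq zero_le_one (gaussianReal 0 1)
  simp only [one_mul] at this
  exact integral_exp_pos this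

lemma normalLaplace_lt_one : normalLaplace < 1 := by
  have hi := integrable_exp_neg_mul_sq zero_le_one (gaussianReal 0 1)
  simp only [one_mul] at hi
  have h0 : 0 ≤ fun z : ℝ => 1 - Real.exp (-z ^ 2) := fun z => by
    have : Real.exp (-z ^ 2) ≤ 1 := Real.exp_le_one_iff.2 (by nlinarith [sq_nonneg z])
    simpa using this
  have hsub : Integrable (fun z : ℝ => 1 - Real.exp (-z ^ 2)) (gaussianReal 0 1) :=
    (integrable_const 1).sub hi
  have hpos : 0 < ∫ z, (1 - Real.exp (-z ^ 2)) ∂(gaussianReal 0 1) := by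
    rw [integral_pos_iff_support_of_nonneg h0 hsub]
    have hsupp : ({0}ᶜ : Set ℝ) ⊆ Function.support fun z : ℝ => 1 - Real.exp (-z ^ 2) := by
      intro z hz
      have hz' : z ≠ 0 := hz
      have : Real.exp (-z ^ 2) < 1 := Real.exp_lt_one_iff.2 (by have := sq_pos_of_ne_zero hz'; linarith)
      simp only [Function.mem_support]
      linarith
    refine lt_of_lt_of_le ?_ (measure_mono hsupp)
    have := nullSingletonClass_gaussianReal (μ := 0) (v := 1) one_ne_zero
    rw [measure_compl (measurableSet_singleton _) (measure_ne_top _ _), measure_singleton]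
    simp
  rw [integral_sub (integrable_const 1) hi] at hpos
  simp only [integral_const, probReal_univ, smul_eq_mul, one_mul] at hpos
  unfold normalLaplace
  linarith

/-- Small-ball constant. -/
noncomputable def smallBallConst : ℝ := -Real.log normalLaplace / 2

/-- Small-ball rate. -/
noncomputable def smallBallRate : ℝ := Real.sqrt normalLaplace

lemma smallBallConst_pos : 0 < smallBallConst := by
  have := Real.log_neg normalLaplace_pos normalLaplace_lt_one
  unfold smallBallConst
  linarith

lemma smallBallRate_nonneg : 0 ≤ smallBallRate := Real.sqrt_nonneg _

lemma smallBallRate_lt_one : smallBallRate < 1 := by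
  rw [smallBallRate, Real.sqrt_lt' one_pos]
  simpa using normalLaplace_lt_one

lemma exp_smallBallConst_mul : Real.exp smallBallConst * normalLaplace = smallBallRate := by
  have h := normalLaplace_pos
  have h1 : Real.exp smallBallConst * Real.sqrt normalLaplace = 1 := by
    rw [smallBallConst, Real.sqrt_eq_rpow, Real.rpow_def_of_pos h, ← Real.exp_add,
      Real.exp_eq_one_iff]
    ring
  conv_lhs => rw [← Real.mul_self_sqrt h.le]
  rw [← mul_assoc, h1, one_mul]; rfl

lemma integral_exp_neg_sq_div_le {s : ℝ} (hs : 0 < s) {v : ℝ≥0} (hv : s ≤ v) :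
    ∫ z, Real.exp (-(s⁻¹ * z ^ 2)) ∂(gaussianReal 0 v) ≤ normalLaplace := by
  have hmap : (gaussianReal 0 1).map (fun z => Real.sqrt v * z) = gaussianReal 0 v := by
    rw [gaussianReal_map_const_mul]
    congr 1
    · simp
    · ext; simp
  rw [← hmap, integral_map (by fun_prop) (by fun_prop)]
  have hi := integrable_exp_neg_mul_sq zero_le_one (gaussianReal 0 1)
  simp only [one_mul] at hi
  refine integral_mono_of_nonneg (ae_of_all _ fun z => (Real.exp_pos _).le) hi
    (ae_of_all _ fun z => Real.exp_le_exp.2 (neg_le_neg ?_))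
  rw [mul_pow, Real.sq_sqrt v.coe_nonneg, ← mul_assoc]
  have : 1 ≤ s⁻¹ * v := by rwa [inv_mul_eq_div, one_le_div hs]
  nlinarith [sq_nonneg z]

/-- Chernoff bound with `exp (-∑ z_i²/s)`: with `L = normalLaplace`, each factor has mean at most
`L`. The choice `smallBallConst = -log L / 2` makes the bound `exp (c |I|) L^|I| = (√L)^|I|`, hence
geometric decay in the number of coordinates. -/
lemma smallBall {ι : Type*} [Fintype ι] (v : ι → ℝ≥0) (I : Finset ι) {s : ℝ} (hs : 0 < s)
    (hv : ∀ i ∈ I, s ≤ v i) :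
    (Measure.pi fun i => gaussianReal 0 (v i))
      {z | ∑ i ∈ I, z i ^ 2 ≤ s * smallBallConst * I.card}
      ≤ ENNReal.ofReal (smallBallRate ^ I.card) := by
  classical
  set ν := Measure.pi fun i => gaussianReal 0 (v i) with hν
  set c := smallBallConst with hc
  set g : ι → ℝ → ℝ := fun i z => if i ∈ I then Real.exp (-(s⁻¹ * z ^ 2)) else 1 with hg
  have hgi : ∀ i, Integrable (g i) (gaussianReal 0 (v i)) := by
    intro i
    by_cases hi : i ∈ I
    · simpa [hg, hi] using integrable_exp_neg_mul_sq (inv_nonneg.2 hs.le) (gaussianReal 0 (v i))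
    · simp [hg, hi]
  have hgn : ∀ i z, 0 ≤ g i z := fun i z => by
    simp only [hg]; split_ifs <;> positivity
  have hprod : Integrable (fun z : ι → ℝ => ∏ i, g i (z i)) ν := Integrable.fintype_prod hgi
  have hint : ∫ z, ∏ i, g i (z i) ∂ν ≤ normalLaplace ^ I.card := by
    rw [hν, integral_fintype_prod_eq_prod]
    calc ∏ i, ∫ z, g i z ∂(gaussianReal 0 (v i))
        ≤ ∏ i, if i ∈ I then normalLaplace else 1 := by
          refine Finset.prod_le_prod (fun i _ => integral_nonneg (hgn i)) fun i _ => ?_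
          by_cases hi : i ∈ I
          · simpa [hg, hi] using integral_exp_neg_sq_div_le hs (hv i hi)
          · simp [hg, hi]
      _ = normalLaplace ^ I.card := by simp
  have hmul : ENNReal.ofReal (Real.exp (-(c * I.card))) *
      ν {z | ∑ i ∈ I, z i ^ 2 ≤ s * c * I.card} ≤ ENNReal.ofReal (normalLaplace ^ I.card) := by
    have hm : Measurable fun z : ι → ℝ => ENNReal.ofReal (∏ i, g i (z i)) := by
      refine (Finset.measurable_prod _ fun i _ => ?_).ennreal_ofReal
      simp only [hg]
      split_ifs <;> fun_prop
    refine le_trans ?_ ((mul_meas_ge_le_lintegral (μ := ν) hm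
      (ENNReal.ofReal (Real.exp (-(c * I.card))))).trans ?_)
    · refine mul_le_mul_right (measure_mono fun z hz => ?_) _
      simp only [Set.mem_ofPred_eq] at hz ⊢
      refine ENNReal.ofReal_le_ofReal ?_
      have : ∏ i, g i (z i) = Real.exp (-(s⁻¹ * ∑ i ∈ I, z i ^ 2)) := by
        rw [Finset.mul_sum, ← Finset.sum_neg_distrib, Real.exp_sum]
        simp [hg]
      rw [this, Real.exp_le_exp, neg_le_neg_iff, inv_mul_le_iff₀ hs]
      linarith
    · rw [← ofReal_integral_eq_lintegral_ofReal hprod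
        (ae_of_all _ fun z => Finset.prod_nonneg fun i _ => hgn i _)]
      exact ENNReal.ofReal_le_ofReal hint
  have hE : ENNReal.ofReal (Real.exp (c * I.card)) * ENNReal.ofReal (Real.exp (-(c * I.card))) = 1 := by
    rw [← ENNReal.ofReal_mul (Real.exp_pos _).le, ← Real.exp_add]
    simp
  calc ν {z | ∑ i ∈ I, z i ^ 2 ≤ s * c * I.card}
      = ENNReal.ofReal (Real.exp (c * I.card)) * (ENNReal.ofReal (Real.exp (-(c * I.card))) *
        ν {z | ∑ i ∈ I, z i ^ 2 ≤ s * c * I.card}) := by rw [← mul_assoc, hE, one_mul]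
    _ ≤ ENNReal.ofReal (Real.exp (c * I.card)) * ENNReal.ofReal (normalLaplace ^ I.card) :=
        mul_le_mul_right hmul _
    _ = ENNReal.ofReal (smallBallRate ^ I.card) := by
        rw [← ENNReal.ofReal_mul (Real.exp_pos _).le, ← exp_smallBallConst_mul, mul_pow,
          ← Real.exp_nat_mul, mul_comm c]

end SmallBall

/-! ### Quadratic forms of a positive definite matrix and of its inverse. -/

section QuadraticForms

open Matrix

variable {m : ℕ} {P : Matrix (Fin m) (Fin m) ℝ}

/-- This is the expansion of the form of `P` at `P⁻¹ z - w`. -/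
lemma dotProduct_inv_sub_sq (hP : P.PosDef) (z w : Fin m → ℝ) :
    0 ≤ z ⬝ᵥ P⁻¹ *ᵥ z - 2 * (z ⬝ᵥ w) + w ⬝ᵥ P *ᵥ w := by
  have h := hP.posSemidef.dotProduct_mulVec_nonneg (P⁻¹ *ᵥ z - w)
  have hdet : IsUnit P.det := hP.det_pos.ne'.isUnit
  have hsymm : Pᵀ = P := by
    simpa [IsHermitian, conjTranspose_eq_transpose_of_trivial] using hP.isHermitian
  have h1 : P *ᵥ P⁻¹ *ᵥ z = z := by rw [mulVec_mulVec, mul_nonsing_inv _ hdet, one_mulVec]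
  have h2 : P⁻¹ *ᵥ z ⬝ᵥ P *ᵥ w = z ⬝ᵥ w := by
    rw [dotProduct_mulVec, ← mulVec_transpose, hsymm, h1]
  simp only [star_trivial] at h
  rw [mulVec_sub, sub_dotProduct, dotProduct_sub, dotProduct_sub, h1, h2,
    dotProduct_comm (P⁻¹ *ᵥ z) z, dotProduct_comm w z] at h
  linarith

/-- Inversion reverses the order of forms. The test vector `w = D z` is the optimal one in
`dotProduct_inv_sub_sq` with `P` replaced by the diagonal bound. -/
lemma le_dotProduct_inv (hP : P.PosDef) {D : Fin m → ℝ} (hD : ∀ j, 0 < D j)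
    (h : ∀ w : Fin m → ℝ, w ⬝ᵥ P *ᵥ w ≤ ∑ j, w j ^ 2 / D j) (z : Fin m → ℝ) :
    ∑ j, D j * z j ^ 2 ≤ z ⬝ᵥ P⁻¹ *ᵥ z := by
  have h1 := dotProduct_inv_sub_sq hP z (fun j => D j * z j)
  have h2 := h fun j => D j * z j
  have h3 : ∑ j, (D j * z j) ^ 2 / D j = ∑ j, D j * z j ^ 2 :=
    Finset.sum_congr rfl fun j _ => by have := (hD j).ne'; field_simp
  have h4 : z ⬝ᵥ (fun j => D j * z j) = ∑ j, D j * z j ^ 2 :=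
    Finset.sum_congr rfl fun j _ => by ring
  rw [h3] at h2
  rw [h4] at h1
  linarith

/-- With `s = P⁻¹ z`, the form is `2 z·s - s·P s ≤ ∑ (2 z_j s_j - s_j²/D_j)`, and each summand is at
most `D_j z_j²`. -/
lemma dotProduct_inv_le (hP : P.PosDef) {D : Fin m → ℝ} (hD : ∀ j, 0 < D j)
    (h : ∀ w : Fin m → ℝ, ∑ j, w j ^ 2 / D j ≤ w ⬝ᵥ P *ᵥ w) (z : Fin m → ℝ) :
    z ⬝ᵥ P⁻¹ *ᵥ z ≤ ∑ j, D j * z j ^ 2 := by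
  set s := P⁻¹ *ᵥ z with hs
  have h1 : P *ᵥ s = z := by
    rw [hs, mulVec_mulVec, mul_nonsing_inv _ hP.det_pos.ne'.isUnit, one_mulVec]
  have h2 := h s
  rw [h1, dotProduct_comm] at h2
  have h3 : 2 * (z ⬝ᵥ s) - ∑ j, s j ^ 2 / D j ≤ ∑ j, D j * z j ^ 2 := by
    rw [dotProduct, Finset.mul_sum, ← Finset.sum_sub_distrib]
    refine Finset.sum_le_sum fun j _ => ?_
    have hj := hD j
    have : D j * z j ^ 2 - (2 * (z j * s j) - s j ^ 2 / D j) = (D j * z j - s j) ^ 2 / D j := by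
      field_simp; ring
    have h0 : 0 ≤ (D j * z j - s j) ^ 2 / D j := by positivity
    linarith
  linarith

open scoped MatrixOrder in
lemma norm_sqrt_mulVec_sq {S : Matrix (Fin m) (Fin m) ℝ} (hS : S.PosSemidef)
    (z : EuclideanSpace ℝ (Fin m)) :
    ‖toEuclideanCLM (𝕜 := ℝ) (CFC.sqrt S) z‖ ^ 2 = z.ofLp ⬝ᵥ S *ᵥ z.ofLp := by
  have hRsymm : (CFC.sqrt S)ᵀ = CFC.sqrt S := by
    have := (CFC.sqrt_nonneg S).isSelfAdjoint
    simpa [IsSelfAdjoint, star_eq_conjTranspose, conjTranspose_eq_transpose_of_trivial] using this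
  have hRR : CFC.sqrt S * CFC.sqrt S = S := CFC.sqrt_mul_sqrt_self _ hS.nonneg
  have h : ‖toEuclideanCLM (𝕜 := ℝ) (CFC.sqrt S) z‖ ^ 2
      = (CFC.sqrt S *ᵥ z.ofLp) ⬝ᵥ (CFC.sqrt S *ᵥ z.ofLp) := by
    rw [EuclideanSpace.real_norm_sq_eq, dotProduct]
    refine Finset.sum_congr rfl fun j _ => ?_
    rw [sq]; simp
  rw [h, dotProduct_mulVec, vecMul_mulVec, ← dotProduct_mulVec, hRsymm, hRR]

end QuadraticForms

/-! ### Mean and credible radius of a resampled law. -/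

section CredibleBall

open Matrix

variable {𝓧 : Type*} [MeasurableSpace 𝓧] {μ : Measure 𝓧}

/-- The function with coefficients `a` on the first `m` basis functions. -/
noncomputable def headSum (e : HilbertBasis ℕ ℝ (L2 μ)) {m : ℕ} (a : EuclideanSpace ℝ (Fin m)) :
    L2 μ := ∑ i : Fin m, a i • e i

variable {e : HilbertBasis ℕ ℝ (L2 μ)} {lam : ℕ → ℝ≥0} {m : ℕ}

lemma coords_headSum (a : EuclideanSpace ℝ (Fin m)) (j : ℕ) :
    coords e (headSum e a) j = if h : j < m then a ⟨j, h⟩ else 0 :=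
  coords_sum_fin e m a j

lemma hasSum_fin_sq (a : Fin m → ℝ) :
    HasSum (fun j : ℕ => (if h : j < m then a ⟨j, h⟩ else 0) ^ 2) (∑ i, a i ^ 2) := by
  have : ∑ i : Fin m, a i ^ 2
      = ∑ j ∈ Finset.range m, (fun j : ℕ => (if h : j < m then a ⟨j, h⟩ else 0) ^ 2) j := by
    rw [← Fin.sum_univ_eq_sum_range]
    exact Finset.sum_congr rfl fun i _ => by simp
  rw [this]
  refine hasSum_sum_of_ne_finset_zero fun j hj => ?_
  rw [dif_neg (by simpa using hj)]
  simp

/-- Pythagoras for head and tail. Either part alone bounds the radius from below, and their second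
moments add up for the bound from above. -/
lemma norm_resample_sub_sq (e : HilbertBasis ℕ ℝ (L2 μ)) (a u : EuclideanSpace ℝ (Fin m))
    (f : L2 μ) : ‖resample e m (u, f) - headSum e a‖ ^ 2
      = ‖u - a‖ ^ 2 + ‖f - headProj e m f‖ ^ 2 := by
  have h1 := hasSum_coords_sq e (resample e m (u, f) - headSum e a)
  have h2 := hasSum_coords_sq e (f - headProj e m f)
  have h3 := hasSum_fin_sq (u - a).ofLp
  rw [EuclideanSpace.real_norm_sq_eq]
  refine h1.unique ((h3.add h2).congr_fun fun j => ?_)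
  have : coords e (resample e m (u, f) - headSum e a) j
      = coords e (resample e m (u, f)) j - coords e (headSum e a) j := by
    simp only [coords, inner_sub_right]
  rw [this, coords_resample, coords_headSum, coords_tail]
  split_ifs <;> simp

lemma lintegral_norm_sub_multivariateGaussian {S : Matrix (Fin m) (Fin m) ℝ} (hS : S.PosSemidef)
    (a : EuclideanSpace ℝ (Fin m)) :
    ∫⁻ u, ENNReal.ofReal (‖u - a‖ ^ 2) ∂(multivariateGaussian a S) = ENNReal.ofReal S.trace := by
  have hid : MemLp (fun u : EuclideanSpace ℝ (Fin m) => u) 2 (multivariateGaussian a S) :=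
    IsGaussian.memLp_two_id
  have hj : ∀ j : Fin m, MemLp (fun u : EuclideanSpace ℝ (Fin m) => u j) 2
      (multivariateGaussian a S) := fun j =>
    ContinuousLinearMap.comp_memLp' (EuclideanSpace.proj (𝕜 := ℝ) j) hid
  have hmean : ∀ j : Fin m, ∫ u, u j ∂(multivariateGaussian a S) = a j := fun j => by
    have := ContinuousLinearMap.integral_comp_comm (EuclideanSpace.proj (𝕜 := ℝ) j)
      (hid.integrable (by simp))
    simpa using this
  have hsq : ∀ j : Fin m, Integrable (fun u : EuclideanSpace ℝ (Fin m) => (u j - a j) ^ 2)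
      (multivariateGaussian a S) := fun j => ((hj j).sub (memLp_const (a j))).integrable_sq
  have hint : ∀ j : Fin m, ∫ u, (u j - a j) ^ 2 ∂(multivariateGaussian a S) = S j j := fun j => by
    have := variance_eval_multivariateGaussian (μ := a) hS j
    rw [variance_eq_integral (by fun_prop), hmean] at this
    exact this
  simp_rw [EuclideanSpace.real_norm_sq_eq]
  rw [← ofReal_integral_eq_lintegral_ofReal]
  · congr 1
    simp only [PiLp.sub_apply]
    rw [integral_finsetSum _ fun j _ => hsq j]
    simp_rw [hint]
    rfl
  · exact integrable_finsetSum _ fun j _ => hsq j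
  · exact ae_of_all _ fun u => Finset.sum_nonneg fun j _ => sq_nonneg _

lemma memLp_tail [SecondCountableTopology (L2 μ)] (e : HilbertBasis ℕ ℝ (L2 μ))
    (hs : Summable lam) (m : ℕ) : MemLp (fun f => f - headProj e m f) 2 (prior e lam) := by
  have := continuous_headProj e m
  refine ⟨Continuous.aestronglyMeasurable (by fun_prop), ?_⟩
  rw [eLpNorm_lt_top_iff_lintegral_rpow_enorm_lt_top (by simp) (by simp)]
  have h1 : ∀ f : L2 μ, ‖f - headProj e m f‖ₑ ^ (2 : ℝ≥0∞).toReal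
      = ENNReal.ofReal (‖f - headProj e m f‖ ^ 2) := by
    intro f
    rw [ENNReal.ofReal_pow (norm_nonneg _), ofReal_norm]
    simp
  simp_rw [h1, lintegral_norm_tail_sq e hs m]
  refine lt_of_le_of_lt (ENNReal.tsum_le_tsum fun j => ?_)
    (ENNReal.tsum_coe_ne_top_iff_summable.2 hs).lt_top
  split_ifs <;> simp

lemma integral_tail (e : HilbertBasis ℕ ℝ (L2 μ)) (hs : Summable lam) (m : ℕ) :
    ∫ f, (f - headProj e m f) ∂(prior e lam) = 0 := by
  have h : ∫ f, (f - headProj e m f) ∂(prior e lam)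
      = ∫ f, (-f - headProj e m (-f)) ∂(prior e lam) := by
    conv_lhs => rw [← prior_map_neg e hs]
    exact (MeasurableEquiv.neg (L2 μ)).measurableEmbedding.integral_map _
  have h2 : ∀ f : L2 μ, -f - headProj e m (-f) = -(f - headProj e m f) := fun f => by
    simp only [headProj, inner_neg_right, neg_smul, Finset.sum_neg_distrib]
    abel
  simp_rw [h2] at h
  rw [integral_neg, eq_neg_iff_add_eq_zero, ← two_smul ℝ] at h
  exact (smul_eq_zero.1 h).resolve_left two_ne_zero

lemma meanOf_map_resample [SecondCountableTopology (L2 μ)] (hs : Summable lam)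
    (a : EuclideanSpace ℝ (Fin m)) (S : Matrix (Fin m) (Fin m) ℝ) :
    meanOf (((multivariateGaussian a S).prod (prior e lam)).map (resample e m)) = headSum e a := by
  have := isProbabilityMeasure_prior e hs
  have hid : Integrable (fun u : EuclideanSpace ℝ (Fin m) => u) (multivariateGaussian a S) :=
    (IsGaussian.memLp_two_id (μ := multivariateGaussian a S)).integrable (by simp)
  have hj : ∀ j : Fin m, Integrable (fun u : EuclideanSpace ℝ (Fin m) => u j)
      (multivariateGaussian a S) := fun j =>
    (EuclideanSpace.proj (𝕜 := ℝ) j).integrable_comp hid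
  have hmean : ∀ j : Fin m, ∫ u, u j ∂(multivariateGaussian a S) = a j := fun j => by
    have := ContinuousLinearMap.integral_comp_comm (EuclideanSpace.proj (𝕜 := ℝ) j) hid
    simpa using this
  have hhead : Integrable (fun u : EuclideanSpace ℝ (Fin m) => ∑ j : Fin m, u j • e j)
      (multivariateGaussian a S) := integrable_finsetSum _ fun j _ => (hj j).smul_const _
  have htail := (memLp_tail e hs m).integrable (by simp)
  rw [meanOf, integral_map (measurable_resample e m).aemeasurable (by fun_prop)]
  unfold resample
  rw [integral_add (hhead.comp_fst _) (htail.comp_snd _),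
    integral_fun_fst (fun u : EuclideanSpace ℝ (Fin m) => ∑ j : Fin m, u j • e j),
    integral_fun_snd (fun f => f - headProj e m f), integral_tail e hs,
    integral_finsetSum _ fun j _ => (hj j).smul_const _]
  simp_rw [integral_smul_const, hmean]
  simp [headSum]

section Radius

variable [SecondCountableTopology (L2 μ)] {γ ρ : ℝ} {a : EuclideanSpace ℝ (Fin m)}
  {S : Matrix (Fin m) (Fin m) ℝ}

lemma credible_prob (hs : Summable lam)
    (hρ : IsCredibleRadius γ (((multivariateGaussian a S).prod (prior e lam)).map (resample e m)) ρ) :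
    ((multivariateGaussian a S).prod (prior e lam))
      {p | ‖resample e m p - headSum e a‖ ≤ ρ} = ENNReal.ofReal (1 - γ) := by
  rw [IsCredibleRadius, meanOf_map_resample hs, Measure.map_apply (measurable_resample e m)] at hρ
  · exact hρ
  · exact (isClosed_le (by fun_prop) continuous_const).measurableSet

lemma credible_radius_nonneg (hγ : γ < 1) (hs : Summable lam)
    (hρ : IsCredibleRadius γ (((multivariateGaussian a S).prod (prior e lam)).map (resample e m)) ρ) :
    0 ≤ ρ := by
  by_contra hneg
  have h := credible_prob hs hρ
  have hempty : {p | ‖resample e m p - headSum e a‖ ≤ ρ} = ∅ := by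
    ext p
    simp only [Set.mem_ofPred_eq, Set.mem_empty_iff_false, iff_false, not_le]
    exact (not_le.1 hneg).trans_le (norm_nonneg _)
  rw [hempty, measure_empty, eq_comm, ENNReal.ofReal_eq_zero] at h
  linarith

-- Writing `u - a = √S z` with `z` standard normal gives `‖u - a‖² = z·S z ≥ s ∑_I z_i²`. A smaller
-- radius would put the ball, of mass `1 - γ`, inside an event of mass at most `smallBallRate ^
-- I.card`.
open scoped MatrixOrder in
lemma credible_radius_gt_of_head (hγ : γ < 1) (hs : Summable lam) (hS : S.PosSemidef)
    (hρ : IsCredibleRadius γ (((multivariateGaussian a S).prod (prior e lam)).map (resample e m)) ρ)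
    (I : Finset (Fin m)) {s : ℝ} (hspos : 0 < s)
    (hI : ∀ z : Fin m → ℝ, s * ∑ i ∈ I, z i ^ 2 ≤ z ⬝ᵥ S *ᵥ z)
    (hrate : smallBallRate ^ I.card < 1 - γ) : s * smallBallConst * I.card < ρ ^ 2 := by
  have hρ0 := credible_radius_nonneg hγ hs hρ
  have := isProbabilityMeasure_prior e hs
  by_contra hle
  rw [not_lt] at hle
  have h := credible_prob hs hρ
  have hmono : ((multivariateGaussian a S).prod (prior e lam))
      {p | ‖resample e m p - headSum e a‖ ≤ ρ}
      ≤ (Measure.pi fun _ : Fin m => gaussianReal 0 1)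
        {z | ∑ i ∈ I, z i ^ 2 ≤ 1 * smallBallConst * I.card} := by
    calc ((multivariateGaussian a S).prod (prior e lam))
          {p | ‖resample e m p - headSum e a‖ ≤ ρ}
        ≤ ((multivariateGaussian a S).prod (prior e lam)) ({u | ‖u - a‖ ≤ ρ} ×ˢ Set.univ) := by
          refine measure_mono fun p hp => ⟨?_, trivial⟩
          have hp' : ‖resample e m p - headSum e a‖ ≤ ρ := hp
          have h1 := norm_resample_sub_sq e a p.1 p.2
          have h2 := pow_le_pow_left₀ (norm_nonneg _) hp' 2
          refine abs_le_of_sq_le_sq' ?_ hρ0 |>.2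
          have := sq_nonneg ‖p.2 - headProj e m p.2‖
          linarith
      _ = multivariateGaussian a S {u | ‖u - a‖ ≤ ρ} := by simp
      _ ≤ _ := by
          have hm : MeasurableSet {u : EuclideanSpace ℝ (Fin m) | ‖u - a‖ ≤ ρ} :=
            (isClosed_le (by fun_prop) continuous_const).measurableSet
          have hmp : Measurable fun x => a + toEuclideanCLM (𝕜 := ℝ) (CFC.sqrt S) x := by fun_prop
          rw [multivariateGaussian, Measure.map_apply hmp hm, ← map_pi_eq_stdGaussian,
            Measure.map_apply (by fun_prop) (hmp hm)]
          refine measure_mono fun z hz => ?_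
          simp only [Set.mem_preimage, Set.mem_ofPred_eq, add_sub_cancel_left] at hz ⊢
          have h2 := pow_le_pow_left₀ (norm_nonneg _) hz 2
          rw [norm_sqrt_mulVec_sq hS] at h2
          have h3 := (hI z).trans (h2.trans hle)
          rw [mul_assoc] at h3
          rw [one_mul]
          exact le_of_mul_le_mul_left h3 hspos
  have h2 := smallBall (fun _ : Fin m => 1) I one_pos (fun i _ => by simp)
  have h3 := hmono.trans h2
  rw [h] at h3
  have := (ENNReal.ofReal_le_ofReal_iff (pow_nonneg smallBallRate_nonneg _)).1 h3
  linarith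

/-- The argument for the head, applied to prior coordinates `j ≥ m`, which the data do not touch and
which keep variance `λ_j`. -/
lemma credible_radius_gt_of_tail (hγ : γ < 1) (hs : Summable lam)
    (hρ : IsCredibleRadius γ (((multivariateGaussian a S).prod (prior e lam)).map (resample e m)) ρ)
    (I : Finset ℕ) {s : ℝ} (hspos : 0 < s) (hI : ∀ j ∈ I, m ≤ j ∧ s ≤ lam j)
    (hrate : smallBallRate ^ I.card < 1 - γ) : s * smallBallConst * I.card < ρ ^ 2 := by
  have hρ0 := credible_radius_nonneg hγ hs hρ
  have := isProbabilityMeasure_prior e hs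
  by_contra hle
  rw [not_lt] at hle
  have h := credible_prob hs hρ
  have hmono : ((multivariateGaussian a S).prod (prior e lam))
      {p | ‖resample e m p - headSum e a‖ ≤ ρ}
      ≤ (Measure.pi fun i : I => gaussianReal 0 (lam i))
        {z | ∑ i, z i ^ 2 ≤ s * smallBallConst * (Finset.univ : Finset I).card} := by
    calc ((multivariateGaussian a S).prod (prior e lam))
          {p | ‖resample e m p - headSum e a‖ ≤ ρ}
        ≤ ((multivariateGaussian a S).prod (prior e lam)) (Set.univ ×ˢ
            {f | ∑ j ∈ I, coords e f j ^ 2 ≤ s * smallBallConst * I.card}) := by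
          refine measure_mono fun p hp => ⟨trivial, ?_⟩
          have hp' : ‖resample e m p - headSum e a‖ ≤ ρ := hp
          have h1 := norm_resample_sub_sq e a p.1 p.2
          have h2 := pow_le_pow_left₀ (norm_nonneg _) hp' 2
          have h3 := sq_nonneg ‖p.1 - a‖
          have h4 := hasSum_coords_sq e (p.2 - headProj e m p.2)
          have h5 := sum_le_hasSum I (fun j _ => sq_nonneg _) h4
          have h6 : ∑ j ∈ I, coords e p.2 j ^ 2
              = ∑ j ∈ I, coords e (p.2 - headProj e m p.2) j ^ 2 := by
            refine Finset.sum_congr rfl fun j hj => ?_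
            rw [coords_tail, if_neg (not_lt.2 (hI j hj).1)]
          simp only [Set.mem_ofPred_eq]
          rw [h6]
          linarith
      _ = prior e lam {f | ∑ j ∈ I, coords e f j ^ 2 ≤ s * smallBallConst * I.card} := by simp
      _ = (coordLaw lam) {θ | ∑ j ∈ I, θ j ^ 2 ≤ s * smallBallConst * I.card} := by
          rw [← prior_map_coords e hs, Measure.map_apply (measurable_coords e)]
          · rfl
          · exact measurableSet_le (by fun_prop) measurable_const
      _ = _ := by
          rw [← Measure.infinitePi_map_restrict (μ := fun j => gaussianReal 0 (lam j)) (I := I),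
            Measure.map_apply (by fun_prop) (measurableSet_le (by fun_prop) measurable_const)]
          congr 1
          ext θ
          simp only [Set.mem_preimage, Set.mem_ofPred_eq, Finset.restrict, Finset.card_univ,
            Fintype.card_coe]
          rw [Finset.sum_coe_sort I (fun j => θ j ^ 2)]
  have h2 := smallBall (fun i : I => lam i) Finset.univ hspos (fun i _ => (hI i i.2).2)
  have h3 := hmono.trans h2
  rw [h] at h3
  have := (ENNReal.ofReal_le_ofReal_iff (pow_nonneg smallBallRate_nonneg _)).1 h3
  simp only [Finset.card_univ, Fintype.card_coe] at this
  linarith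

/-- Markov's inequality for the squared distance to the center: the complement of the ball has mass
exactly `γ`, and the second moment is `trace S` plus the tail eigenvalues. -/
lemma credible_radius_sq_le (hγ : 0 < γ) (hγ1 : γ < 1) (hs : Summable lam) (hS : S.PosSemidef)
    (hρ : IsCredibleRadius γ (((multivariateGaussian a S).prod (prior e lam)).map (resample e m)) ρ)
    {B : ℝ} (hB : ENNReal.ofReal S.trace + ∑' j, (if j < m then 0 else (lam j : ℝ≥0∞))
      ≤ ENNReal.ofReal B) (hB0 : 0 ≤ B) : ρ ^ 2 ≤ B / γ := by
  have hρ0 := credible_radius_nonneg hγ1 hs hρ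
  have := isProbabilityMeasure_prior e hs
  have h := credible_prob hs hρ
  set Q := (multivariateGaussian a S).prod (prior e lam) with hQ
  have hhp := continuous_headProj e m
  have hcont := continuous_resample e m
  have hmeas : MeasurableSet {p | ‖resample e m p - headSum e a‖ ≤ ρ} :=
    (isClosed_le (by fun_prop) continuous_const).measurableSet
  have hcompl : ENNReal.ofReal γ ≤ Q {p | ENNReal.ofReal (ρ ^ 2)
      ≤ ENNReal.ofReal (‖resample e m p - headSum e a‖ ^ 2)} := by
    have h1 := prob_compl_eq_one_sub hmeas (μ := Q)
    rw [h, ← ENNReal.ofReal_one, ← ENNReal.ofReal_sub _ (by linarith), sub_sub_cancel] at h1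
    rw [← h1]
    refine measure_mono fun p hp => ?_
    simp only [Set.mem_compl_iff, Set.mem_ofPred_eq, not_le] at hp ⊢
    exact ENNReal.ofReal_le_ofReal (pow_le_pow_left₀ hρ0 hp.le 2)
  have hlint : ∫⁻ p, ENNReal.ofReal (‖resample e m p - headSum e a‖ ^ 2) ∂Q ≤ ENNReal.ofReal B := by
    refine le_trans (le_of_eq ?_) hB
    have h1 : ∀ p : EuclideanSpace ℝ (Fin m) × L2 μ,
        ENNReal.ofReal (‖resample e m p - headSum e a‖ ^ 2)
        = ENNReal.ofReal (‖p.1 - a‖ ^ 2) + ENNReal.ofReal (‖p.2 - headProj e m p.2‖ ^ 2) := by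
      intro p
      rw [← ENNReal.ofReal_add (sq_nonneg _) (sq_nonneg _), ← norm_resample_sub_sq]
    simp_rw [h1]
    have hm1 : Measurable fun u : EuclideanSpace ℝ (Fin m) => ENNReal.ofReal (‖u - a‖ ^ 2) := by
      fun_prop
    have hm2 : Measurable fun f : L2 μ => ENNReal.ofReal (‖f - headProj e m f‖ ^ 2) :=
      (Continuous.measurable (by fun_prop)).ennreal_ofReal
    have hadd := lintegral_add_left (μ := Q) (hm1.comp measurable_fst)
      fun p => ENNReal.ofReal (‖p.2 - headProj e m p.2‖ ^ 2)
    simp only [Function.comp_def] at hadd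
    rw [hadd, ← lintegral_norm_tail_sq e hs m,
      ← lintegral_norm_sub_multivariateGaussian hS a]
    congr 1
    · rw [← lintegral_map (μ := Q) hm1 measurable_fst, hQ, Measure.map_fst_prod]
      simp
    · rw [← lintegral_map (μ := Q) hm2 measurable_snd, hQ, Measure.map_snd_prod]
      simp
  have hmk := mul_meas_ge_le_lintegral (μ := Q)
    (f := fun p => ENNReal.ofReal (‖resample e m p - headSum e a‖ ^ 2))
    (Continuous.measurable (by fun_prop)).ennreal_ofReal (ENNReal.ofReal (ρ ^ 2))
  have h5 := ((mul_le_mul_right hcompl _).trans hmk).trans hlint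
  rw [← ENNReal.ofReal_mul (sq_nonneg _)] at h5
  have h6 := (ENNReal.ofReal_le_ofReal_iff hB0).1 h5
  rwa [le_div_iff₀ hγ]

end Radius

end CredibleBall

/-! ### Deterministic estimates for the regression on the features. -/

section Energy

open Matrix

variable {𝓧 : Type*} {φ : ℕ → 𝓧 → ℝ} {lam : ℕ → ℝ≥0} {σ : ℝ≥0} {m n : ℕ}
  {x : Fin n → 𝓧} {y : Fin n → ℝ}

/-- The empirical Gram matrix of the first `m` basis functions is close to the identity. -/
def GramBounds (φ : ℕ → 𝓧 → ℝ) (m : ℕ) (x : Fin n → 𝓧) : Prop :=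
  ∀ w : Fin m → ℝ, (n : ℝ) / 2 * ∑ j, w j ^ 2 ≤ ∑ i, predict φ x w i ^ 2 ∧
    ∑ i, predict φ x w i ^ 2 ≤ 2 * n * ∑ j, w j ^ 2

/-- The upper bound for the posterior variance of the `j`-th feature. -/
noncomputable def varBound (lam : ℕ → ℝ≥0) (σ : ℝ≥0) (n j : ℕ) : ℝ :=
  ((lam j : ℝ)⁻¹ + n / (2 * (σ : ℝ) ^ 2))⁻¹

lemma varBound_pos (hpos : ∀ j, 0 < lam j) (n j : ℕ) : 0 < varBound lam σ n j := by
  have := hpos j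
  unfold varBound
  positivity

lemma varBound_le_lam (hpos : ∀ j, 0 < lam j) (n j : ℕ) : varBound lam σ n j ≤ lam j := by
  have h : (0 : ℝ) < lam j := by exact_mod_cast hpos j
  unfold varBound
  rw [inv_le_comm₀ (by positivity) h]
  have : (0 : ℝ) ≤ n / (2 * (σ : ℝ) ^ 2) := by positivity
  linarith

lemma varBound_le_div (hpos : ∀ j, 0 < lam j) (hσ : 0 < σ) (hn : 0 < n) (j : ℕ) :
    varBound lam σ n j ≤ 2 * (σ : ℝ) ^ 2 / n := by
  have h : (0 : ℝ) < lam j := by exact_mod_cast hpos j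
  have hσ' : (0 : ℝ) < σ := by exact_mod_cast hσ
  have hn' : (0 : ℝ) < n := by exact_mod_cast hn
  unfold varBound
  rw [inv_le_comm₀ (by positivity) (by positivity), inv_div]
  have : (0 : ℝ) ≤ (lam j : ℝ)⁻¹ := by positivity
  linarith

lemma predict_sub (w v : Fin m → ℝ) (i : Fin n) :
    predict φ x (w - v) i = predict φ x w i - predict φ x v i := by
  simp only [predict, Pi.sub_apply, sub_mul, Finset.sum_sub_distrib]

lemma sum_predict_mul (w : Fin m → ℝ) (v : Fin n → ℝ) :
    ∑ i, predict φ x w i * v i = ∑ j : Fin m, w j * ∑ i, φ j (x i) * v i := by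
  simp only [predict, Finset.sum_mul, Finset.mul_sum]
  rw [Finset.sum_comm]
  exact Finset.sum_congr rfl fun j _ => Finset.sum_congr rfl fun i _ => by ring

lemma precision_quadratic (w : Fin m → ℝ) : w ⬝ᵥ precision φ lam σ m x *ᵥ w
    = ∑ j : Fin m, w j ^ 2 / lam j + (∑ i, predict φ x w i ^ 2) / (σ : ℝ) ^ 2 := by
  rw [dotProduct_precision]
  simp_rw [sq]

lemma sum_div_varBound_le (hG : GramBounds φ m x) (w : Fin m → ℝ) :
    ∑ j : Fin m, w j ^ 2 / varBound lam σ n j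
      ≤ ∑ j : Fin m, w j ^ 2 / lam j + (∑ i, predict φ x w i ^ 2) / (σ : ℝ) ^ 2 := by
  have h1 : ∑ j : Fin m, w j ^ 2 / varBound lam σ n j
      = ∑ j : Fin m, w j ^ 2 / lam j + ((n : ℝ) / 2 * ∑ j, w j ^ 2) / (σ : ℝ) ^ 2 := by
    rw [Finset.mul_sum, Finset.sum_div, ← Finset.sum_add_distrib]
    refine Finset.sum_congr rfl fun j _ => ?_
    rw [varBound, div_inv_eq_mul]
    ring
  rw [h1]
  gcongr
  exact (hG w).1

/-- Energy estimate for the variational posterior mean, when the data are `Φ θ + g + ε`. -/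
lemma energy_estimate (hpos : ∀ j, 0 < lam j) (hσ : 0 < σ) (hG : GramBounds φ m x)
    (θ : Fin m → ℝ) (g ε : Fin n → ℝ) (hy : ∀ i, y i = predict φ x θ i + g i + ε i) :
    (n : ℝ) / (2 * (σ : ℝ) ^ 2) * ∑ j, ((featureMean φ lam σ m x y).ofLp j - θ j) ^ 2
      ≤ 3 * (∑ j : Fin m, varBound lam σ n j * (θ j / lam j) ^ 2 + (∑ i, g i ^ 2) / (σ : ℝ) ^ 2
        + ∑ j : Fin m, varBound lam σ n j * ((∑ i, φ j (x i) * ε i) / (σ : ℝ) ^ 2) ^ 2) := by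
  have hσ' : (0 : ℝ) < σ := by exact_mod_cast hσ
  set a := featureMean φ lam σ m x y with ha
  set w : Fin m → ℝ := a.ofLp - θ with hw
  set p := predict φ x w with hp
  set E := ∑ j : Fin m, w j ^ 2 / lam j + (∑ i, p i ^ 2) / (σ : ℝ) ^ 2 with hE
  set K := ∑ j : Fin m, w j ^ 2 / varBound lam σ n j with hK
  have hKE : K ≤ E := sum_div_varBound_le hG w
  have hne := normal_equations (φ := φ) (σ := σ) hpos x y w
  -- The normal equations tested with the error `w` itself express the energy through the prior
  -- penalty at `θ`, the bias `g` and the noise `ε`.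
  have hEeq : E = -∑ j : Fin m, w j * (θ j / lam j) + (∑ i, p i * g i) / (σ : ℝ) ^ 2
      + ∑ j : Fin m, w j * ((∑ i, φ j (x i) * ε i) / (σ : ℝ) ^ 2) := by
    have e1 : ∑ j : Fin m, w j ^ 2 / lam j
        = ∑ j : Fin m, w j * a.ofLp j / lam j - ∑ j : Fin m, w j * (θ j / lam j) := by
      rw [← Finset.sum_sub_distrib]
      refine Finset.sum_congr rfl fun j _ => ?_
      rw [hw, Pi.sub_apply]; ring
    have e2 : ∑ i, p i ^ 2 = ∑ i, p i * predict φ x a.ofLp i - ∑ i, p i * predict φ x θ i := by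
      rw [← Finset.sum_sub_distrib]
      refine Finset.sum_congr rfl fun i _ => ?_
      rw [hp, hw, predict_sub]; ring
    have e3 : ∑ i, p i * y i = ∑ i, p i * predict φ x θ i + ∑ i, p i * g i + ∑ i, p i * ε i := by
      rw [← Finset.sum_add_distrib, ← Finset.sum_add_distrib]
      exact Finset.sum_congr rfl fun i _ => by rw [hy]; ring
    have e4 : ∑ j : Fin m, w j * ((∑ i, φ j (x i) * ε i) / (σ : ℝ) ^ 2)
        = (∑ i, p i * ε i) / (σ : ℝ) ^ 2 := by
      rw [hp, sum_predict_mul, Finset.sum_div]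
      exact Finset.sum_congr rfl fun j _ => by ring
    rw [hE, e1, e2, e4]
    have hne' : ∑ j : Fin m, w j * a.ofLp j / lam j
        = (∑ i, p i * y i) / (σ : ℝ) ^ 2 - (∑ i, p i * predict φ x a.ofLp i) / (σ : ℝ) ^ 2 := by
      rw [← hne]; ring
    rw [hne', e3]
    ring
  -- The weight 1/6 is chosen so that the three terms together cost at most `E/2`, as `K ≤ E`.
  -- Absorbing this on the left turns `3/2` into the factor 3.
  have young : ∀ {u v D : ℝ}, 0 < D → u * v ≤ u ^ 2 / D / 6 + 3 / 2 * (D * v ^ 2) := by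
    intro u v D hD
    have h0 : u ^ 2 / D / 6 + 3 / 2 * (D * v ^ 2) - u * v = (u - 3 * D * v) ^ 2 / (6 * D) := by
      field_simp; ring
    have h1 : 0 ≤ (u - 3 * D * v) ^ 2 / (6 * D) := by positivity
    linarith
  have hv := varBound_pos (σ := σ) hpos n
  have b1 : -∑ j : Fin m, w j * (θ j / lam j)
      ≤ K / 6 + 3 / 2 * ∑ j : Fin m, varBound lam σ n j * (θ j / lam j) ^ 2 := by
    rw [hK, Finset.sum_div, Finset.mul_sum, ← Finset.sum_add_distrib, ← Finset.sum_neg_distrib]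
    refine Finset.sum_le_sum fun j _ => ?_
    have := young (u := w j) (v := -(θ j / lam j)) (hv j)
    rw [neg_sq] at this
    linarith
  have b2 : (∑ i, p i * g i) / (σ : ℝ) ^ 2
      ≤ (∑ i, p i ^ 2) / (σ : ℝ) ^ 2 / 6 + 3 / 2 * ((∑ i, g i ^ 2) / (σ : ℝ) ^ 2) := by
    have : ∑ i, p i * g i ≤ (∑ i, p i ^ 2) / 6 + 3 / 2 * ∑ i, g i ^ 2 := by
      rw [Finset.sum_div, Finset.mul_sum, ← Finset.sum_add_distrib]
      refine Finset.sum_le_sum fun i _ => ?_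
      have := young (u := p i) (v := g i) one_pos
      simpa using this
    calc (∑ i, p i * g i) / (σ : ℝ) ^ 2
        ≤ ((∑ i, p i ^ 2) / 6 + 3 / 2 * ∑ i, g i ^ 2) / (σ : ℝ) ^ 2 := by gcongr
      _ = _ := by ring
  have b3 : ∑ j : Fin m, w j * ((∑ i, φ j (x i) * ε i) / (σ : ℝ) ^ 2)
      ≤ K / 6 + 3 / 2 *
        ∑ j : Fin m, varBound lam σ n j * ((∑ i, φ j (x i) * ε i) / (σ : ℝ) ^ 2) ^ 2 := by
    rw [hK, Finset.sum_div, Finset.mul_sum, ← Finset.sum_add_distrib]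
    exact Finset.sum_le_sum fun j _ => young (hv j)
  have hpE : (∑ i, p i ^ 2) / (σ : ℝ) ^ 2 ≤ E := by
    rw [hE]
    have : 0 ≤ ∑ j : Fin m, w j ^ 2 / (lam j : ℝ) :=
      Finset.sum_nonneg fun j _ => div_nonneg (sq_nonneg _) (lam j).2
    linarith
  have hfin : (n : ℝ) / (2 * (σ : ℝ) ^ 2) * ∑ j, w j ^ 2 ≤ E := by
    refine le_trans ?_ hpE
    rw [le_div_iff₀ (by positivity)]
    calc (n : ℝ) / (2 * (σ : ℝ) ^ 2) * (∑ j, w j ^ 2) * (σ : ℝ) ^ 2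
        = (n : ℝ) / 2 * ∑ j, w j ^ 2 := by field_simp
      _ ≤ _ := (hG w).1
  refine le_trans hfin ?_
  linarith

/-- The energy estimate with `θ = 0` and `ε = 0`, all of `y` being counted as bias. -/
lemma sum_featureMean_sq_le (hpos : ∀ j, 0 < lam j) (hσ : 0 < σ) (hn : 0 < n)
    (hG : GramBounds φ m x) :
    ∑ j, (featureMean φ lam σ m x y).ofLp j ^ 2 ≤ 6 * (∑ i, y i ^ 2) / n := by
  have hσ' : (0 : ℝ) < σ := by exact_mod_cast hσ
  have hn' : (0 : ℝ) < n := by exact_mod_cast hn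
  have h := energy_estimate (y := y) hpos hσ hG 0 y 0 (fun i => by simp [predict])
  simp only [Pi.zero_apply, sub_zero, zero_div, mul_zero, Finset.sum_const_zero, ne_eq,
    OfNat.ofNat_ne_zero, not_false_eq_true, zero_pow, add_zero, zero_add] at h
  rw [le_div_iff₀ hn']
  rw [div_mul_eq_mul_div, div_le_iff₀ (by positivity)] at h
  have e : 3 * ((∑ i, y i ^ 2) / (σ : ℝ) ^ 2) * (2 * (σ : ℝ) ^ 2) = 6 * ∑ i, y i ^ 2 := by
    field_simp; ring
  rw [e] at h
  linarith

/-- The normal equation of a single coordinate reads `a_j = (λ_j/σ²) ∑ φ_j(x_i)(y_i - p_i)`, and the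
residuals are no larger than `y` in norm. Coefficients with a tiny prior variance are thus shrunk to
zero, whatever the Gram matrix. -/
lemma featureMean_sq_le {C : ℝ} (hφ : ∀ j x, |φ j x| ≤ C) (hpos : ∀ j, 0 < lam j)
    (j : Fin m) : (featureMean φ lam σ m x y).ofLp j ^ 2
      ≤ ((lam j : ℝ) / (σ : ℝ) ^ 2) ^ 2 * (n * C ^ 2 * ∑ i, y i ^ 2) := by
  set a := featureMean φ lam σ m x y with ha
  set p := predict φ x a.ofLp with hp
  have hl : (0 : ℝ) < lam j := by exact_mod_cast hpos j
  have h1 := normal_equations (φ := φ) (σ := σ) hpos x y a.ofLp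
  have h2 := normal_equations (φ := φ) (σ := σ) hpos x y (Pi.single j 1)
  have hpj : ∀ i, predict φ x (Pi.single j 1 : Fin m → ℝ) i = φ j (x i) := by
    intro i
    rw [predict, Finset.sum_eq_single j] <;> simp +contextual
  simp_rw [hpj] at h2
  have hsum : ∑ k : Fin m, (Pi.single j 1 : Fin m → ℝ) k * a.ofLp k / lam k = a.ofLp j / lam j := by
    rw [Finset.sum_eq_single j] <;> simp +contextual
  rw [hsum] at h2
  have h3 : a.ofLp j = lam j / (σ : ℝ) ^ 2 * ∑ i, φ j (x i) * (y i - p i) := by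
    simp_rw [mul_sub, Finset.sum_sub_distrib]
    have : a.ofLp j / lam j = (∑ i, φ j (x i) * y i) / (σ : ℝ) ^ 2
        - (∑ i, φ j (x i) * p i) / (σ : ℝ) ^ 2 := by rw [← h2]; ring
    rw [div_eq_iff hl.ne'] at this
    rw [this]; ring
  have h4 : ∑ i, (y i - p i) ^ 2 ≤ ∑ i, y i ^ 2 := by
    have e : ∑ i, (y i - p i) ^ 2 = ∑ i, y i ^ 2 - 2 * ∑ i, p i * y i + ∑ i, p i * p i := by
      rw [Finset.mul_sum, ← Finset.sum_sub_distrib, ← Finset.sum_add_distrib]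
      exact Finset.sum_congr rfl fun i _ => by ring
    have h0 : 0 ≤ ∑ k : Fin m, a.ofLp k * a.ofLp k / (lam k : ℝ) :=
      Finset.sum_nonneg fun k _ => div_nonneg (mul_self_nonneg _) (lam k).2
    have hpp : 0 ≤ ∑ i, p i * p i := Finset.sum_nonneg fun i _ => mul_self_nonneg _
    -- For `σ = 0` the convention `0⁻¹ = 0` makes `featureMean` vanish.
    rcases eq_or_ne (σ : ℝ) 0 with hσ0 | hσ0
    · have hz : ∀ k, a.ofLp k = 0 := by
        intro k
        simp [ha, featureMean, hσ0]
      have : ∀ i, p i = 0 := fun i => by simp [hp, predict, hz]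
      simp [this]
    · have hle : (∑ i, p i * p i) / (σ : ℝ) ^ 2 ≤ (∑ i, p i * y i) / (σ : ℝ) ^ 2 := by
        rw [← h1]; exact le_add_of_nonneg_left h0
      rw [div_le_div_iff_of_pos_right (by positivity)] at hle
      linarith
  rw [h3, mul_pow]
  refine mul_le_mul_of_nonneg_left ?_ (sq_nonneg _)
  calc (∑ i, φ j (x i) * (y i - p i)) ^ 2
      ≤ (∑ i, φ j (x i) ^ 2) * ∑ i, (y i - p i) ^ 2 := Finset.sum_mul_sq_le_sq_mul_sq _ _ _
    _ ≤ (n * C ^ 2) * ∑ i, y i ^ 2 := by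
        refine mul_le_mul ?_ h4 (Finset.sum_nonneg fun i _ => sq_nonneg _) (by positivity)
        calc ∑ i, φ j (x i) ^ 2 ≤ ∑ _i : Fin n, C ^ 2 :=
              Finset.sum_le_sum fun i _ => sq_le_sq' (abs_le.1 (hφ j (x i))).1
                (abs_le.1 (hφ j (x i))).2
          _ = n * C ^ 2 := by simp

lemma le_dotProduct_inv_precision (hpos : ∀ j, 0 < lam j) (hσ : 0 < σ) (hG : GramBounds φ m x)
    (I : Finset (Fin m)) {s : ℝ}
    (hI : ∀ j ∈ I, s ≤ ((lam j : ℝ)⁻¹ + 2 * n / (σ : ℝ) ^ 2)⁻¹) (z : Fin m → ℝ) :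
    s * ∑ j ∈ I, z j ^ 2 ≤ z ⬝ᵥ (precision φ lam σ m x)⁻¹ *ᵥ z := by
  have hσ' : (0 : ℝ) < σ := by exact_mod_cast hσ
  have hD : ∀ j : Fin m, 0 < ((lam j : ℝ)⁻¹ + 2 * n / (σ : ℝ) ^ 2)⁻¹ := fun j => by
    have := hpos j
    positivity
  refine le_trans ?_ (le_dotProduct_inv (posDef_precision hpos x) hD (fun w => ?_) z)
  · rw [Finset.mul_sum]
    refine (Finset.sum_le_sum fun j hj => mul_le_mul_of_nonneg_right (hI j hj) (sq_nonneg _)).trans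
      (Finset.sum_le_univ_sum_of_nonneg fun j => mul_nonneg (hD j).le (sq_nonneg _))
  · have h1 : ∑ j : Fin m, w j ^ 2 / ((lam j : ℝ)⁻¹ + 2 * n / (σ : ℝ) ^ 2)⁻¹
        = ∑ j : Fin m, w j ^ 2 / lam j + (2 * n * ∑ j, w j ^ 2) / (σ : ℝ) ^ 2 := by
      rw [Finset.mul_sum, Finset.sum_div, ← Finset.sum_add_distrib]
      refine Finset.sum_congr rfl fun j _ => ?_
      rw [div_inv_eq_mul]
      ring
    rw [h1, precision_quadratic]
    gcongr
    exact (hG w).2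

lemma trace_inv_precision_le (hpos : ∀ j, 0 < lam j) (hG : GramBounds φ m x) :
    ((precision φ lam σ m x)⁻¹).trace ≤ ∑ j : Fin m, varBound lam σ n j := by
  refine Finset.sum_le_sum fun j _ => ?_
  have h := dotProduct_inv_le (posDef_precision (φ := φ) (lam := lam) (σ := σ) hpos x)
    (fun j : Fin m => varBound_pos (σ := σ) hpos n j)
    (fun w => by rw [precision_quadratic]; exact sum_div_varBound_le hG w) (Pi.single j 1)
  have h2 : ∑ k : Fin m, varBound lam σ n k * (Pi.single j 1 : Fin m → ℝ) k ^ 2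
      = varBound lam σ n j := by
    rw [Finset.sum_eq_single j] <;> simp +contextual
  rw [h2] at h
  simpa using h

end Energy

lemma measurable_representative {𝓧 : Type*} [MeasurableSpace 𝓧] {μ : Measure 𝓧} (f : L2 μ) :
    Measurable (f : 𝓧 → ℝ) :=
  (Lp.stronglyMeasurable f).measurable


/-! ### Moments under the law of the data. -/

section DataLaw

variable {𝓧 : Type*} [MeasurableSpace 𝓧] {μ : Measure 𝓧} [IsProbabilityMeasure μ]
  {φ : ℕ → 𝓧 → ℝ} {e : HilbertBasis ℕ ℝ (L2 μ)} {σ : ℝ≥0} {n m : ℕ} {f₀ : L2 μ}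

lemma measurable_dataMap (f₀ : L2 μ) (n : ℕ) :
    Measurable fun p : (Fin n → 𝓧) × (Fin n → ℝ) => (p.1, fun i => f₀ (p.1 i) + p.2 i) := by
  have := measurable_representative f₀
  refine measurable_fst.prodMk (measurable_pi_iff.2 fun i => ?_)
  fun_prop

instance isProbabilityMeasure_dataLaw : IsProbabilityMeasure (dataLaw μ σ f₀ n) :=
  Measure.isProbabilityMeasure_map (measurable_dataMap f₀ n).aemeasurable

lemma lintegral_dataLaw {F : (Fin n → 𝓧) × (Fin n → ℝ) → ℝ≥0∞} (hF : Measurable F) :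
    ∫⁻ p, F p ∂(dataLaw μ σ f₀ n)
      = ∫⁻ x, ∫⁻ ε, F (x, fun i => f₀ (x i) + ε i)
          ∂(Measure.pi fun _ : Fin n => gaussianReal 0 (σ ^ 2)) ∂(Measure.pi fun _ : Fin n => μ) := by
  rw [dataLaw, lintegral_map hF (measurable_dataMap f₀ n)]
  exact lintegral_prod _ (hF.comp (measurable_dataMap f₀ n)).aemeasurable

/-- Markov's inequality. -/
lemma measure_lt_le_of_lintegral_le {α : Type*} [MeasurableSpace α] {P : Measure α} {F : α → ℝ}
    (hF : Measurable F) {B t : ℝ} (ht : 0 < t)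
    (hB : ∫⁻ p, ENNReal.ofReal (F p) ∂P ≤ ENNReal.ofReal B) :
    P {p | t < F p} ≤ ENNReal.ofReal (B / t) := by
  have h := mul_meas_ge_le_lintegral (μ := P) hF.ennreal_ofReal (ENNReal.ofReal t)
  rw [ENNReal.ofReal_div_of_pos ht,
    ENNReal.le_div_iff_mul_le (Or.inl (by simpa using ht)) (Or.inl ENNReal.ofReal_ne_top), mul_comm]
  refine le_trans (mul_le_mul_right (measure_mono fun p hp => ?_) _) (h.trans hB)
  exact ENNReal.ofReal_le_ofReal (le_of_lt hp)

lemma lintegral_eval_pi (i : Fin n) {g : 𝓧 → ℝ≥0∞} (hg : Measurable g) :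
    ∫⁻ x, g (x i) ∂(Measure.pi fun _ : Fin n => μ) = ∫⁻ z, g z ∂μ := by
  have h := (measurePreserving_eval (fun _ : Fin n => μ) i).map_eq
  conv_rhs => rw [← h]
  rw [lintegral_map hg (measurable_pi_apply i)]

lemma lintegral_sq_eq_norm (f : L2 μ) : ∫⁻ z, ENNReal.ofReal (f z ^ 2) ∂μ
    = ENNReal.ofReal (‖f‖ ^ 2) := by
  have h2 : Integrable (fun z => f z ^ 2) μ := (Lp.memLp f).integrable_sq
  rw [← ofReal_integral_eq_lintegral_ofReal h2 (ae_of_all _ fun z => sq_nonneg _),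
    ← real_inner_self_eq_norm_sq, L2.inner_def]
  congr 1
  refine integral_congr_ae (ae_of_all _ fun z => ?_)
  simp [sq]

/-- The part of `f₀` beyond the first `m` basis functions, as a function on `𝓧`. -/
noncomputable def residual (φ : ℕ → 𝓧 → ℝ) (f₀ : L2 μ) (θ : Fin m → ℝ)
    (z : 𝓧) : ℝ := f₀ z - ∑ j : Fin m, θ j * φ j z

lemma measurable_residual (hφ : IsBoundedEigenbasis φ e) (f₀ : L2 μ) (θ : Fin m → ℝ) :
    Measurable (residual φ f₀ θ) := by
  have := measurable_representative f₀
  have := hφ.measurable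
  unfold residual; fun_prop

lemma residual_ae_eq (hφ : IsBoundedEigenbasis φ e) (f₀ : L2 μ) (θ : Fin m → ℝ) :
    residual φ f₀ θ =ᵐ[μ] (f₀ - ∑ j : Fin m, θ j • e j : L2 μ) := by
  have h1 : ∀ s : Finset (Fin m), ((∑ j ∈ s, θ j • e j : L2 μ) : 𝓧 → ℝ)
      =ᵐ[μ] fun z => ∑ j ∈ s, θ j * φ j z := by
    intro s
    induction s using Finset.induction_on with
    | empty =>
      filter_upwards [Lp.coeFn_zero ℝ 2 μ] with z hz
      simp
    | insert j s hj ih =>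
      rw [Finset.sum_insert hj]
      filter_upwards [Lp.coeFn_add (θ j • e j : L2 μ) (∑ j ∈ s, θ j • e j), ih,
        Lp.coeFn_smul (θ j) (e j), hφ.coe_eq j] with z h1 h2 h3 h4
      rw [h1, Pi.add_apply, h2, h3, Pi.smul_apply, h4, Finset.sum_insert hj, smul_eq_mul]
  filter_upwards [Lp.coeFn_sub f₀ (∑ j : Fin m, θ j • e j), h1 Finset.univ] with z h2 h3
  rw [h2, Pi.sub_apply, h3, residual]

lemma lintegral_sum_residual_sq (hφ : IsBoundedEigenbasis φ e) (f₀ : L2 μ) (θ : Fin m → ℝ) :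
    ∫⁻ p, ENNReal.ofReal (∑ i, residual φ f₀ θ (p.1 i) ^ 2) ∂(dataLaw μ σ f₀ n)
      = ENNReal.ofReal (n * ‖f₀ - ∑ j : Fin m, θ j • e j‖ ^ 2) := by
  have hm := measurable_residual hφ f₀ θ
  have hm2 : Measurable fun z => ENNReal.ofReal (residual φ f₀ θ z ^ 2) := by fun_prop
  rw [lintegral_dataLaw (by fun_prop)]
  simp only [lintegral_const, measure_univ, mul_one]
  have h : ∀ x : Fin n → 𝓧, ENNReal.ofReal (∑ i, residual φ f₀ θ (x i) ^ 2)
      = ∑ i, ENNReal.ofReal (residual φ f₀ θ (x i) ^ 2) := fun x =>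
    ENNReal.ofReal_sum_of_nonneg fun i _ => sq_nonneg _
  simp_rw [h]
  rw [lintegral_finsetSum _ fun i _ => by fun_prop]
  have h2 : ∀ i : Fin n, ∫⁻ x : Fin n → 𝓧, ENNReal.ofReal (residual φ f₀ θ (x i) ^ 2)
      ∂(Measure.pi fun _ : Fin n => μ) = ENNReal.ofReal (‖f₀ - ∑ j : Fin m, θ j • e j‖ ^ 2) := by
    intro i
    rw [lintegral_eval_pi i hm2, ← lintegral_sq_eq_norm]
    refine lintegral_congr_ae ?_
    filter_upwards [residual_ae_eq hφ f₀ θ] with z hz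
    rw [hz]
  simp_rw [h2]
  rw [ENNReal.ofReal_mul (by positivity)]
  simp

lemma lintegral_sum_sq_le (f₀ : L2 μ) :
    ∫⁻ p, ENNReal.ofReal (∑ i, p.2 i ^ 2) ∂(dataLaw μ σ f₀ n)
      ≤ ENNReal.ofReal (n * (2 * ‖f₀‖ ^ 2 + 2 * (σ : ℝ) ^ 2)) := by
  have hm := measurable_representative f₀
  rw [lintegral_dataLaw (by fun_prop)]
  have hle : ∀ (x : Fin n → 𝓧) (ε : Fin n → ℝ),
      ENNReal.ofReal (∑ i, (f₀ (x i) + ε i) ^ 2)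
      ≤ ∑ i, (2 * ENNReal.ofReal (f₀ (x i) ^ 2) + 2 * ENNReal.ofReal (ε i ^ 2)) := by
    intro x ε
    rw [ENNReal.ofReal_sum_of_nonneg fun i _ => sq_nonneg _]
    refine Finset.sum_le_sum fun i _ => ?_
    generalize f₀ (x i) = t
    have h2 : ∀ s : ℝ, (2 : ℝ≥0∞) * ENNReal.ofReal (s ^ 2) = ENNReal.ofReal (2 * s ^ 2) := fun s => by
      rw [ENNReal.ofReal_mul (by norm_num), ENNReal.ofReal_ofNat]
    rw [h2, h2, ← ENNReal.ofReal_add (by positivity) (by positivity)]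
    exact ENNReal.ofReal_le_ofReal (by nlinarith [sq_nonneg (t - ε i)])
  refine (lintegral_mono fun x => lintegral_mono fun ε => hle x ε).trans ?_
  have hin : ∀ x : Fin n → 𝓧, ∫⁻ ε, ∑ i, (2 * ENNReal.ofReal (f₀ (x i) ^ 2)
      + 2 * ENNReal.ofReal (ε i ^ 2)) ∂(Measure.pi fun _ : Fin n => gaussianReal 0 (σ ^ 2))
      = ∑ i, (2 * ENNReal.ofReal (f₀ (x i) ^ 2) + 2 * ENNReal.ofReal ((σ : ℝ) ^ 2)) := by
    intro x
    rw [lintegral_finsetSum _ fun i _ => by fun_prop]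
    refine Finset.sum_congr rfl fun i _ => ?_
    have hg : ∫⁻ ε : Fin n → ℝ, ENNReal.ofReal (ε i ^ 2)
        ∂(Measure.pi fun _ : Fin n => gaussianReal 0 (σ ^ 2)) = ENNReal.ofReal ((σ : ℝ) ^ 2) := by
      rw [lintegral_eval_pi (μ := gaussianReal 0 (σ ^ 2)) i (g := fun z => ENNReal.ofReal (z ^ 2))
        (by fun_prop), lintegral_sq_gaussianReal]
      simp
    rw [lintegral_add_left measurable_const, lintegral_const, measure_univ, mul_one,
      lintegral_const_mul _ (by fun_prop), hg]
  simp_rw [hin]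
  rw [lintegral_finsetSum _ fun i _ => by fun_prop]
  have h2 : ∀ i : Fin n, ∫⁻ x : Fin n → 𝓧, (2 * ENNReal.ofReal (f₀ (x i) ^ 2)
      + 2 * ENNReal.ofReal ((σ : ℝ) ^ 2)) ∂(Measure.pi fun _ : Fin n => μ)
      = ENNReal.ofReal (2 * ‖f₀‖ ^ 2 + 2 * (σ : ℝ) ^ 2) := by
    intro i
    rw [lintegral_add_right _ measurable_const, lintegral_const, measure_univ, mul_one,
      lintegral_const_mul _ (by fun_prop),
      lintegral_eval_pi i (g := fun z => ENNReal.ofReal (f₀ z ^ 2)) (by fun_prop),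
      lintegral_sq_eq_norm, ENNReal.ofReal_add (by positivity) (by positivity),
      ENNReal.ofReal_mul (by norm_num), ENNReal.ofReal_mul (by norm_num), ENNReal.ofReal_ofNat]
  simp_rw [h2]
  rw [ENNReal.ofReal_mul (by positivity)]
  simp

/-- The second moment of a sum of independent centered variables. -/
lemma lintegral_sq_sum_pi {Ω : Type*} [MeasurableSpace Ω] {ν : Measure Ω} [IsProbabilityMeasure ν]
    {h : Fin n → Ω → ℝ} (hL : ∀ i, MemLp (h i) 2 ν) (h0 : ∀ i, ∫ z, h i z ∂ν = 0) :
    ∫⁻ ω, ENNReal.ofReal ((∑ i, h i (ω i)) ^ 2) ∂(Measure.pi fun _ : Fin n => ν)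
      = ENNReal.ofReal (∑ i, ∫ z, h i z ^ 2 ∂ν) := by
  have hL' : ∀ i, MemLp (fun ω : Fin n → Ω => h i (ω i)) 2 (Measure.pi fun _ : Fin n => ν) :=
    fun i => (hL i).comp_measurePreserving (measurePreserving_eval (fun _ : Fin n => ν) i)
  have hsum : MemLp (fun ω : Fin n → Ω => ∑ i, h i (ω i)) 2 (Measure.pi fun _ : Fin n => ν) :=
    memLp_finsetSum _ fun i _ => hL' i
  have hmean : ∫ ω, ∑ i, h i (ω i) ∂(Measure.pi fun _ : Fin n => ν) = 0 := by
    rw [integral_finsetSum _ fun i _ => (hL' i).integrable (by simp)]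
    refine Finset.sum_eq_zero fun i _ => ?_
    have hmp := measurePreserving_eval (fun _ : Fin n => ν) i
    have h1 := integral_map (f := h i) hmp.measurable.aemeasurable
      (by rw [hmp.map_eq]; exact (hL i).1)
    rw [hmp.map_eq, h0 i] at h1
    exact h1.symm
  have hvar := variance_sum_pi (μ := fun _ : Fin n => ν) (X := h) hL
  have h1 : (∑ i, fun ω : Fin n → Ω => h i (ω i)) = fun ω => ∑ i, h i (ω i) := by
    ext ω; simp
  rw [h1, variance_of_integral_eq_zero hsum.1.aemeasurable hmean] at hvar
  rw [← ofReal_integral_eq_lintegral_ofReal hsum.integrable_sq (ae_of_all _ fun ω => sq_nonneg _),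
    hvar]
  congr 1
  exact Finset.sum_congr rfl fun i _ => variance_of_integral_eq_zero (hL i).1.aemeasurable (h0 i)

lemma lintegral_linear_sq_gaussian (c : Fin n → ℝ) (v : ℝ≥0) :
    ∫⁻ ε, ENNReal.ofReal ((∑ i, c i * ε i) ^ 2) ∂(Measure.pi fun _ : Fin n => gaussianReal 0 v)
      = ENNReal.ofReal (v * ∑ i, c i ^ 2) := by
  have hL : ∀ i, MemLp (fun z : ℝ => c i * z) 2 (gaussianReal 0 v) := fun i =>
    (IsGaussian.memLp_two_id (μ := gaussianReal 0 v)).const_mul (c i)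
  rw [lintegral_sq_sum_pi hL fun i => by
    rw [integral_const_mul, integral_id_gaussianReal, mul_zero]]
  congr 1
  rw [Finset.mul_sum]
  refine Finset.sum_congr rfl fun i _ => ?_
  have hv := variance_id_gaussianReal (μ := 0) (v := v)
  rw [variance_of_integral_eq_zero aemeasurable_id integral_id_gaussianReal] at hv
  simp_rw [mul_pow]
  rw [integral_const_mul, mul_comm]
  congr 1

/-- Given the design, `∑ φ_j(x_i) ε_i` is centered Gaussian with variance `σ² ∑ φ_j(x_i)² ≤ σ² n
C²`. -/
lemma lintegral_sum_noise_sq_le (hφ : IsBoundedEigenbasis φ e) {C : ℝ} (hC : ∀ j x, |φ j x| ≤ C)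
    (f₀ : L2 μ) {D : Fin m → ℝ} (hD : ∀ j, 0 ≤ D j) :
    ∫⁻ p, ENNReal.ofReal (∑ j : Fin m,
        D j * ((∑ i, φ j (p.1 i) * (p.2 i - f₀ (p.1 i))) / (σ : ℝ) ^ 2) ^ 2) ∂(dataLaw μ σ f₀ n)
      ≤ ENNReal.ofReal ((∑ j, D j) * (n * C ^ 2 / (σ : ℝ) ^ 2)) := by
  have hm := measurable_representative f₀
  have hm' := hφ.measurable
  rw [lintegral_dataLaw (by fun_prop)]
  simp only [add_sub_cancel_left]
  refine (lintegral_mono (g := fun _ => ENNReal.ofReal ((∑ j, D j) * (n * C ^ 2 / (σ : ℝ) ^ 2)))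
    fun x => ?_).trans (by simp)
  have h1 : ∀ ε : Fin n → ℝ, ENNReal.ofReal (∑ j : Fin m,
        D j * ((∑ i, φ j (x i) * ε i) / (σ : ℝ) ^ 2) ^ 2)
      = ∑ j : Fin m, ENNReal.ofReal (D j / (σ : ℝ) ^ 4) *
        ENNReal.ofReal ((∑ i, φ j (x i) * ε i) ^ 2) := by
    intro ε
    rw [ENNReal.ofReal_sum_of_nonneg fun j _ => mul_nonneg (hD j) (sq_nonneg _)]
    refine Finset.sum_congr rfl fun j _ => ?_
    rw [← ENNReal.ofReal_mul (div_nonneg (hD j) (by positivity))]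
    congr 1
    rw [div_pow, ← pow_mul]
    ring
  simp_rw [h1]
  rw [lintegral_finsetSum _ fun j _ => by fun_prop, Finset.sum_mul,
    ENNReal.ofReal_sum_of_nonneg fun j _ => mul_nonneg (hD j) (by positivity)]
  refine Finset.sum_le_sum fun j _ => ?_
  rw [lintegral_const_mul _ (by fun_prop), lintegral_linear_sq_gaussian,
    ← ENNReal.ofReal_mul (div_nonneg (hD j) (by positivity))]
  refine ENNReal.ofReal_le_ofReal ?_
  have h2 : ∑ i, φ j (x i) ^ 2 ≤ n * C ^ 2 := by
    refine (Finset.sum_le_sum fun i _ => sq_le_sq' (abs_le.1 (hC j (x i))).1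
      (abs_le.1 (hC j (x i))).2).trans ?_
    simp
  rcases eq_or_ne (σ : ℝ) 0 with h | h
  · simp [h]
  · calc D j / (σ : ℝ) ^ 4 * (((σ ^ 2 : ℝ≥0) : ℝ) * ∑ i, φ j (x i) ^ 2)
        = D j * ((∑ i, φ j (x i) ^ 2) / (σ : ℝ) ^ 2) := by push_cast; field_simp
      _ ≤ _ := by
        have := hD j
        gcongr

/-- The squared distance of the empirical Gram matrix to the identity. -/
noncomputable def gramDefect (φ : ℕ → 𝓧 → ℝ) (m : ℕ) (x : Fin n → 𝓧) : ℝ :=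
  ∑ j : Fin m, ∑ k : Fin m, (∑ i, (φ j (x i) * φ k (x i) - if j = k then 1 else 0)) ^ 2

/-- The defect is the squared Frobenius norm of `ΦᵀΦ - n I`, which dominates the operator norm by
two applications of Cauchy-Schwarz. The threshold `n²/4` allows a deviation of `n/2`. -/
lemma gramBounds_of_gramDefect_le {x : Fin n → 𝓧} (h : gramDefect φ m x ≤ (n : ℝ) ^ 2 / 4) :
    GramBounds φ m x := by
  intro w
  set A : Fin m → Fin m → ℝ := fun j k => ∑ i, (φ j (x i) * φ k (x i) - if j = k then 1 else 0)
  set N := ∑ j, w j ^ 2 with hN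
  have hN0 : 0 ≤ N := Finset.sum_nonneg fun j _ => sq_nonneg _
  have e1 : ∑ i, predict φ x w i ^ 2 - n * N = ∑ j, w j * ∑ k, A j k * w k := by
    have e2 : ∀ i, predict φ x w i ^ 2
        = ∑ j : Fin m, w j * ∑ k : Fin m, (φ j (x i) * φ k (x i)) * w k := by
      intro i
      rw [sq, predict, Finset.sum_mul_sum]
      refine Finset.sum_congr rfl fun j _ => ?_
      rw [Finset.mul_sum]
      exact Finset.sum_congr rfl fun k _ => by ring
    have e3 : N = ∑ j : Fin m, w j * ∑ k : Fin m, (if j = k then (1 : ℝ) else 0) * w k := by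
      refine Finset.sum_congr rfl fun j _ => ?_
      simp [sq]
    have e4 : (n : ℝ) * N
        = ∑ _i : Fin n, ∑ j : Fin m, w j * ∑ k : Fin m, (if j = k then (1 : ℝ) else 0) * w k := by
      rw [← e3]; simp
    rw [e4, ← Finset.sum_sub_distrib]
    simp_rw [e2, ← Finset.sum_sub_distrib, ← mul_sub, ← Finset.sum_sub_distrib, ← sub_mul]
    rw [Finset.sum_comm]
    refine Finset.sum_congr rfl fun j _ => ?_
    rw [← Finset.mul_sum, Finset.sum_comm]
    simp only [A, Finset.sum_mul]
  have e5 : (∑ i, predict φ x w i ^ 2 - n * N) ^ 2 ≤ ((n : ℝ) / 2 * N) ^ 2 := by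
    rw [e1]
    calc (∑ j, w j * ∑ k, A j k * w k) ^ 2
        ≤ N * ∑ j, (∑ k, A j k * w k) ^ 2 := Finset.sum_mul_sq_le_sq_mul_sq _ _ _
      _ ≤ N * ∑ j, (∑ k, A j k ^ 2) * N := by
          gcongr with j _
          exact Finset.sum_mul_sq_le_sq_mul_sq _ _ _
      _ = gramDefect φ m x * N ^ 2 := by
          rw [← Finset.sum_mul, gramDefect]; ring
      _ ≤ (n : ℝ) ^ 2 / 4 * N ^ 2 := by gcongr
      _ = _ := by ring
  have h6 := abs_le.1 (abs_le_of_sq_le_sq e5 (by positivity))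
  have : 0 ≤ (n : ℝ) * N := by positivity
  constructor <;> linarith [h6.1, h6.2]

lemma integral_eigenfunction_mul (hφ : IsBoundedEigenbasis φ e) (j k : ℕ) :
    ∫ z, φ j z * φ k z ∂μ = if j = k then 1 else 0 := by
  rw [← orthonormal_iff_ite.1 e.orthonormal j k, L2.inner_def]
  refine integral_congr_ae ?_
  filter_upwards [hφ.coe_eq j, hφ.coe_eq k] with z h1 h2
  rw [h1, h2]
  simp [mul_comm]

/-- Each of the `m²` entries is a sum of `n` independent centered variables of variance at most
`C⁴`. Against the threshold `n²/4` the probability is of order `m²/n`, whence the requirement `r <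
1/2`. -/
lemma lintegral_gramDefect_le (hφ : IsBoundedEigenbasis φ e) {C : ℝ} (hC : ∀ j x, |φ j x| ≤ C)
    (f₀ : L2 μ) (m : ℕ) :
    ∫⁻ p, ENNReal.ofReal (gramDefect φ m p.1) ∂(dataLaw μ σ f₀ n)
      ≤ ENNReal.ofReal (m ^ 2 * (n * C ^ 4)) := by
  have hm' := hφ.measurable
  have hg : Measurable fun x : Fin n → 𝓧 => gramDefect φ m x := by
    unfold gramDefect; fun_prop
  rw [lintegral_dataLaw (by fun_prop)]
  simp only [lintegral_const, measure_univ, mul_one]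
  have h1 : ∀ x : Fin n → 𝓧, ENNReal.ofReal (gramDefect φ m x)
      = ∑ j : Fin m, ∑ k : Fin m,
        ENNReal.ofReal ((∑ i, (φ j (x i) * φ k (x i) - if j = k then 1 else 0)) ^ 2) := by
    intro x
    rw [gramDefect, ENNReal.ofReal_sum_of_nonneg fun j _ => Finset.sum_nonneg fun k _ => sq_nonneg _]
    exact Finset.sum_congr rfl fun j _ => ENNReal.ofReal_sum_of_nonneg fun k _ => sq_nonneg _
  simp_rw [h1]
  rw [lintegral_finsetSum _ fun j _ => by fun_prop]
  have h2 : ∀ j k : Fin m, ∫⁻ x : Fin n → 𝓧,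
      ENNReal.ofReal ((∑ i, (φ j (x i) * φ k (x i) - if j = k then 1 else 0)) ^ 2)
        ∂(Measure.pi fun _ : Fin n => μ) ≤ ENNReal.ofReal (n * C ^ 4) := by
    intro j k
    have hb : ∀ z, |φ j z * φ k z| ≤ C ^ 2 := fun z => by
      rw [abs_mul, sq]
      exact mul_le_mul (hC _ _) (hC _ _) (abs_nonneg _) ((abs_nonneg _).trans (hC j z))
    have hL : MemLp (fun z => φ j z * φ k z) 2 μ :=
      MemLp.of_bound (by fun_prop) (C ^ 2) (ae_of_all _ hb)
    have hint := integral_eigenfunction_mul hφ j k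
    have hite : (if (j : ℕ) = k then (1 : ℝ) else 0) = if j = k then 1 else 0 := by
      simp [Fin.ext_iff]
    rw [hite] at hint
    rw [lintegral_sq_sum_pi (ν := μ)
      (h := fun _ z => φ j z * φ k z - if j = k then 1 else 0) (fun i => hL.sub (memLp_const _))
      (fun i => by
        rw [integral_sub (hL.integrable (by simp)) (integrable_const _), hint]; simp)]
    refine ENNReal.ofReal_le_ofReal ?_
    rw [Finset.sum_const, Finset.card_univ, Fintype.card_fin, nsmul_eq_mul]
    refine mul_le_mul_of_nonneg_left ?_ (by positivity)
    set t : ℝ := if j = k then 1 else 0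
    calc ∫ z, (φ j z * φ k z - t) ^ 2 ∂μ
        = ∫ z, ((φ j z * φ k z) ^ 2 - (2 * t * (φ j z * φ k z) - t ^ 2)) ∂μ :=
          integral_congr_ae (ae_of_all _ fun z => by ring)
      _ = ∫ z, (φ j z * φ k z) ^ 2 ∂μ - (2 * t * t - t ^ 2) := by
          have hi := hL.integrable (q := 2) (by simp)
          have h3 : Integrable (fun z => 2 * t * (φ j z * φ k z)) μ := hi.const_mul _
          have h4 : Integrable (fun z => 2 * t * (φ j z * φ k z) - t ^ 2) μ :=
            h3.sub (integrable_const _)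
          rw [integral_sub hL.integrable_sq h4, integral_sub h3 (integrable_const _),
            integral_const_mul, hint]
          simp
      _ ≤ ∫ z, (φ j z * φ k z) ^ 2 ∂μ := by nlinarith [sq_nonneg t]
      _ ≤ ∫ _, C ^ 4 ∂μ := by
          refine integral_mono hL.integrable_sq (integrable_const _) fun z => ?_
          have := sq_le_sq' (abs_le.1 (hb z)).1 (abs_le.1 (hb z)).2
          calc _ ≤ _ := this
            _ = _ := by ring
      _ = C ^ 4 := by simp
  calc ∑ j : Fin m, ∫⁻ x : Fin n → 𝓧, ∑ k : Fin m,
        ENNReal.ofReal ((∑ i, (φ j (x i) * φ k (x i) - if j = k then 1 else 0)) ^ 2)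
        ∂(Measure.pi fun _ : Fin n => μ)
      ≤ ∑ _j : Fin m, ∑ _k : Fin m, ENNReal.ofReal (n * C ^ 4) := by
        refine Finset.sum_le_sum fun j _ => ?_
        rw [lintegral_finsetSum _ fun k _ => by fun_prop]
        exact Finset.sum_le_sum fun k _ => h2 j k
    _ = ENNReal.ofReal (m ^ 2 * (n * C ^ 4)) := by
        rw [sq, mul_assoc, ENNReal.ofReal_mul (Nat.cast_nonneg m),
          ENNReal.ofReal_mul (Nat.cast_nonneg m), Finset.sum_const, Finset.sum_const]
        simp only [Finset.card_univ, Fintype.card_fin, nsmul_eq_mul, ENNReal.ofReal_natCast]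

end DataLaw

/-! ### The estimates transferred to the variational posterior. -/

section FixedSample

variable {𝓧 : Type*} [MeasurableSpace 𝓧] [MeasurableSpace.CountablyGenerated 𝓧] {μ : Measure 𝓧}
  [SFinite μ] {φ : ℕ → 𝓧 → ℝ} {e : HilbertBasis ℕ ℝ (L2 μ)} {lam : ℕ → ℝ≥0} {σ : ℝ≥0} {m n : ℕ}
  {x : Fin n → 𝓧} {y : Fin n → ℝ} {Ψ : Measure (L2 μ)} {γ ρ C : ℝ}

lemma secondCountableTopology_L2 : SecondCountableTopology (L2 μ) := by
  have : Fact ((2 : ℝ≥0∞) ≠ ∞) := ⟨ENNReal.ofNat_ne_top⟩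
  infer_instance

lemma norm_headSum_sq (a : EuclideanSpace ℝ (Fin m)) : ‖headSum e a‖ ^ 2 = ∑ i, a.ofLp i ^ 2 := by
  have h := hasSum_coords_sq e (headSum e a)
  simp_rw [coords_headSum] at h
  exact h.unique (hasSum_fin_sq a.ofLp)

lemma headSum_sub (a b : EuclideanSpace ℝ (Fin m)) :
    headSum e (a - b) = headSum e a - headSum e b := by
  simp [headSum, sub_smul]

lemma meanOf_eq_headSum (hC : ∀ j x, |φ j x| ≤ C) (hr : Summable fun j => NNReal.sqrt (lam j))
    (hpos : ∀ j, 0 < lam j) (hΨ : IsVariationalPosterior φ e lam σ m x y Ψ) :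
    meanOf Ψ = headSum e (featureMean φ lam σ m x y) := by
  have := secondCountableTopology_L2 (μ := μ)
  rw [eq_of_isVariationalPosterior hC hr hpos hΨ, meanOf_map_resample (summable_of_summable_sqrt hr)]

lemma radius_nonneg (hγ : γ < 1) (hC : ∀ j x, |φ j x| ≤ C)
    (hr : Summable fun j => NNReal.sqrt (lam j)) (hpos : ∀ j, 0 < lam j)
    (hΨ : IsVariationalPosterior φ e lam σ m x y Ψ) (hρ : IsCredibleRadius γ Ψ ρ) : 0 ≤ ρ := by
  have := secondCountableTopology_L2 (μ := μ)
  rw [eq_of_isVariationalPosterior hC hr hpos hΨ] at hρ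
  exact credible_radius_nonneg hγ (summable_of_summable_sqrt hr) hρ

lemma lt_radius_sq_of_head (hγ : γ < 1) (hC : ∀ j x, |φ j x| ≤ C)
    (hr : Summable fun j => NNReal.sqrt (lam j)) (hpos : ∀ j, 0 < lam j) (hσ : 0 < σ)
    (hΨ : IsVariationalPosterior φ e lam σ m x y Ψ) (hρ : IsCredibleRadius γ Ψ ρ)
    (hG : GramBounds φ m x) {k : ℕ} (hk : k ≤ m) {s : ℝ} (hs : 0 < s)
    (hle : ∀ j < k, s ≤ ((lam j : ℝ)⁻¹ + 2 * n / (σ : ℝ) ^ 2)⁻¹)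
    (hrate : smallBallRate ^ k < 1 - γ) : s * smallBallConst * k < ρ ^ 2 := by
  have := secondCountableTopology_L2 (μ := μ)
  rw [eq_of_isVariationalPosterior hC hr hpos hΨ] at hρ
  set I : Finset (Fin m) := Finset.univ.filter fun j => (j : ℕ) < k with hI
  have hcard : I.card = k := by
    rw [hI, Fin.card_filter_val_lt, min_eq_right hk]
  have h := credible_radius_gt_of_head hγ (summable_of_summable_sqrt hr)
    (posDef_precision hpos x).inv.posSemidef hρ I hs
    (le_dotProduct_inv_precision hpos hσ hG I fun j hj => hle j (Finset.mem_filter.1 hj).2)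
    (by rwa [hcard])
  rwa [hcard] at h

lemma lt_radius_sq_of_tail (hγ : γ < 1) (hC : ∀ j x, |φ j x| ≤ C)
    (hr : Summable fun j => NNReal.sqrt (lam j)) (hpos : ∀ j, 0 < lam j)
    (hΨ : IsVariationalPosterior φ e lam σ m x y Ψ) (hρ : IsCredibleRadius γ Ψ ρ)
    {k : ℕ} {s : ℝ} (hs : 0 < s) (hle : ∀ j, m ≤ j → j < m + k → s ≤ lam j)
    (hrate : smallBallRate ^ k < 1 - γ) : s * smallBallConst * k < ρ ^ 2 := by
  have := secondCountableTopology_L2 (μ := μ)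
  rw [eq_of_isVariationalPosterior hC hr hpos hΨ] at hρ
  have hcard : (Finset.Ico m (m + k)).card = k := by simp
  have h := credible_radius_gt_of_tail hγ (summable_of_summable_sqrt hr) hρ (Finset.Ico m (m + k)) hs
    (fun j hj => ⟨(Finset.mem_Ico.1 hj).1, hle j (Finset.mem_Ico.1 hj).1 (Finset.mem_Ico.1 hj).2⟩)
    (by rwa [hcard])
  rwa [hcard] at h

/-- One sequence `w` dominates both the posterior variances of the head and the prior variances of
the tail, so that the resulting bound need not depend on `m`. -/
lemma radius_sq_le (hγ0 : 0 < γ) (hγ : γ < 1) (hC : ∀ j x, |φ j x| ≤ C)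
    (hr : Summable fun j => NNReal.sqrt (lam j)) (hpos : ∀ j, 0 < lam j)
    (hΨ : IsVariationalPosterior φ e lam σ m x y Ψ) (hρ : IsCredibleRadius γ Ψ ρ)
    (hG : GramBounds φ m x) {w : ℕ → ℝ} {B : ℝ} (hB : 0 ≤ B) (hw : ∀ j < m, varBound lam σ n j ≤ w j)
    (hw' : ∀ j, m ≤ j → lam j ≤ w j) (hsum : ∀ N, ∑ j ∈ Finset.range N, w j ≤ B) :
    ρ ^ 2 ≤ B / γ := by
  have := secondCountableTopology_L2 (μ := μ)
  rw [eq_of_isVariationalPosterior hC hr hpos hΨ] at hρ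
  have hw0 : ∀ j, 0 ≤ w j := fun j => by
    rcases lt_or_ge j m with h | h
    · exact (varBound_pos hpos n j).le.trans (hw j h)
    · exact (NNReal.coe_nonneg _).trans (hw' j h)
  refine credible_radius_sq_le hγ0 hγ (summable_of_summable_sqrt hr)
    (posDef_precision hpos x).inv.posSemidef hρ ?_ hB
  have h1 : ENNReal.ofReal ((precision φ lam σ m x)⁻¹).trace
      ≤ ∑' j, if j < m then ENNReal.ofReal (w j) else 0 := by
    calc ENNReal.ofReal ((precision φ lam σ m x)⁻¹).trace
        ≤ ENNReal.ofReal (∑ j ∈ Finset.range m, w j) := by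
          refine ENNReal.ofReal_le_ofReal ((trace_inv_precision_le hpos hG).trans ?_)
          rw [← Fin.sum_univ_eq_sum_range]
          exact Finset.sum_le_sum fun j _ => hw j j.2
      _ = ∑ j ∈ Finset.range m, if j < m then ENNReal.ofReal (w j) else 0 := by
          rw [ENNReal.ofReal_sum_of_nonneg fun j _ => hw0 j]
          exact Finset.sum_congr rfl fun j hj => by rw [if_pos (Finset.mem_range.1 hj)]
      _ ≤ _ := ENNReal.sum_le_tsum _
  calc _ ≤ (∑' j, if j < m then ENNReal.ofReal (w j) else 0)
        + ∑' j, (if j < m then 0 else (lam j : ℝ≥0∞)) := by gcongr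
    _ = ∑' j, ((if j < m then ENNReal.ofReal (w j) else 0)
        + (if j < m then 0 else (lam j : ℝ≥0∞))) := ENNReal.tsum_add.symm
    _ ≤ ∑' j, ENNReal.ofReal (w j) := by
        refine ENNReal.tsum_le_tsum fun j => ?_
        split_ifs with h
        · simp
        · rw [zero_add, ← ENNReal.ofReal_coe_nnreal]
          exact ENNReal.ofReal_le_ofReal (hw' j (not_lt.1 h))
    _ ≤ ENNReal.ofReal B := by
        refine ENNReal.tsum_le_of_sum_range_le fun N => ?_
        rw [← ENNReal.ofReal_sum_of_nonneg fun j _ => hw0 j]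
        exact ENNReal.ofReal_le_ofReal (hsum N)

lemma norm_sub_headSum_sq_le {f₀ : L2 μ} {k : ℕ} (hk : k ≤ m) {s : ℝ} (hs : 0 ≤ s)
    {S : ℝ} (hS : HasSum (fun j : ℕ => ((j : ℝ) + 1) ^ s * coords e f₀ j ^ 2) S) :
    ‖f₀ - headSum e (WithLp.toLp 2 fun j : Fin m => if (j : ℕ) < k then coords e f₀ j else 0)‖ ^ 2
      ≤ ((k : ℝ) + 1) ^ (-s) * S := by
  refine hasSum_le (fun j => ?_) (hasSum_coords_sq e _) (hS.mul_left _)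
  have h0 : 0 ≤ ((k : ℝ) + 1) ^ (-s) * (((j : ℝ) + 1) ^ s * coords e f₀ j ^ 2) := by positivity
  have h1 : ∀ g : L2 μ, coords e (f₀ - g) j = coords e f₀ j - coords e g j := fun g => by
    simp only [coords, inner_sub_right]
  rw [h1, coords_headSum]
  by_cases hj : j < k
  · rw [dif_pos (hj.trans_le hk)]
    simp only [hj, if_true, sub_self]
    simpa using h0
  · have h2 : (1 : ℝ) ≤ ((k : ℝ) + 1) ^ (-s) * ((j : ℝ) + 1) ^ s := by
      rw [Real.rpow_neg (by positivity), ← div_eq_inv_mul, one_le_div (by positivity)]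
      have : (k : ℝ) ≤ j := by exact_mod_cast not_lt.1 hj
      gcongr
    have h3 : coords e f₀ j - (if h : j < m then
        (WithLp.toLp 2 fun j : Fin m => if (j : ℕ) < k then coords e f₀ j else 0 :
          EuclideanSpace ℝ (Fin m)) ⟨j, h⟩ else 0) = coords e f₀ j := by
      split_ifs <;> simp [hj]
    rw [h3, ← mul_assoc]
    exact le_mul_of_one_le_left (sq_nonneg _) h2

end FixedSample

/-- No measurability of the events is needed. -/
lemma tendsto_measure_one {Ω : ℕ → Type*} [∀ n, MeasurableSpace (Ω n)] {P : ∀ n, Measure (Ω n)}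
    [∀ n, IsProbabilityMeasure (P n)] {E : ∀ n, Set (Ω n)} {δ : ℕ → ℝ}
    (hE : ∀ᶠ n in atTop, P n (E n)ᶜ ≤ ENNReal.ofReal (δ n)) (hδ : Tendsto δ atTop (𝓝 0)) :
    Tendsto (fun n => P n (E n)) atTop (𝓝 1) := by
  have h1 : Tendsto (fun n => 1 - ENNReal.ofReal (δ n)) atTop (𝓝 1) := by
    have := ENNReal.Tendsto.sub (tendsto_const_nhds (x := (1 : ℝ≥0∞)))
      (ENNReal.tendsto_ofReal hδ) (Or.inl ENNReal.one_ne_top)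
    simpa using this
  refine tendsto_of_tendsto_of_tendsto_of_le_of_le' h1 tendsto_const_nhds ?_
    (Eventually.of_forall fun n => prob_le_one)
  filter_upwards [hE] with n hn
  rw [tsub_le_iff_right]
  calc (1 : ℝ≥0∞) = P n (E n ∪ (E n)ᶜ) := by rw [Set.union_compl_self, measure_univ]
    _ ≤ P n (E n) + P n (E n)ᶜ := measure_union_le _ _
    _ ≤ _ := by gcongr

/-- The order `exp (-τ_n j^(1/d))` of the eigenvalues. -/
noncomputable def eigRate (d : ℕ) (α : ℝ) (n j : ℕ) : ℝ :=
  Real.exp (-rescaling d α n * ((j : ℝ) + 1) ^ (1 / (d : ℝ)))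

/-- The effective dimension `n^(d/(d+2α))`. -/
noncomputable def effDim (d : ℕ) (α : ℝ) (n : ℕ) : ℝ := (n : ℝ) ^ ((d : ℝ) / (d + 2 * α))

/-- The exponent `t` for which the `j`-th eigenvalue is of the order of `n^(-t)`. -/
noncomputable def relIndex (d : ℕ) (α : ℝ) (n j : ℕ) : ℝ :=
  ((j : ℝ) + 1) ^ (1 / (d : ℝ)) * (n : ℝ) ^ (-(1 / ((d : ℝ) + 2 * α)))

/-! ### Eigenvalue rates and the effective dimension. -/

section Rates

variable {d : ℕ} {α : ℝ} {n : ℕ}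

lemma eigRate_pos (j : ℕ) : 0 < eigRate d α n j := Real.exp_pos _

lemma relIndex_nonneg (j : ℕ) : 0 ≤ relIndex d α n j := by
  unfold relIndex; positivity

/-- The factor `log n` in `rescaling` turns the exponential into a power of `n`. -/
lemma eigRate_eq (hn : 0 < n) (j : ℕ) : eigRate d α n j = (n : ℝ) ^ (-relIndex d α n j) := by
  have hn' : (0 : ℝ) < n := by exact_mod_cast hn
  rw [Real.rpow_def_of_pos hn', eigRate, rescaling, relIndex]
  congr 1
  ring

lemma effDim_pos (hn : 0 < n) : 0 < effDim d α n := by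
  have hn' : (0 : ℝ) < n := by exact_mod_cast hn
  unfold effDim; positivity

lemma one_le_effDim (hα : 0 < α) (hn : 0 < n) : 1 ≤ effDim d α n :=
  Real.one_le_rpow (by exact_mod_cast hn) (by positivity)

/-- Hence the exponent equals 1, and the eigenvalue has the order of the noise level `1/n`, when the
index is `effDim`. -/
lemma relIndex_pow (hd : 0 < d) (hn : 0 < n) (hα : 0 < α) (j : ℕ) :
    relIndex d α n j ^ d = ((j : ℝ) + 1) / effDim d α n := by
  have hn' : (0 : ℝ) < n := by exact_mod_cast hn
  have hd' : (d : ℝ) ≠ 0 := by exact_mod_cast hd.ne'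
  rw [relIndex, mul_pow, ← Real.rpow_natCast, ← Real.rpow_mul (by positivity),
    ← Real.rpow_natCast, ← Real.rpow_mul (by positivity), one_div_mul_cancel hd', Real.rpow_one,
    effDim, div_eq_mul_inv (_ + 1 : ℝ), ← Real.rpow_neg (by positivity)]
  congr 2
  field_simp

lemma relIndex_le_iff (hd : 0 < d) (hn : 0 < n) (hα : 0 < α) {s : ℝ} (hs : 0 ≤ s) (j : ℕ) :
    relIndex d α n j ≤ s ↔ (j : ℝ) + 1 ≤ s ^ d * effDim d α n := by
  rw [← pow_le_pow_iff_left₀ (relIndex_nonneg j) hs hd.ne', relIndex_pow hd hn hα,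
    div_le_iff₀ (effDim_pos hn)]

lemma le_relIndex_iff (hd : 0 < d) (hn : 0 < n) (hα : 0 < α) {s : ℝ} (hs : 0 ≤ s) (j : ℕ) :
    s ≤ relIndex d α n j ↔ s ^ d * effDim d α n ≤ (j : ℝ) + 1 := by
  rw [← pow_le_pow_iff_left₀ hs (relIndex_nonneg j) hd.ne', relIndex_pow hd hn hα,
    le_div_iff₀ (effDim_pos hn)]

lemma inv_le_eigRate (hd : 0 < d) (hn : 0 < n) (hα : 0 < α) {j : ℕ}
    (hj : (j : ℝ) + 1 ≤ effDim d α n) : (n : ℝ)⁻¹ ≤ eigRate d α n j := by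
  have h : relIndex d α n j ≤ 1 := (relIndex_le_iff hd hn hα zero_le_one j).2 (by simpa using hj)
  rw [eigRate_eq hn, ← Real.rpow_neg_one]
  exact Real.rpow_le_rpow_of_exponent_le (by exact_mod_cast hn) (by linarith)

lemma effDim_rpow (hd : 0 < d) (hα : 0 < α) (s : ℝ) :
    effDim d α n ^ (s / d) = (n : ℝ) ^ (s / (d + 2 * α)) := by
  have hd' : (d : ℝ) ≠ 0 := by exact_mod_cast hd.ne'
  rw [effDim, ← Real.rpow_mul (by positivity)]
  congr 1
  field_simp

/-- At `J = effDim` the squared bias `J^(-2α/d)` and the variance `J/n` coincide. -/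
lemma effDim_rpow_neg (hd : 0 < d) (hn : 0 < n) (hα : 0 < α) :
    effDim d α n ^ (-(2 * α / d)) = effDim d α n / n := by
  have hn' : (0 : ℝ) < n := by exact_mod_cast hn
  have hd' : (d : ℝ) ≠ 0 := by exact_mod_cast hd.ne'
  rw [← neg_div, effDim_rpow hd hα, effDim, ← Real.rpow_sub_one hn'.ne']
  congr 1
  field_simp
  ring

/-- A constant for which `(1 + t)^(2d) ≤ C 2^(t-1)`. -/
noncomputable def decayConst (d : ℕ) : ℝ := 4 * ((2 * d).factorial / Real.log 2 ^ (2 * d))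

lemma decayConst_pos (d : ℕ) : 0 < decayConst d := by
  have := Real.log_pos one_lt_two
  unfold decayConst; positivity

lemma two_rpow_le {t : ℝ} (ht : 0 ≤ t) (d : ℕ) :
    (2 : ℝ) ^ (1 - t) ≤ decayConst d / (1 + t) ^ (2 * d) := by
  have hl := Real.log_pos one_lt_two
  have h := Real.pow_div_factorial_le_exp ((1 + t) * Real.log 2) (by positivity) (2 * d)
  have e1 : Real.exp ((1 + t) * Real.log 2) = 2 ^ (1 + t) := by
    rw [Real.rpow_def_of_pos two_pos, mul_comm]
  rw [e1, mul_pow, div_le_iff₀ (by positivity)] at h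
  rw [le_div_iff₀ (by positivity), decayConst]
  have e2 : (2 : ℝ) ^ (1 - t) * 2 ^ (1 + t) = 4 := by
    rw [← Real.rpow_add two_pos]; norm_num
  rw [← mul_div_assoc, le_div_iff₀ (by positivity), mul_assoc]
  calc _ ≤ (2 : ℝ) ^ (1 - t) * (2 ^ (1 + t) * ((2 * d).factorial : ℝ)) := by gcongr
    _ = _ := by rw [← mul_assoc, e2]

/-- A majorant of the truncated eigenvalues with a telescoping sum. -/
noncomputable def majorant (J : ℝ) (j : ℕ) : ℝ := J ^ 2 * ((J + j)⁻¹ - (J + (j + 1 : ℕ))⁻¹)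

lemma sum_majorant_le {J : ℝ} (hJ : 0 < J) (N : ℕ) : ∑ j ∈ Finset.range N, majorant J j ≤ J := by
  simp only [majorant]
  rw [← Finset.mul_sum, Finset.sum_range_sub' (fun j : ℕ => (J + j)⁻¹)]
  have : 0 ≤ (J + N)⁻¹ := by positivity
  calc J ^ 2 * ((J + (0 : ℕ))⁻¹ - (J + N)⁻¹) ≤ J ^ 2 * J⁻¹ := by
        gcongr; simpa using this
    _ = J := by field_simp

/-- With `t = relIndex`, the minimum is at most `n⁻¹ 2^(1-t)`: for `t ≥ 1` this uses `n ≥ 2`.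
Exponential decay beats `(1+t)^(-2d)`, and `(1+t)^d ≥ 1 + t^d = 1 + (j+1)/J` leaves a quadratic
decay in `j/J`, whose sum is of order `J`. -/
lemma min_eigRate_le (hd : 0 < d) (hn : 2 ≤ n) (hα : 0 < α) (j : ℕ) :
    min (eigRate d α n j) (n : ℝ)⁻¹ ≤ decayConst d / n * majorant (effDim d α n) j := by
  have hn0 : 0 < n := by omega
  have hn' : (2 : ℝ) ≤ n := by exact_mod_cast hn
  have hJ := effDim_pos (d := d) (α := α) hn0
  set J := effDim d α n with hJd
  set t := relIndex d α n j with htd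
  have ht : 0 ≤ t := relIndex_nonneg j
  have h1 : min (eigRate d α n j) (n : ℝ)⁻¹ ≤ (n : ℝ)⁻¹ * 2 ^ (1 - t) := by
    rcases le_total t 1 with h | h
    · exact (min_le_right _ _).trans (le_mul_of_one_le_right (by positivity)
        (Real.one_le_rpow one_le_two (by linarith)))
    · refine (min_le_left _ _).trans ?_
      rw [eigRate_eq hn0, ← htd, show -t = -1 + (1 - t) by ring, Real.rpow_add (by positivity),
        Real.rpow_neg_one]
      exact mul_le_mul_of_nonneg_left
        (Real.rpow_le_rpow_of_nonpos two_pos hn' (by linarith)) (by positivity)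
  refine h1.trans ?_
  have h2 : 1 + t ^ d ≤ (1 + t) ^ d := by
    have := pow_add_pow_le zero_le_one ht hd.ne'
    rwa [one_pow] at this
  have h3 : t ^ d = ((j : ℝ) + 1) / J := relIndex_pow hd hn0 hα j
  have h4 : (1 + t) ^ (2 * d) ≥ (1 + ((j : ℝ) + 1) / J) ^ 2 := by
    rw [mul_comm, pow_mul, ← h3]
    gcongr
  have h5 : ((1 + ((j : ℝ) + 1) / J) ^ 2)⁻¹ ≤ majorant J j := by
    have e1 : majorant J j = J ^ 2 / ((J + j) * (J + j + 1)) := by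
      rw [majorant, inv_sub_inv (by positivity) (by positivity)]
      push_cast
      rw [add_sub_assoc, ← add_assoc]
      ring_nf
    have e2 : ((1 + ((j : ℝ) + 1) / J) ^ 2)⁻¹ = J ^ 2 / (J + j + 1) ^ 2 := by
      field_simp; ring
    rw [e1, e2]
    gcongr
    nlinarith [Nat.cast_nonneg (α := ℝ) j]
  calc (n : ℝ)⁻¹ * 2 ^ (1 - t) ≤ (n : ℝ)⁻¹ * (decayConst d / (1 + t) ^ (2 * d)) := by
        gcongr; exact two_rpow_le ht d
    _ ≤ (n : ℝ)⁻¹ * (decayConst d / (1 + ((j : ℝ) + 1) / J) ^ 2) := by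
        have := decayConst_pos d
        gcongr
    _ = decayConst d / n * ((1 + ((j : ℝ) + 1) / J) ^ 2)⁻¹ := by ring
    _ ≤ _ := by
        have := decayConst_pos d
        gcongr

/-- `n^(2t) ≤ 4^α n² t^(2α)` for `n^(-1/(d+2α)) ≤ t ≤ 1`. -/
lemma inv_eigRate_sq_le (hd : 0 < d) (hn : 0 < n) (hα : 0 < α) {j : ℕ}
    (hj : (j : ℝ) + 1 ≤ effDim d α n) : ((eigRate d α n j) ^ 2)⁻¹
      ≤ 4 ^ α * n * effDim d α n * ((j : ℝ) + 1) ^ (2 * α / d) := by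
  have hn' : (1 : ℝ) ≤ n := by exact_mod_cast hn
  have hn0 : (0 : ℝ) < n := by linarith
  have hd' : (0 : ℝ) < d := by exact_mod_cast hd
  set t := relIndex d α n j with htd
  have ht : 0 ≤ t := relIndex_nonneg j
  have ht1 : t ≤ 1 := (relIndex_le_iff hd hn hα zero_le_one j).2 (by simpa using hj)
  have e1 : ((eigRate d α n j) ^ 2)⁻¹ = (n : ℝ) ^ (2 * t) := by
    rw [eigRate_eq hn, ← Real.rpow_natCast, ← Real.rpow_mul hn0.le, ← Real.rpow_neg hn0.le]
    congr 1; push_cast; ring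
  have e2 : (n : ℝ) * effDim d α n * ((j : ℝ) + 1) ^ (2 * α / d) = n ^ 2 * t ^ (2 * α) := by
    rw [htd, relIndex, Real.mul_rpow (by positivity) (by positivity),
      ← Real.rpow_mul (by positivity), ← Real.rpow_mul (by positivity), effDim]
    have : (n : ℝ) * (n : ℝ) ^ ((d : ℝ) / (d + 2 * α))
        = n ^ 2 * (n : ℝ) ^ (-(1 / ((d : ℝ) + 2 * α)) * (2 * α)) := by
      rw [← Real.rpow_one_add' hn0.le (by positivity), ← Real.rpow_natCast, ← Real.rpow_add hn0]
      congr 1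
      push_cast
      field_simp
      ring
    rw [this, show 1 / (d : ℝ) * (2 * α) = 2 * α / d by ring]
    ring
  rw [e1, mul_assoc, mul_assoc, ← mul_assoc (n : ℝ), e2]
  -- For `t ≤ 1/2`, `n^(2t) ≤ n` while `t ≥ n^(-1/(d+2α))` yields `t^(2α) ≥ 1/n`. For `t ≥ 1/2`,
  -- `n^(2t) ≤ n²` and the constant `4^α` compensates `t^(2α)`.
  rcases le_total t (1 / 2) with h | h
  · have h1 : (n : ℝ) ^ (-(1 / ((d : ℝ) + 2 * α))) ≤ t := by
      rw [htd, relIndex]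
      exact le_mul_of_one_le_left (by positivity)
        (Real.one_le_rpow (by linarith [Nat.cast_nonneg (α := ℝ) j]) (by positivity))
    have h2 : (n : ℝ)⁻¹ ≤ t ^ (2 * α) := by
      calc (n : ℝ)⁻¹ = (n : ℝ) ^ (-1 : ℝ) := (Real.rpow_neg_one _).symm
        _ ≤ (n : ℝ) ^ (-(1 / ((d : ℝ) + 2 * α)) * (2 * α)) := by
            refine Real.rpow_le_rpow_of_exponent_le hn' ?_
            rw [neg_mul, neg_le_neg_iff, div_mul_eq_mul_div, div_le_one (by positivity)]
            linarith
        _ = ((n : ℝ) ^ (-(1 / ((d : ℝ) + 2 * α)))) ^ (2 * α) := Real.rpow_mul hn0.le _ _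
        _ ≤ _ := by gcongr
    calc (n : ℝ) ^ (2 * t) ≤ (n : ℝ) ^ (1 : ℝ) :=
          Real.rpow_le_rpow_of_exponent_le hn' (by linarith)
      _ = 1 * (n ^ 2 * (n : ℝ)⁻¹) := by rw [Real.rpow_one]; field_simp
      _ ≤ _ := by
        gcongr
        exact Real.one_le_rpow (by norm_num) hα.le
  · have h1 : 1 ≤ 4 ^ α * t ^ (2 * α) := by
      calc (1 : ℝ) = 4 ^ α * (1 / 2) ^ (2 * α) := by
            rw [Real.rpow_mul (by norm_num), ← Real.mul_rpow (by norm_num) (by positivity)]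
            norm_num
        _ ≤ _ := by gcongr
    calc (n : ℝ) ^ (2 * t) ≤ (n : ℝ) ^ (2 : ℝ) :=
          Real.rpow_le_rpow_of_exponent_le hn' (by linarith)
      _ = n ^ 2 * 1 := by rw [mul_one]; exact_mod_cast Real.rpow_natCast (n : ℝ) 2
      _ ≤ n ^ 2 * (4 ^ α * t ^ (2 * α)) := by gcongr
      _ = _ := by ring

lemma rescaling_pos (hn : 2 ≤ n) : 0 < rescaling d α n := by
  have hn' : (1 : ℝ) < n := by exact_mod_cast hn
  have := Real.log_pos hn'
  unfold rescaling; positivity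

/-- The square root only halves `τ`, and the term of degree `2d` of the exponential series in
`(j+1)^(1/d)` gives the summable bound `(j+1)⁻²`. -/
lemma summable_sqrt_of_le_eigRate (hd : 0 < d) (hn : 2 ≤ n) {lam : ℕ → ℝ≥0} {C : ℝ}
    (h : ∀ j, lam j ≤ C * eigRate d α n j) : Summable fun j => NNReal.sqrt (lam j) := by
  have hτ := rescaling_pos (d := d) (α := α) hn
  have hd' : (d : ℝ) ≠ 0 := by exact_mod_cast hd.ne'
  set τ := rescaling d α n with hτd
  have hs : Summable fun j : ℕ => Real.sqrt C * ((2 * d).factorial * (2 / τ) ^ (2 * d)) *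
      (1 / ((j + 1 : ℕ) : ℝ) ^ 2) :=
    (((summable_nat_add_iff 1).2 (Real.summable_one_div_nat_pow.2 one_lt_two))).mul_left _
  rw [← NNReal.summable_coe]
  refine hs.of_nonneg_of_le (fun j => NNReal.coe_nonneg _) fun j => ?_
  rw [Real.coe_sqrt]
  refine (Real.sqrt_le_sqrt (h j)).trans ?_
  rw [Real.sqrt_mul' _ (eigRate_pos j).le, mul_assoc]
  refine mul_le_mul_of_nonneg_left ?_ (Real.sqrt_nonneg _)
  set u := ((j : ℝ) + 1) ^ (1 / (d : ℝ)) with hu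
  have hu0 : 0 < u := by positivity
  have e1 : Real.sqrt (eigRate d α n j) = (Real.exp (τ / 2 * u))⁻¹ := by
    rw [eigRate, Real.sqrt_eq_rpow, ← Real.exp_mul, ← Real.exp_neg]
    congr 1; ring
  have e2 : u ^ (2 * d) = ((j + 1 : ℕ) : ℝ) ^ 2 := by
    rw [mul_comm, pow_mul, hu, ← Real.rpow_natCast (_ ^ _) d, ← Real.rpow_mul (by positivity),
      one_div_mul_cancel hd', Real.rpow_one]
    push_cast; rfl
  have h1 := Real.pow_div_factorial_le_exp (τ / 2 * u) (by positivity) (2 * d)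
  rw [e1]
  calc (Real.exp (τ / 2 * u))⁻¹ ≤ ((τ / 2 * u) ^ (2 * d) / (2 * d).factorial)⁻¹ := by gcongr
    _ = _ := by
      rw [← e2, mul_pow, div_pow, div_pow]
      field_simp

end Rates

/-! ### Estimation error and radius at a given sample size. -/

section Bounds

variable {𝓧 : Type*} [MeasurableSpace 𝓧] [MeasurableSpace.CountablyGenerated 𝓧] {μ : Measure 𝓧}
  [IsProbabilityMeasure μ] {φ : ℕ → 𝓧 → ℝ} {e : HilbertBasis ℕ ℝ (L2 μ)} {lam : ℕ → ℝ≥0} {σ : ℝ≥0}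
  {d m n k : ℕ} {α : ℝ} {x : Fin n → 𝓧} {y : Fin n → ℝ} {Ψ : Measure (L2 μ)}
  {γ ρ C c₀ C₀ c₁ S : ℝ} {f₀ : L2 μ}

lemma lam_pos_of_le (hc₀ : 0 < c₀) (hlo : ∀ j, c₀ * eigRate d α n j ≤ lam j) (j : ℕ) : 0 < lam j := by
  have := mul_pos hc₀ (eigRate_pos (d := d) (α := α) (n := n) j)
  exact_mod_cast this.trans_le (hlo j)

lemma varBound_le_majorant (hd : 0 < d) (hn : 2 ≤ n) (hα : 0 < α) (hσ : 0 < σ)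
    (hpos : ∀ j, 0 < lam j) (hC₀ : 0 ≤ C₀) (hup : ∀ j, lam j ≤ C₀ * eigRate d α n j) (j : ℕ) :
    varBound lam σ n j
      ≤ (C₀ + 2 * (σ : ℝ) ^ 2) * (decayConst d / n * majorant (effDim d α n) j) := by
  refine le_trans ?_ (mul_le_mul_of_nonneg_left (min_eigRate_le hd hn hα j) (by positivity))
  have h1 := (varBound_le_lam (σ := σ) hpos n j).trans (hup j)
  have h2 := varBound_le_div hpos hσ (by omega : 0 < n) j
  have h3 := eigRate_pos (d := d) (α := α) (n := n) j
  have h4 : (0 : ℝ) ≤ (σ : ℝ) ^ 2 := by positivity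
  rcases min_choice (eigRate d α n j) (n : ℝ)⁻¹ with h | h <;> rw [h]
  · exact h1.trans (mul_le_mul_of_nonneg_right (by linarith) h3.le)
  · refine h2.trans ?_
    rw [div_eq_mul_inv]
    exact mul_le_mul_of_nonneg_right (by linarith) (by positivity)

/-- The first `k` coefficients of `f₀`, among the first `m`. -/
noncomputable def truncation (e : HilbertBasis ℕ ℝ (L2 μ)) (f₀ : L2 μ) (m k : ℕ) : Fin m → ℝ :=
  fun j => if (j : ℕ) < k then coords e f₀ j else 0

/-- The random part of the bound for the estimation error. -/
noncomputable def fluctuation (φ : ℕ → 𝓧 → ℝ) (lam : ℕ → ℝ≥0) (σ : ℝ≥0) (f₀ : L2 μ)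
    (θ : Fin m → ℝ) (p : (Fin n → 𝓧) × (Fin n → ℝ)) : ℝ :=
  (∑ i, residual φ f₀ θ (p.1 i) ^ 2) / (σ : ℝ) ^ 2
    + ∑ j : Fin m, varBound lam σ n j *
        ((∑ i, φ j (p.1 i) * (p.2 i - f₀ (p.1 i))) / (σ : ℝ) ^ 2) ^ 2

lemma measurable_fluctuation (hφ : IsBoundedEigenbasis φ e) (f₀ : L2 μ) (θ : Fin m → ℝ) :
    Measurable (fluctuation (n := n) φ lam σ f₀ θ) := by
  have h1 := measurable_residual hφ f₀ θ
  have h2 := measurable_representative f₀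
  have h3 := hφ.measurable
  unfold fluctuation
  fun_prop

lemma truncation_error_le (hd : 0 < d) (hn : 0 < n) (hα : 0 < α) (hk : k ≤ m) (hc₁ : 0 < c₁)
    (hk₁ : c₁ * effDim d α n ≤ k)
    (hS : HasSum (fun j : ℕ => ((j : ℝ) + 1) ^ (2 * α / d) * coords e f₀ j ^ 2) S) :
    ‖f₀ - headSum e (WithLp.toLp 2 (truncation e f₀ m k))‖ ^ 2
      ≤ c₁ ^ (-(2 * α / d)) * S * (effDim d α n / n) := by
  have hJ := effDim_pos (d := d) (α := α) hn
  have hS0 : 0 ≤ S := hS.nonneg fun j => by positivity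
  refine (norm_sub_headSum_sq_le hk (by positivity) hS).trans ?_
  calc ((k : ℝ) + 1) ^ (-(2 * α / d)) * S ≤ (c₁ * effDim d α n) ^ (-(2 * α / d)) * S := by
        refine mul_le_mul_of_nonneg_right (Real.rpow_le_rpow_of_nonpos (by positivity)
          (by linarith) ?_) hS0
        rw [neg_nonpos]; positivity
    _ = _ := by
        rw [Real.mul_rpow hc₁.le hJ.le, effDim_rpow_neg hd hn hα]; ring

/-- Both parts are of order `J = effDim`: the bias part is `n` times the squared truncation error
`J/n`, and the noise part is `n` times `∑ varBound ≲ J/n`. -/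
lemma lintegral_fluctuation_le (hd : 0 < d) (hn : 2 ≤ n) (hα : 0 < α) (hσ : 0 < σ)
    (hφ : IsBoundedEigenbasis φ e) (hC : ∀ j x, |φ j x| ≤ C)
    (hc₀ : 0 < c₀) (hlo : ∀ j, c₀ * eigRate d α n j ≤ lam j)
    (hC₀ : 0 ≤ C₀) (hup : ∀ j, lam j ≤ C₀ * eigRate d α n j) (hk : k ≤ m) (hc₁ : 0 < c₁)
    (hk₁ : c₁ * effDim d α n ≤ k)
    (hS : HasSum (fun j : ℕ => ((j : ℝ) + 1) ^ (2 * α / d) * coords e f₀ j ^ 2) S) :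
    ∫⁻ p, ENNReal.ofReal (fluctuation φ lam σ f₀ (truncation e f₀ m k) p) ∂(dataLaw μ σ f₀ n)
      ≤ ENNReal.ofReal ((c₁ ^ (-(2 * α / d)) * S + C ^ 2 * (C₀ + 2 * (σ : ℝ) ^ 2) * decayConst d)
          / (σ : ℝ) ^ 2 * effDim d α n) := by
  have hn0 : 0 < n := by omega
  have hn' : (0 : ℝ) < n := by exact_mod_cast hn0
  have hσ' : (0 : ℝ) < σ := by exact_mod_cast hσ
  have hpos := lam_pos_of_le hc₀ hlo
  have hS0 : 0 ≤ S := hS.nonneg fun j => by positivity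
  have hJ := effDim_pos (d := d) (α := α) hn0
  have hdec := decayConst_pos d
  set θ := truncation e f₀ m k with hθ
  have h1 := measurable_residual hφ f₀ θ
  have hsplit : ∀ p : (Fin n → 𝓧) × (Fin n → ℝ), ENNReal.ofReal (fluctuation φ lam σ f₀ θ p)
      = ENNReal.ofReal (((σ : ℝ) ^ 2)⁻¹) * ENNReal.ofReal (∑ i, residual φ f₀ θ (p.1 i) ^ 2)
        + ENNReal.ofReal (∑ j : Fin m, varBound lam σ n j *
        ((∑ i, φ j (p.1 i) * (p.2 i - f₀ (p.1 i))) / (σ : ℝ) ^ 2) ^ 2) := by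
    intro p
    have hA : 0 ≤ (∑ i, residual φ f₀ θ (p.1 i) ^ 2) / (σ : ℝ) ^ 2 := by positivity
    have hB : 0 ≤ ∑ j : Fin m, varBound lam σ n j *
        ((∑ i, φ j (p.1 i) * (p.2 i - f₀ (p.1 i))) / (σ : ℝ) ^ 2) ^ 2 :=
      Finset.sum_nonneg fun j _ => mul_nonneg (varBound_pos hpos n j).le (sq_nonneg _)
    rw [fluctuation, ENNReal.ofReal_add hA hB, ← ENNReal.ofReal_mul (by positivity), div_eq_inv_mul]
  simp_rw [hsplit]
  rw [lintegral_add_left (by fun_prop), lintegral_const_mul _ (by fun_prop),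
    lintegral_sum_residual_sq hφ, ← ENNReal.ofReal_mul (by positivity)]
  have hD : ∑ j : Fin m, varBound lam σ n j
      ≤ (C₀ + 2 * (σ : ℝ) ^ 2) * (decayConst d / n * effDim d α n) := by
    refine (Finset.sum_le_sum (f := fun j : Fin m => varBound lam σ n j) fun j _ =>
      varBound_le_majorant hd hn hα hσ hpos hC₀ hup (j : ℕ)).trans ?_
    rw [Fin.sum_univ_eq_sum_range (fun j => (C₀ + 2 * (σ : ℝ) ^ 2) *
      (decayConst d / n * majorant (effDim d α n) j)), ← Finset.mul_sum, ← Finset.mul_sum]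
    have := sum_majorant_le hJ m
    gcongr
  have hT := truncation_error_le hd hn0 hα hk hc₁ hk₁ hS
  have hN := lintegral_sum_noise_sq_le (σ := σ) (n := n) hφ hC f₀
    (D := fun j : Fin m => varBound lam σ n j) fun j => (varBound_pos hpos n j).le
  refine (add_le_add (ENNReal.ofReal_le_ofReal (?_ : _ ≤ ((σ : ℝ) ^ 2)⁻¹ *
      (n * (c₁ ^ (-(2 * α / d)) * S * (effDim d α n / n))))) (hN.trans (ENNReal.ofReal_le_ofReal
      (mul_le_mul_of_nonneg_right hD (by positivity))))).trans ?_
  · gcongr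
    exact hT
  · rw [← ENNReal.ofReal_add (by positivity) (by positivity)]
    refine ENNReal.ofReal_le_ofReal (le_of_eq ?_)
    field_simp

/-- The energy estimate is applied around `f₀` truncated at `k ≤ J`, not at `m`: the prior penalty
involves `λ_j⁻²`, which `inv_eigRate_sq_le` bounds by the Sobolev weight only up to `J`. The omitted
coefficients are charged to the residual. -/
lemma norm_meanOf_sub_sq_le (hd : 0 < d) (hn : 2 ≤ n) (hα : 0 < α) (hσ : 0 < σ)
    (hC : ∀ j x, |φ j x| ≤ C)
    (hc₀ : 0 < c₀) (hlo : ∀ j, c₀ * eigRate d α n j ≤ lam j)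
    (hup : ∀ j, lam j ≤ C₀ * eigRate d α n j) (hk : k ≤ m) (hc₁ : 0 < c₁)
    (hk₁ : c₁ * effDim d α n ≤ k) (hkJ : (k : ℝ) ≤ effDim d α n)
    (hS : HasSum (fun j : ℕ => ((j : ℝ) + 1) ^ (2 * α / d) * coords e f₀ j ^ 2) S)
    (hG : GramBounds φ m x) (hΨ : IsVariationalPosterior φ e lam σ m x y Ψ) :
    ‖meanOf Ψ - f₀‖ ^ 2
      ≤ ((24 * (σ : ℝ) ^ 4 / c₀ ^ 2 * 4 ^ α + 2 * c₁ ^ (-(2 * α / d))) * S * effDim d α n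
        + 12 * (σ : ℝ) ^ 2 * fluctuation φ lam σ f₀ (truncation e f₀ m k) (x, y)) / n := by
  have hn0 : 0 < n := by omega
  have hn' : (0 : ℝ) < n := by exact_mod_cast hn0
  have hσ' : (0 : ℝ) < σ := by exact_mod_cast hσ
  have hpos := lam_pos_of_le hc₀ hlo
  have hJ := effDim_pos (d := d) (α := α) hn0
  set J := effDim d α n with hJdef
  have hr := summable_sqrt_of_le_eigRate hd hn hup
  rw [meanOf_eq_headSum hC hr hpos hΨ]
  set a := featureMean φ lam σ m x y with ha
  set θ := truncation e f₀ m k with hθ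
  have hT := truncation_error_le hd hn0 hα hk hc₁ hk₁ hS
  have h1 := energy_estimate (y := y) hpos hσ hG θ (fun i => residual φ f₀ θ (x i))
    (fun i => y i - f₀ (x i)) (fun i => by simp only [predict, residual]; ring)
  have h2 : ∑ j : Fin m, varBound lam σ n j * (θ j / lam j) ^ 2
      ≤ 2 * (σ : ℝ) ^ 2 / c₀ ^ 2 * 4 ^ α * J * S := by
    have h3 : ∀ j : Fin m, varBound lam σ n j * (θ j / lam j) ^ 2
        ≤ 2 * (σ : ℝ) ^ 2 / c₀ ^ 2 * 4 ^ α * J *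
          (((j : ℕ) + 1 : ℝ) ^ (2 * α / d) * coords e f₀ j ^ 2) := by
      intro j
      have hθj : θ j = if (j : ℕ) < k then coords e f₀ j else 0 := rfl
      rw [hθj]
      split_ifs with hjk
      · have hjJ : ((j : ℕ) : ℝ) + 1 ≤ J := by
          have : ((j : ℕ) : ℝ) + 1 ≤ k := by exact_mod_cast hjk
          linarith
        have h4 := inv_eigRate_sq_le hd hn0 hα hjJ
        have h5 : ((lam j : ℝ) ^ 2)⁻¹ ≤ (c₀ ^ 2)⁻¹ * ((eigRate d α n j) ^ 2)⁻¹ := by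
          rw [← mul_inv, ← mul_pow]
          have := eigRate_pos (d := d) (α := α) (n := n) j
          have := hlo j
          gcongr
        calc varBound lam σ n j * (coords e f₀ j / lam j) ^ 2
            = varBound lam σ n j * ((lam j : ℝ) ^ 2)⁻¹ * coords e f₀ j ^ 2 := by
              rw [div_pow]; ring
          _ ≤ 2 * (σ : ℝ) ^ 2 / n * ((c₀ ^ 2)⁻¹ * (4 ^ α * n * J * ((j : ℕ) + 1 : ℝ) ^ (2 * α / d)))
              * coords e f₀ j ^ 2 := by
              have := varBound_le_div hpos hσ hn0 (j : ℕ)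
              have h6 := h5.trans (mul_le_mul_of_nonneg_left h4 (by positivity))
              gcongr
          _ = _ := by field_simp
      · simp only [zero_div, ne_eq, OfNat.ofNat_ne_zero, not_false_eq_true, zero_pow, mul_zero]
        positivity
    refine (Finset.sum_le_sum fun j _ => h3 j).trans ?_
    rw [← Finset.mul_sum, Fin.sum_univ_eq_sum_range
      (fun j : ℕ => ((j : ℝ) + 1) ^ (2 * α / d) * coords e f₀ j ^ 2)]
    exact mul_le_mul_of_nonneg_left (sum_le_hasSum _ (fun j _ => by positivity) hS) (by positivity)
  have h7 : ‖headSum e a - f₀‖ ^ 2 ≤ 2 * ∑ j, (a.ofLp j - θ j) ^ 2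
      + 2 * ‖f₀ - headSum e (WithLp.toLp 2 θ)‖ ^ 2 := by
    have e1 : ∑ j, (a.ofLp j - θ j) ^ 2 = ‖headSum e a - headSum e (WithLp.toLp 2 θ)‖ ^ 2 := by
      rw [← headSum_sub, norm_headSum_sq]; rfl
    rw [e1]
    have e2 := norm_sub_le_norm_sub_add_norm_sub (headSum e a) (headSum e (WithLp.toLp 2 θ)) f₀
    rw [norm_sub_rev (headSum e (WithLp.toLp 2 θ)) f₀] at e2
    calc _ ≤ (‖headSum e a - headSum e (WithLp.toLp 2 θ)‖ + ‖f₀ - headSum e (WithLp.toLp 2 θ)‖) ^ 2 := by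
          gcongr
      _ ≤ _ := by
          nlinarith [sq_nonneg (‖headSum e a - headSum e (WithLp.toLp 2 θ)‖
            - ‖f₀ - headSum e (WithLp.toLp 2 θ)‖)]
  rw [le_div_iff₀ hn']
  have h8 : ∑ j, (a.ofLp j - θ j) ^ 2 * n ≤ 6 * (σ : ℝ) ^ 2 *
      (2 * (σ : ℝ) ^ 2 / c₀ ^ 2 * 4 ^ α * J * S + fluctuation φ lam σ f₀ θ (x, y)) := by
    have h9 : (n : ℝ) / (2 * (σ : ℝ) ^ 2) * ∑ j, (a.ofLp j - θ j) ^ 2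
        ≤ 3 * (2 * (σ : ℝ) ^ 2 / c₀ ^ 2 * 4 ^ α * J * S + fluctuation φ lam σ f₀ θ (x, y)) := by
      refine h1.trans ?_
      rw [fluctuation]
      linarith
    rw [div_mul_eq_mul_div, div_le_iff₀ (by positivity)] at h9
    rw [← Finset.sum_mul]
    linarith
  have h10 : ‖f₀ - headSum e (WithLp.toLp 2 θ)‖ ^ 2 * n ≤ c₁ ^ (-(2 * α / d)) * S * J := by
    have := mul_le_mul_of_nonneg_right hT hn'.le
    calc _ ≤ _ := this
      _ = _ := by rw [← hJdef]; field_simp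
  rw [← Finset.sum_mul] at h8
  have h11 := mul_le_mul_of_nonneg_right h7 hn'.le
  have e3 : 24 * (σ : ℝ) ^ 4 / c₀ ^ 2 * 4 ^ α * S * J
      = 12 * (σ : ℝ) ^ 2 * (2 * (σ : ℝ) ^ 2 / c₀ ^ 2 * 4 ^ α * J * S) := by ring
  nlinarith [h8, h10, h11, e3]

/-- For indices below `k ≤ J` the eigenvalues are at least `c₀/n`, so the posterior variances are at
least a constant times `1/n`, and there are `k ≳ J` of them. -/
lemma lt_radius_sq (hd : 0 < d) (hn : 2 ≤ n) (hα : 0 < α) (hσ : 0 < σ) (hγ : γ < 1)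
    (hC : ∀ j x, |φ j x| ≤ C)
    (hc₀ : 0 < c₀) (hlo : ∀ j, c₀ * eigRate d α n j ≤ lam j)
    (hup : ∀ j, lam j ≤ C₀ * eigRate d α n j) (hk : k ≤ m)
    (hk₁ : c₁ * effDim d α n ≤ k) (hkJ : (k : ℝ) ≤ effDim d α n)
    (hG : GramBounds φ m x) (hΨ : IsVariationalPosterior φ e lam σ m x y Ψ)
    (hρ : IsCredibleRadius γ Ψ ρ) (hrate : smallBallRate ^ k < 1 - γ) :
    (c₀⁻¹ + 2 / (σ : ℝ) ^ 2)⁻¹ * smallBallConst * c₁ * effDim d α n / n < ρ ^ 2 := by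
  have hn0 : 0 < n := by omega
  have hn' : (0 : ℝ) < n := by exact_mod_cast hn0
  have hσ' : (0 : ℝ) < σ := by exact_mod_cast hσ
  have hpos := lam_pos_of_le hc₀ hlo
  have hr := summable_sqrt_of_le_eigRate hd hn hup
  have hb := smallBallConst_pos
  have h := lt_radius_sq_of_head (s := (c₀⁻¹ * n + 2 * n / (σ : ℝ) ^ 2)⁻¹) hγ hC hr hpos hσ hΨ hρ hG
    hk (by positivity) (fun j hj => ?_) hrate
  · refine lt_of_le_of_lt ?_ h
    calc (c₀⁻¹ + 2 / (σ : ℝ) ^ 2)⁻¹ * smallBallConst * c₁ * effDim d α n / n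
        = (c₀⁻¹ * n + 2 * n / (σ : ℝ) ^ 2)⁻¹ * smallBallConst * (c₁ * effDim d α n) := by
          field_simp
      _ ≤ _ := by gcongr
  · have hjJ : (j : ℝ) + 1 ≤ effDim d α n := by
      have : (j : ℝ) + 1 ≤ k := by exact_mod_cast hj
      linarith
    have h1 := inv_le_eigRate hd hn0 hα hjJ
    have h2 : (lam j : ℝ)⁻¹ ≤ c₀⁻¹ * n := by
      calc (lam j : ℝ)⁻¹ ≤ (c₀ * (n : ℝ)⁻¹)⁻¹ := by
            have := (mul_le_mul_of_nonneg_left h1 hc₀.le).trans (hlo j)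
            gcongr
        _ = _ := by rw [mul_inv, inv_inv]
    have : (0 : ℝ) < lam j := by exact_mod_cast hpos j
    gcongr

lemma measure_gramDefect_le (hφ : IsBoundedEigenbasis φ e) (hC : ∀ j x, |φ j x| ≤ C) (hn : 0 < n)
    (f₀ : L2 μ) (m : ℕ) :
    dataLaw μ σ f₀ n {p | (n : ℝ) ^ 2 / 4 < gramDefect φ m p.1}
      ≤ ENNReal.ofReal (4 * C ^ 4 * (m ^ 2 / n)) := by
  have hn' : (0 : ℝ) < n := by exact_mod_cast hn
  have h3 := hφ.measurable
  have hm : Measurable fun p : (Fin n → 𝓧) × (Fin n → ℝ) => gramDefect φ m p.1 := by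
    unfold gramDefect; fun_prop
  refine (measure_lt_le_of_lintegral_le hm (by positivity)
    (lintegral_gramDefect_le hφ hC f₀ m)).trans (ENNReal.ofReal_le_ofReal (le_of_eq ?_))
  field_simp

end Bounds

/-! ### Limits in the sample size. -/

section Asymptotics

variable {d : ℕ} {α r : ℝ} {m : ℕ → ℕ}

lemma tendsto_sq_div_zero (hr : r < 1 / 2) {C : ℝ}
    (hm : ∀ n : ℕ, 2 ≤ n → (m n : ℝ) ≤ C * (n : ℝ) ^ r) :
    Tendsto (fun n : ℕ => (m n : ℝ) ^ 2 / n) atTop (𝓝 0) := by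
  have h1 : Tendsto (fun n : ℕ => C ^ 2 * (n : ℝ) ^ (-(1 - 2 * r))) atTop (𝓝 0) := by
    have := ((tendsto_rpow_neg_atTop (by linarith : 0 < 1 - 2 * r)).comp
      tendsto_natCast_atTop_atTop).const_mul (C ^ 2)
    simpa using this
  refine squeeze_zero' (Eventually.of_forall fun n => by positivity) ?_ h1
  filter_upwards [eventually_ge_atTop 2] with n hn
  have hn' : (0 : ℝ) < n := by exact_mod_cast (by omega : 0 < n)
  calc (m n : ℝ) ^ 2 / n ≤ (C * (n : ℝ) ^ r) ^ 2 / n := by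
        gcongr; exact hm n hn
    _ = C ^ 2 * ((n : ℝ) ^ (2 * r) / n) := by
        rw [mul_pow, ← Real.rpow_natCast (_ ^ r), ← Real.rpow_mul hn'.le]
        push_cast; ring_nf
    _ = _ := by
        rw [← Real.rpow_sub_one hn'.ne']; ring_nf

lemma tendsto_atTop_of_rpow_le (hr : 0 < r) {c : ℝ} (hc : 0 < c)
    (hm : ∀ n : ℕ, 2 ≤ n → c * (n : ℝ) ^ r ≤ m n) :
    Tendsto (fun n => (m n : ℝ)) atTop atTop := by
  refine tendsto_atTop_mono' atTop ?_
    (((tendsto_rpow_atTop hr).comp tendsto_natCast_atTop_atTop).const_mul_atTop hc)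
  filter_upwards [eventually_ge_atTop 2] with n hn using hm n hn

lemma tendsto_effDim (hd : 0 < d) (hα : 0 < α) : Tendsto (effDim d α) atTop atTop :=
  (tendsto_rpow_atTop (by positivity)).comp tendsto_natCast_atTop_atTop

lemma eventually_smallBallRate_pow_lt {k : ℕ → ℕ} (hk : Tendsto (fun n => (k n : ℝ)) atTop atTop)
    {t : ℝ} (ht : 0 < t) : ∀ᶠ n in atTop, smallBallRate ^ k n < t :=
  ((tendsto_pow_atTop_nhds_zero_of_lt_one smallBallRate_nonneg smallBallRate_lt_one).comp
    (tendsto_natCast_atTop_iff.1 hk)).eventually_lt_const ht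

/-- The exponent `r/d - 1/(d+2α)` is negative, so the power beats `log n`. It follows that
eigenvalues with index of order `n^r` do not decay. -/
lemma tendsto_rescaling_mul (hd : 0 < d) (hr : r < (d : ℝ) / (d + 2 * α)) {C : ℝ}
    (hC : 0 ≤ C) : Tendsto (fun n : ℕ => rescaling d α n * (C * (n : ℝ) ^ r) ^ (1 / (d : ℝ)))
      atTop (𝓝 0) := by
  have hd' : (0 : ℝ) < d := by exact_mod_cast hd
  have hs : 0 < 1 / ((d : ℝ) + 2 * α) - r / d := by
    rw [sub_pos, div_lt_iff₀ hd', div_mul_eq_mul_div, one_mul]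
    exact hr
  have h1 : Tendsto (fun x : ℝ => Real.log x / x ^ (1 / ((d : ℝ) + 2 * α) - r / d)) atTop (𝓝 0) :=
    (isLittleO_log_rpow_atTop hs).tendsto_div_nhds_zero
  have h2 := (h1.comp tendsto_natCast_atTop_atTop).const_mul (C ^ (1 / (d : ℝ)))
  rw [mul_zero] at h2
  refine h2.congr' ?_
  filter_upwards [eventually_ge_atTop 1] with n hn
  have hn' : (0 : ℝ) < n := by exact_mod_cast hn
  rw [Function.comp_apply, rescaling, Real.mul_rpow hC (by positivity), ← Real.rpow_mul hn'.le,
    Real.rpow_sub hn', Real.rpow_neg hn'.le, mul_one_div]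
  field_simp

end Asymptotics

lemma sobolev_anti {𝓧 : Type*} [MeasurableSpace 𝓧] {μ : Measure 𝓧} (e : HilbertBasis ℕ ℝ (L2 μ)) (d : ℕ) {α β : ℝ} (h : α ≤ β) :
    sobolev e d β ⊆ sobolev e d α := by
  intro f hf
  refine Summable.of_nonneg_of_le (fun j => by positivity) (fun j => ?_) hf
  refine mul_le_mul_of_nonneg_right (Real.rpow_le_rpow_of_exponent_le ?_ (by gcongr)) (sq_nonneg _)
  linarith [Nat.cast_nonneg (α := ℝ) j]

/-! ### Coverage for smooth truths and for few features. -/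

section Coverage

variable {𝓧 : Type*} [MeasurableSpace 𝓧] [MeasurableSpace.CountablyGenerated 𝓧] {μ : Measure 𝓧}
  [IsProbabilityMeasure μ] {φ : ℕ → 𝓧 → ℝ} {e : HilbertBasis ℕ ℝ (L2 μ)} {lam : ℕ → ℕ → ℝ≥0}
  {σ : ℝ≥0} {d : ℕ} {m : ℕ → ℕ} {α γ r c₀ C₀ c₁ C₁ : ℝ}
  {Ψ : ∀ n : ℕ, (Fin n → 𝓧) → (Fin n → ℝ) → Measure (L2 μ)}
  {ρ : ∀ n : ℕ, (Fin n → 𝓧) → (Fin n → ℝ) → ℝ}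

/-- On the Gram event, failure of coverage forces `fluctuation` above a multiple of `J (M² κ - A₁)`,
while its mean is at most `A₂ J`. Markov's inequality bounds the probability by the order of `1/M²`.
-/
theorem tendsto_coverage_of_smooth (hd : 0 < d) (hσ : 0 < σ) (hγ : γ < 1)
    (hφ : IsBoundedEigenbasis φ e) (hα : 0 < α) (hc₀ : 0 < c₀) (hC₀ : 0 < C₀)
    (hlo : ∀ n, 2 ≤ n → ∀ j, c₀ * eigRate d α n j ≤ lam n j)
    (hup : ∀ n, 2 ≤ n → ∀ j, lam n j ≤ C₀ * eigRate d α n j)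
    (hr : r < 1 / 2) (hrα : (d : ℝ) / (d + 2 * α) ≤ r) (hc₁ : 0 < c₁)
    (hmlo : ∀ n : ℕ, 2 ≤ n → c₁ * (n : ℝ) ^ r ≤ m n)
    (hmup : ∀ n : ℕ, 2 ≤ n → (m n : ℝ) ≤ C₁ * (n : ℝ) ^ r)
    (hΨ : ∀ n : ℕ, 2 ≤ n → ∀ x y, IsVariationalPosterior φ e (lam n) σ (m n) x y (Ψ n x y))
    (hρ : ∀ n : ℕ, 2 ≤ n → ∀ x y, IsCredibleRadius γ (Ψ n x y) (ρ n x y))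
    {f₀ : L2 μ} (hf₀ : f₀ ∈ sobolev e d α) {M : ℕ → ℝ} (hM : Tendsto M atTop atTop) :
    Tendsto (fun n => dataLaw μ σ f₀ n {p | ‖meanOf (Ψ n p.1 p.2) - f₀‖ ≤ M n * ρ n p.1 p.2})
      atTop (𝓝 1) := by
  obtain ⟨C, hC⟩ := hφ.bounded
  obtain ⟨S, hS⟩ : ∃ S, HasSum (fun j : ℕ => ((j : ℝ) + 1) ^ (2 * α / d) * coords e f₀ j ^ 2) S :=
    hf₀
  have hσ' : (0 : ℝ) < σ := by exact_mod_cast hσ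
  have hS0 : 0 ≤ S := hS.nonneg fun j => by positivity
  have hdec := decayConst_pos d
  -- For `k = min m ⌊J⌋` one has `k ≥ c J`: the constant `c₁` serves `m`, and `1/2` serves the
  -- floor, since `J ≥ 1`.
  set c := min c₁ (1 / 2) with hc
  have hc0 : 0 < c := by positivity
  set k : ℕ → ℕ := fun n => min (m n) ⌊effDim d α n⌋₊ with hk
  have hkJ : ∀ n, 2 ≤ n → (k n : ℝ) ≤ effDim d α n := fun n hn => by
    have h1 : ((k n : ℕ) : ℝ) ≤ ⌊effDim d α n⌋₊ := by exact_mod_cast min_le_right _ _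
    exact h1.trans (Nat.floor_le (effDim_pos (by omega)).le)
  have hk₁ : ∀ n, 2 ≤ n → c * effDim d α n ≤ k n := by
    intro n hn
    have hJ1 := one_le_effDim (d := d) hα (by omega : 0 < n)
    simp only [hk]
    rw [Nat.cast_min, le_min_iff]
    constructor
    · calc c * effDim d α n ≤ c₁ * (n : ℝ) ^ r := by
            gcongr
            · exact min_le_left _ _
            · exact Real.rpow_le_rpow_of_exponent_le (by exact_mod_cast (by omega : 1 ≤ n)) hrα
        _ ≤ _ := hmlo n hn
    · have h1 := Nat.lt_floor_add_one (effDim d α n)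
      have h2 : (1 : ℝ) ≤ ⌊effDim d α n⌋₊ := by
        exact_mod_cast Nat.le_floor (by simpa using hJ1)
      have h3 : c * effDim d α n ≤ 1 / 2 * effDim d α n :=
        mul_le_mul_of_nonneg_right (min_le_right _ _) (by linarith)
      linarith
  have hktop : Tendsto (fun n => (k n : ℝ)) atTop atTop := by
    refine tendsto_atTop_mono' atTop ?_ ((tendsto_effDim hd hα).const_mul_atTop hc0)
    filter_upwards [eventually_ge_atTop 2] with n hn using hk₁ n hn
  set κ := (c₀⁻¹ + 2 / (σ : ℝ) ^ 2)⁻¹ * smallBallConst * c with hκ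
  have hκ0 : 0 < κ := by
    have := smallBallConst_pos
    positivity
  set A₁ := (24 * (σ : ℝ) ^ 4 / c₀ ^ 2 * 4 ^ α + 2 * c ^ (-(2 * α / d))) * S with hA₁
  set A₂ := (c ^ (-(2 * α / d)) * S + C ^ 2 * (C₀ + 2 * (σ : ℝ) ^ 2) * decayConst d)
    / (σ : ℝ) ^ 2 with hA₂
  have hM2 : Tendsto (fun n => M n ^ 2 * κ - A₁) atTop atTop :=
    tendsto_atTop_add_const_right _ _ (((tendsto_pow_atTop two_ne_zero).comp hM).atTop_mul_const hκ0)
  refine tendsto_measure_one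
    (δ := fun n => 4 * C ^ 4 * ((m n : ℝ) ^ 2 / n) + 12 * (σ : ℝ) ^ 2 * A₂ / (M n ^ 2 * κ - A₁)) ?_ ?_
  · filter_upwards [eventually_ge_atTop 2, hM.eventually_gt_atTop 0, hM2.eventually_gt_atTop 0,
      eventually_smallBallRate_pow_lt hktop (sub_pos.2 hγ)] with n hn hMn hMn2 hrate
    have hn0 : 0 < n := by omega
    have hn' : (0 : ℝ) < n := by exact_mod_cast hn0
    have hJ := effDim_pos (d := d) (α := α) hn0
    have hkm : k n ≤ m n := min_le_left _ _
    set F := fluctuation (n := n) φ (lam n) σ f₀ (truncation e f₀ (m n) (k n)) with hF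
    set t := effDim d α n * (M n ^ 2 * κ - A₁) / (12 * (σ : ℝ) ^ 2) with ht
    have hsub : {p | ‖meanOf (Ψ n p.1 p.2) - f₀‖ ≤ M n * ρ n p.1 p.2}ᶜ
        ⊆ {p | (n : ℝ) ^ 2 / 4 < gramDefect φ (m n) p.1} ∪ {p | t < F p} := by
      rintro ⟨x, y⟩ hp
      by_contra hnot
      simp only [Set.mem_compl_iff, Set.mem_union, Set.mem_ofPred_eq, not_le, not_or, not_lt]
        at hp hnot
      have hG := gramBounds_of_gramDefect_le hnot.1
      have h1 := norm_meanOf_sub_sq_le hd hn hα hσ hC hc₀ (hlo n hn) (hup n hn) hkm hc0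
        (hk₁ n hn) (hkJ n hn) hS hG (hΨ n hn x y)
      have h2 := lt_radius_sq hd hn hα hσ hγ hC hc₀ (hlo n hn) (hup n hn) hkm
        (hk₁ n hn) (hkJ n hn) hG (hΨ n hn x y) (hρ n hn x y) hrate
      have h3 := radius_nonneg hγ hC (summable_sqrt_of_le_eigRate hd hn (hup n hn))
        (lam_pos_of_le hc₀ (hlo n hn)) (hΨ n hn x y) (hρ n hn x y)
      have h4 : (M n * ρ n x y) ^ 2 < ‖meanOf (Ψ n x y) - f₀‖ ^ 2 :=
        pow_lt_pow_left₀ hp (by positivity) two_ne_zero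
      have h5 : M n ^ 2 * (κ * effDim d α n / n) ≤ M n ^ 2 * ρ n x y ^ 2 :=
        mul_le_mul_of_nonneg_left h2.le (sq_nonneg _)
      rw [mul_pow] at h4
      have h6 := (h5.trans_lt h4).trans_le h1
      rw [← mul_div_assoc, div_lt_div_iff_of_pos_right hn'] at h6
      have h7 := hnot.2
      rw [ht, le_div_iff₀ (by positivity)] at h7
      nlinarith [h6, h7]
    refine (measure_mono hsub).trans ((measure_union_le _ _).trans ?_)
    have ht0 : 0 < t := by positivity
    have hA₂0 : 0 ≤ A₂ := by positivity
    rw [ENNReal.ofReal_add (by positivity) (by positivity)]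
    refine add_le_add (measure_gramDefect_le hφ hC hn0 f₀ (m n)) ?_
    refine (measure_lt_le_of_lintegral_le (measurable_fluctuation hφ f₀ _) ht0
      (lintegral_fluctuation_le hd hn hα hσ hφ hC hc₀ (hlo n hn) hC₀.le (hup n hn) hkm hc0
        (hk₁ n hn) hS)).trans (ENNReal.ofReal_le_ofReal (le_of_eq ?_))
    rw [ht, ← hA₂]
    field_simp
  · have h1 := (tendsto_sq_div_zero hr hmup).const_mul (4 * C ^ 4)
    have h2 := (tendsto_const_nhds (x := 12 * (σ : ℝ) ^ 2 * A₂)).div_atTop hM2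
    simpa using h1.add h2

/-- Since `τ_n (2m)^(1/d) → 0`, the coordinates `m ≤ j < 2m` eventually have prior variance at least
`c₀/e`, so `ρ² > κ m → ∞`. The squared norm of the mean is at most `6 ∑ y_i²/n`, which is bounded in
probability. -/
theorem tendsto_coverage_of_few_features (hd : 0 < d) (hσ : 0 < σ) (hγ : γ < 1)
    (hφ : IsBoundedEigenbasis φ e) (hc₀ : 0 < c₀)
    (hlo : ∀ n, 2 ≤ n → ∀ j, c₀ * eigRate d α n j ≤ lam n j)
    (hup : ∀ n, 2 ≤ n → ∀ j, lam n j ≤ C₀ * eigRate d α n j)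
    (hr0 : 0 < r) (hr : r < 1 / 2) (hrα : r < (d : ℝ) / (d + 2 * α)) (hc₁ : 0 < c₁) (hC₁ : 0 < C₁)
    (hmlo : ∀ n : ℕ, 2 ≤ n → c₁ * (n : ℝ) ^ r ≤ m n)
    (hmup : ∀ n : ℕ, 2 ≤ n → (m n : ℝ) ≤ C₁ * (n : ℝ) ^ r)
    (hΨ : ∀ n : ℕ, 2 ≤ n → ∀ x y, IsVariationalPosterior φ e (lam n) σ (m n) x y (Ψ n x y))
    (hρ : ∀ n : ℕ, 2 ≤ n → ∀ x y, IsCredibleRadius γ (Ψ n x y) (ρ n x y)) (f₀ : L2 μ) :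
    Tendsto (fun n => dataLaw μ σ f₀ n {p | ‖meanOf (Ψ n p.1 p.2) - f₀‖ ≤ ρ n p.1 p.2})
      atTop (𝓝 1) := by
  obtain ⟨C, hC⟩ := hφ.bounded
  have hmtop := tendsto_atTop_of_rpow_le hr0 hc₁ hmlo
  set κ := c₀ * Real.exp (-1) * smallBallConst with hκ
  have hκ0 : 0 < κ := by
    have := smallBallConst_pos
    positivity
  set N := ‖f₀‖ ^ 2 with hN
  have hm2 : Tendsto (fun n => κ * m n - 2 * N) atTop atTop :=
    tendsto_atTop_add_const_right _ _ (hmtop.const_mul_atTop hκ0)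
  refine tendsto_measure_one (δ := fun n => 4 * C ^ 4 * ((m n : ℝ) ^ 2 / n)
    + 12 * (2 * N + 2 * (σ : ℝ) ^ 2) / (κ * m n - 2 * N)) ?_ ?_
  · filter_upwards [eventually_ge_atTop 2, hm2.eventually_gt_atTop 0,
      eventually_smallBallRate_pow_lt hmtop (sub_pos.2 hγ),
      (tendsto_rescaling_mul (C := 2 * C₁) hd hrα (by positivity)).eventually_le_const one_pos]
      with n hn hmn hrate hres
    have hn0 : 0 < n := by omega
    have hn' : (0 : ℝ) < n := by exact_mod_cast hn0
    have hrs := summable_sqrt_of_le_eigRate hd hn (hup n hn)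
    have hpos := lam_pos_of_le hc₀ (hlo n hn)
    set t := n * (κ * m n - 2 * N) / 12 with ht
    have hle : ∀ j, m n ≤ j → j < m n + m n → c₀ * Real.exp (-1) ≤ lam n j := by
      intro j _ hj
      refine le_trans ?_ (hlo n hn j)
      rw [eigRate]
      gcongr
      rw [neg_mul, neg_le_neg_iff]
      refine le_trans (mul_le_mul_of_nonneg_left ?_ (rescaling_pos hn).le) hres
      have : (j : ℝ) + 1 ≤ m n + m n := by exact_mod_cast hj
      have := hmup n hn
      gcongr
      linarith
    have hsub : {p : (Fin n → 𝓧) × (Fin n → ℝ) | ‖meanOf (Ψ n p.1 p.2) - f₀‖ ≤ ρ n p.1 p.2}ᶜ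
        ⊆ {p | (n : ℝ) ^ 2 / 4 < gramDefect φ (m n) p.1} ∪ {p | t < ∑ i, p.2 i ^ 2} := by
      rintro ⟨x, y⟩ hp
      by_contra hnot
      simp only [Set.mem_compl_iff, Set.mem_union, Set.mem_ofPred_eq, not_le, not_or, not_lt]
        at hp hnot
      have hG := gramBounds_of_gramDefect_le hnot.1
      have h1 := lt_radius_sq_of_tail hγ hC hrs hpos (hΨ n hn x y) (hρ n hn x y)
        (by positivity) hle hrate
      have h2 := radius_nonneg hγ hC hrs hpos (hΨ n hn x y) (hρ n hn x y)
      have h3 : ρ n x y ^ 2 < ‖meanOf (Ψ n x y) - f₀‖ ^ 2 := pow_lt_pow_left₀ hp h2 two_ne_zero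
      have h4 : ‖meanOf (Ψ n x y)‖ ^ 2 ≤ 6 * (∑ i, y i ^ 2) / n := by
        rw [meanOf_eq_headSum hC hrs hpos (hΨ n hn x y), norm_headSum_sq]
        exact sum_featureMean_sq_le hpos hσ hn0 hG
      have h5 : ‖meanOf (Ψ n x y) - f₀‖ ^ 2 ≤ 2 * ‖meanOf (Ψ n x y)‖ ^ 2 + 2 * N := by
        calc _ ≤ (‖meanOf (Ψ n x y)‖ + ‖f₀‖) ^ 2 := by
              gcongr; exact norm_sub_le _ _
          _ ≤ _ := by nlinarith [sq_nonneg (‖meanOf (Ψ n x y)‖ - ‖f₀‖)]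
      have h6 : κ * m n - 2 * N < 2 * (6 * (∑ i, y i ^ 2) / n) := by linarith
      have h7 := hnot.2
      rw [ht, le_div_iff₀ (by norm_num)] at h7
      rw [← mul_div_assoc, lt_div_iff₀ hn'] at h6
      linarith
    refine (measure_mono hsub).trans ((measure_union_le _ _).trans ?_)
    have ht0 : 0 < t := by positivity
    rw [ENNReal.ofReal_add (by positivity) (by positivity)]
    refine add_le_add (measure_gramDefect_le hφ hC hn0 f₀ (m n)) ?_
    refine (measure_lt_le_of_lintegral_le (by fun_prop) ht0 (lintegral_sum_sq_le f₀)).trans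
      (ENNReal.ofReal_le_ofReal (le_of_eq ?_))
    rw [ht, ← hN]
    field_simp
  · have h1 := (tendsto_sq_div_zero hr hmup).const_mul (4 * C ^ 4)
    have h2 := (tendsto_const_nhds (x := 12 * (2 * N + 2 * (σ : ℝ) ^ 2))).div_atTop hm2
    simpa using h1.add h2

end Coverage

/-! ### Truths rougher than the prior. -/

lemma exists_coords_eq_rpow {𝓧 : Type*} [MeasurableSpace 𝓧] {μ : Measure 𝓧}
    (e : HilbertBasis ℕ ℝ (L2 μ)) {s : ℝ} (hs : 0 < s) :
    ∃ f : L2 μ, ∀ j, coords e f j ^ 2 = ((j : ℝ) + 1) ^ (-(1 + 2 * s)) := by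
  set a : ℕ → ℝ := fun j => ((j : ℝ) + 1) ^ (-(1 / 2 + s)) with ha
  have ha2 : ∀ j, a j ^ 2 = ((j : ℝ) + 1) ^ (-(1 + 2 * s)) := fun j => by
    rw [ha, ← Real.rpow_natCast, ← Real.rpow_mul (by positivity)]
    congr 1; push_cast; ring
  have hsum : Summable fun j => a j ^ 2 := by
    simp_rw [ha2]
    have := (summable_nat_add_iff 1).2
      (Real.summable_nat_rpow.2 (by linarith : -(1 + 2 * s) < -1))
    simpa using this
  have hmem : Memℓp a 2 := by
    refine memℓp_gen ?_
    simpa using hsum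
  refine ⟨e.repr.symm ⟨a, hmem⟩, fun j => ?_⟩
  rw [← ha2, coords, ← e.repr_apply_apply, LinearIsometryEquiv.apply_symm_apply]

lemma mem_sobolev_of_coords_eq_rpow {𝓧 : Type*} [MeasurableSpace 𝓧] {μ : Measure 𝓧}
    {e : HilbertBasis ℕ ℝ (L2 μ)} {d : ℕ} (hd : 0 < d) {s β : ℝ} (hβ : β < s) {f : L2 μ}
    (hf : ∀ j, coords e f j ^ 2 = ((j : ℝ) + 1) ^ (-(1 + 2 * (s / d)))) : f ∈ sobolev e d β := by
  have hd' : (0 : ℝ) < d := by exact_mod_cast hd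
  have h1 : Summable fun j : ℕ => ((j : ℝ) + 1) ^ (2 * β / d - (1 + 2 * (s / d))) := by
    have h2 : 2 * β / d - (1 + 2 * (s / d)) < -1 := by
      have : β / d < s / d := by gcongr
      have e : 2 * β / d = 2 * (β / d) := by ring
      linarith
    have := (summable_nat_add_iff 1).2 (Real.summable_nat_rpow.2 h2)
    simpa using this
  refine h1.congr fun j => ?_
  have := hf j
  rw [coords] at this
  rw [this, sub_eq_add_neg, Real.rpow_add (by positivity)]

section Oversmoothing

variable {𝓧 : Type*} [MeasurableSpace 𝓧] [MeasurableSpace.CountablyGenerated 𝓧] {μ : Measure 𝓧}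
  [IsProbabilityMeasure μ] {φ : ℕ → 𝓧 → ℝ} {e : HilbertBasis ℕ ℝ (L2 μ)} {σ : ℝ≥0} {d : ℕ}
  {α γ r c₀ C₀ C₁ : ℝ}

/-- Since `m ≥ J`, the eigenvalues of the tail are of order at most `1/n`; the majorant of `min
(eigRate) (1/n)` therefore covers head and tail alike. -/
lemma radius_sq_le_effDim {lam : ℕ → ℝ≥0} {m n : ℕ} {x : Fin n → 𝓧} {y : Fin n → ℝ}
    {Ψ : Measure (L2 μ)} {ρ C : ℝ} (hd : 0 < d) (hn : 2 ≤ n) (hα : 0 < α) (hσ : 0 < σ)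
    (hγ0 : 0 < γ) (hγ : γ < 1) (hC : ∀ j x, |φ j x| ≤ C) (hC₀ : 0 ≤ C₀) (hpos : ∀ j, 0 < lam j)
    (hup : ∀ j, lam j ≤ C₀ * eigRate d α n j) (hm : effDim d α n ≤ m)
    (hG : GramBounds φ m x) (hΨ : IsVariationalPosterior φ e lam σ m x y Ψ)
    (hρ : IsCredibleRadius γ Ψ ρ) :
    ρ ^ 2 ≤ (C₀ + 2 * (σ : ℝ) ^ 2) * decayConst d * (effDim d α n / n) / γ := by
  have hn0 : 0 < n := by omega
  have hn' : (1 : ℝ) ≤ n := by exact_mod_cast hn0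
  have hJ := effDim_pos (d := d) (α := α) hn0
  have hdec := decayConst_pos d
  refine radius_sq_le hγ0 hγ hC (summable_sqrt_of_le_eigRate hd hn hup) hpos hΨ hρ hG
    (by positivity) (fun j _ => varBound_le_majorant hd hn hα hσ hpos hC₀ hup j)
    (fun j hj => ?_) fun N => ?_
  · have h1 : eigRate d α n j ≤ (n : ℝ)⁻¹ := by
      have h2 : 1 ≤ relIndex d α n j := by
        rw [le_relIndex_iff hd hn0 hα zero_le_one, one_pow, one_mul]
        have : (m : ℝ) ≤ j := by exact_mod_cast hj
        linarith
      rw [eigRate_eq hn0, ← Real.rpow_neg_one]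
      exact Real.rpow_le_rpow_of_exponent_le hn' (by linarith)
    have h3 := min_eigRate_le hd hn hα j
    rw [min_eq_left h1] at h3
    have h4 := eigRate_pos (d := d) (α := α) (n := n) j
    refine (hup j).trans (mul_le_mul ?_ h3 h4.le (by positivity))
    have : (0 : ℝ) ≤ (σ : ℝ) ^ 2 := by positivity
    linarith
  · rw [← Finset.mul_sum, ← Finset.mul_sum]
    calc _ ≤ (C₀ + 2 * (σ : ℝ) ^ 2) * (decayConst d / n * effDim d α n) := by
          have := sum_majorant_le hJ N
          gcongr
      _ = _ := by ring

/-- The coefficients of `f₀` of index about `K` are not recovered. -/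
lemma lt_norm_meanOf_sub_sq {lam : ℕ → ℝ≥0} {m n K : ℕ} {x : Fin n → 𝓧} {y : Fin n → ℝ}
    {Ψ : Measure (L2 μ)} {C s : ℝ} {f₀ : L2 μ} (hd : 0 < d) (hn : 2 ≤ n) (hα : 0 < α) (hs : 0 < s)
    (hC : ∀ j x, |φ j x| ≤ C) (hpos : ∀ j, 0 < lam j)
    (hup : ∀ j, lam j ≤ C₀ * eigRate d α n j) (hΨ : IsVariationalPosterior φ e lam σ m x y Ψ)
    (hK : 4 ^ d * effDim d α n ≤ K) (hy : ∑ i, y i ^ 2 ≤ (n : ℝ) ^ 2)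
    (hf : ∀ j, coords e f₀ j ^ 2 = ((j : ℝ) + 1) ^ (-(1 + 2 * s))) :
    K * ((2 * K : ℝ) ^ (-(1 + 2 * s)) / 2 - (C₀ / (σ : ℝ) ^ 2) ^ 2 * C ^ 2 * ((n : ℝ) ^ 5)⁻¹)
      ≤ ‖meanOf Ψ - f₀‖ ^ 2 := by
  have hn0 : 0 < n := by omega
  have hn' : (1 : ℝ) ≤ n := by exact_mod_cast hn0
  have hr := summable_sqrt_of_le_eigRate hd hn hup
  rw [meanOf_eq_headSum hC hr hpos hΨ]
  set a := featureMean φ lam σ m x y with ha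
  have hco : ∀ j ∈ Finset.Ico K (K + K), (2 * K : ℝ) ^ (-(1 + 2 * s)) / 2
      - (C₀ / (σ : ℝ) ^ 2) ^ 2 * C ^ 2 * ((n : ℝ) ^ 5)⁻¹ ≤ coords e (headSum e a - f₀) j ^ 2 := by
    intro j hj
    rw [Finset.mem_Ico] at hj
    have h1 : (2 * K : ℝ) ^ (-(1 + 2 * s)) ≤ coords e f₀ j ^ 2 := by
      rw [hf]
      refine Real.rpow_le_rpow_of_nonpos (by positivity) ?_ (by linarith)
      have : (j : ℝ) + 1 ≤ K + K := by exact_mod_cast hj.2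
      linarith
    have h2 : coords e (headSum e a) j ^ 2
        ≤ (C₀ / (σ : ℝ) ^ 2) ^ 2 * C ^ 2 * ((n : ℝ) ^ 5)⁻¹ := by
      rw [coords_headSum]
      split_ifs with hjm
      -- An index of at least `4^d J` means `relIndex ≥ 4`. In `featureMean_sq_le` the factors `λ_j²
      -- ≲ n⁻⁸`, `n` and `∑ y_i² ≤ n²` then combine to `n⁻⁵`.
      · have h3 : eigRate d α n j ≤ ((n : ℝ) ^ 4)⁻¹ := by
          have h4 : 4 ≤ relIndex d α n j := by
            rw [le_relIndex_iff hd hn0 hα (by norm_num)]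
            have : (K : ℝ) ≤ j := by exact_mod_cast hj.1
            linarith
          rw [eigRate_eq hn0, ← Real.rpow_natCast, ← Real.rpow_neg (by positivity)]
          exact Real.rpow_le_rpow_of_exponent_le hn' (by push_cast; linarith)
        have hC₀ : 0 ≤ C₀ := by
          have h5 := eigRate_pos (d := d) (α := α) (n := n) j
          have h6 := (NNReal.coe_nonneg (lam j)).trans (hup j)
          exact nonneg_of_mul_nonneg_left h6 h5
        have h5 : (lam j : ℝ) ≤ C₀ * ((n : ℝ) ^ 4)⁻¹ :=
          (hup j).trans (mul_le_mul_of_nonneg_left h3 hC₀)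
        refine (featureMean_sq_le (y := y) (σ := σ) hC hpos ⟨j, hjm⟩).trans ?_
        calc ((lam j : ℝ) / (σ : ℝ) ^ 2) ^ 2 * (n * C ^ 2 * ∑ i, y i ^ 2)
            ≤ (C₀ * ((n : ℝ) ^ 4)⁻¹ / (σ : ℝ) ^ 2) ^ 2 * (n * C ^ 2 * (n : ℝ) ^ 2) := by gcongr
          _ = _ := by field_simp
      · rw [zero_pow two_ne_zero]; positivity
    have h3 : coords e (headSum e a - f₀) j = coords e (headSum e a) j - coords e f₀ j := by
      simp only [coords, inner_sub_right]
    rw [h3]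
    -- This is `(u - v)² ≥ v²/2 - u²`, the difference being `(2u - v)²/2`.
    nlinarith [sq_nonneg (2 * coords e (headSum e a) j - coords e f₀ j)]
  calc _ = ∑ j ∈ Finset.Ico K (K + K), ((2 * K : ℝ) ^ (-(1 + 2 * s)) / 2
        - (C₀ / (σ : ℝ) ^ 2) ^ 2 * C ^ 2 * ((n : ℝ) ^ 5)⁻¹) := by
        rw [Finset.sum_const, Nat.card_Ico, add_tsub_cancel_left, nsmul_eq_mul]
    _ ≤ ∑ j ∈ Finset.Ico K (K + K), coords e (headSum e a - f₀) j ^ 2 := Finset.sum_le_sum hco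
    _ ≤ _ := sum_le_hasSum _ (fun j _ => sq_nonneg _) (hasSum_coords_sq e _)

/-- The main term is of order `K^(-2s/d) ≍ J^(-2s/d)`, which outgrows `J/n = J^(-2α/d)` because `s <
α`. For the same reason `J^(-1-2s/d) ≥ 1/n`, so the term with `n⁻⁵` is absorbed. -/
lemma eventually_radius_lt_bias (hd : 0 < d) (hα : 0 < α) {s : ℝ} (hs : 0 < s) (hsα : s < α)
    (A D : ℝ) : ∀ᶠ n : ℕ in atTop, A * (effDim d α n / n)
      < ⌈4 ^ d * effDim d α n⌉₊ * ((2 * ⌈4 ^ d * effDim d α n⌉₊ : ℝ) ^ (-(1 + 2 * (s / d))) / 2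
        - D * ((n : ℝ) ^ 5)⁻¹) := by
  have hd' : (0 : ℝ) < d := by exact_mod_cast hd
  -- From `K ≤ 4^d J + 1` and `4^d J ≥ 1` follows `2K ≤ 4 · 4^d J`.
  set c : ℝ := 4 * 4 ^ d with hc
  have hc0 : 0 < c := by positivity
  set q : ℝ := 1 + 2 * (s / d) with hq
  have hq0 : 0 < q := by positivity
  have hJtop := tendsto_effDim hd hα
  have hexp : 0 < 2 * α / d - 2 * (s / d) := by
    have : s / d < α / d := by gcongr
    have e : 2 * α / d = 2 * (α / d) := by ring
    linarith
  have h1 := ((tendsto_rpow_atTop hexp).comp hJtop).eventually_gt_atTop (4 * c ^ q * A)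
  filter_upwards [eventually_ge_atTop 2, h1,
    tendsto_natCast_atTop_atTop.eventually_ge_atTop (4 * c ^ q * D)] with n hn h1 h2
  have hn0 : 0 < n := by omega
  have hn' : (1 : ℝ) ≤ n := by exact_mod_cast hn0
  have hJ1 := one_le_effDim (d := d) hα hn0
  have hJn := effDim_rpow_neg (n := n) hd hn0 hα
  set J := effDim d α n with hJ
  have hJ0 : 0 < J := by linarith
  set K := ⌈4 ^ d * J⌉₊ with hK
  have h4d : (1 : ℝ) ≤ 4 ^ d := one_le_pow₀ (by norm_num)
  have hKlo : J ≤ K := (le_mul_of_one_le_left hJ0.le h4d).trans (Nat.le_ceil _)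
  have hKup : 2 * (K : ℝ) ≤ c * J := by
    have := Nat.ceil_lt_add_one (by positivity : 0 ≤ 4 ^ d * J)
    have h5 : 1 ≤ 4 ^ d * J := one_le_mul_of_one_le_of_one_le h4d hJ1
    rw [hc]; linarith
  have hK0 : (0 : ℝ) < K := by linarith
  have h3 : (c * J) ^ (-q) ≤ (2 * (K : ℝ)) ^ (-q) :=
    Real.rpow_le_rpow_of_nonpos (by positivity) hKup (by linarith)
  have h4 : (c * J) ^ (-q) = (c ^ q)⁻¹ * J ^ (-q) := by
    rw [Real.mul_rpow hc0.le hJ0.le, Real.rpow_neg hc0.le]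
  have h5 : (n : ℝ)⁻¹ ≤ J ^ (-q) := by
    have e1 : J ^ (-q) = (n : ℝ) ^ (-(((d : ℝ) + 2 * s) / (d + 2 * α))) := by
      rw [hJ, effDim, ← Real.rpow_mul (by positivity), hq]
      congr 1
      field_simp
    rw [e1, ← Real.rpow_neg_one]
    refine Real.rpow_le_rpow_of_exponent_le hn' ?_
    rw [neg_le_neg_iff, div_le_one (by positivity)]
    linarith
  have h6 : D * ((n : ℝ) ^ 5)⁻¹ ≤ (c ^ q)⁻¹ * J ^ (-q) / 4 := by
    have hcq : 0 < c ^ q := by positivity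
    have h7 : D ≤ (c ^ q)⁻¹ * n / 4 := by
      rw [le_div_iff₀ (by norm_num), le_inv_mul_iff₀ hcq]
      linarith
    have h8 : ((n : ℝ) ^ 4)⁻¹ ≤ (n : ℝ)⁻¹ := by
      have : (n : ℝ) ≤ (n : ℝ) ^ 4 := le_self_pow₀ hn' (by norm_num)
      gcongr
    calc D * ((n : ℝ) ^ 5)⁻¹ ≤ (c ^ q)⁻¹ * n / 4 * ((n : ℝ) ^ 5)⁻¹ := by gcongr
      _ = (c ^ q)⁻¹ * ((n : ℝ) ^ 4)⁻¹ / 4 := by field_simp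
      _ ≤ _ := by
        have := h8.trans h5
        gcongr
  have h9 : J ^ (2 * α / d - 2 * (s / d)) * (J / n) = J * J ^ (-q) := by
    rw [← hJn, ← Real.rpow_add hJ0, ← Real.rpow_one_add' hJ0.le (by linarith [div_pos hs hd'])]
    congr 1
    rw [hq]; ring
  have hcq : 0 < c ^ q := by positivity
  have hJn0 : 0 < J / n := by positivity
  have h10 : 4 * c ^ q * A * (J / n) < J * J ^ (-q) := by
    rw [← h9]; exact mul_lt_mul_of_pos_right h1 hJn0
  have hJq : 0 < J ^ (-q) := by positivity
  calc A * (J / n) < J * J ^ (-q) / (4 * c ^ q) := by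
        rw [lt_div_iff₀ (by positivity)]
        linarith
    _ = J * ((c ^ q)⁻¹ * J ^ (-q) / 4) := by field_simp
    _ ≤ K * ((c ^ q)⁻¹ * J ^ (-q) / 4) := by gcongr
    _ ≤ _ := by
        refine mul_le_mul_of_nonneg_left ?_ hK0.le
        rw [← h4] at h6 ⊢
        linarith

variable {lam : ℕ → ℕ → ℝ≥0} {m : ℕ → ℕ}
  {Ψ : ∀ n : ℕ, (Fin n → 𝓧) → (Fin n → ℝ) → Measure (L2 μ)}
  {ρ : ∀ n : ℕ, (Fin n → 𝓧) → (Fin n → ℝ) → ℝ}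

/-- Apart from a bad Gram matrix or `∑ y_i² > n²`, both of vanishing probability, the squared error
exceeds `M² ρ²` deterministically once `n` is large. The coverage event is then contained in these
two exceptions. -/
theorem tendsto_coverage_zero (hd : 0 < d) (hσ : 0 < σ) (hγ0 : 0 < γ) (hγ : γ < 1)
    (hφ : IsBoundedEigenbasis φ e) (hα : 0 < α) (hc₀ : 0 < c₀) (hC₀ : 0 < C₀)
    (hlo : ∀ n, 2 ≤ n → ∀ j, c₀ * eigRate d α n j ≤ lam n j)
    (hup : ∀ n, 2 ≤ n → ∀ j, lam n j ≤ C₀ * eigRate d α n j) (hr : r < 1 / 2)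
    (hmup : ∀ n : ℕ, 2 ≤ n → (m n : ℝ) ≤ C₁ * (n : ℝ) ^ r)
    (hmJ : ∀ n : ℕ, 2 ≤ n → effDim d α n ≤ m n)
    (hΨ : ∀ n : ℕ, 2 ≤ n → ∀ x y, IsVariationalPosterior φ e (lam n) σ (m n) x y (Ψ n x y))
    (hρ : ∀ n : ℕ, 2 ≤ n → ∀ x y, IsCredibleRadius γ (Ψ n x y) (ρ n x y))
    {s : ℝ} (hs : 0 < s) (hsα : s < α) {f₀ : L2 μ}
    (hf : ∀ j, coords e f₀ j ^ 2 = ((j : ℝ) + 1) ^ (-(1 + 2 * (s / d)))) (M : ℝ) :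
    Tendsto (fun n => dataLaw μ σ f₀ n {p | ‖meanOf (Ψ n p.1 p.2) - f₀‖ ≤ M * ρ n p.1 p.2})
      atTop (𝓝 0) := by
  obtain ⟨C, hC⟩ := hφ.bounded
  set N := 2 * ‖f₀‖ ^ 2 + 2 * (σ : ℝ) ^ 2 with hN
  have hδ : Tendsto (fun n : ℕ => ENNReal.ofReal (4 * C ^ 4 * ((m n : ℝ) ^ 2 / n) + N / n))
      atTop (𝓝 0) := by
    rw [← ENNReal.ofReal_zero]
    refine ENNReal.tendsto_ofReal ?_
    have h1 := (tendsto_sq_div_zero hr hmup).const_mul (4 * C ^ 4)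
    simpa using h1.add (tendsto_const_div_atTop_nhds_zero_nat N)
  refine tendsto_of_tendsto_of_tendsto_of_le_of_le' tendsto_const_nhds hδ
    (Eventually.of_forall fun n => zero_le) ?_
  filter_upwards [eventually_ge_atTop 2, eventually_radius_lt_bias hd hα hs hsα
    (M ^ 2 * ((C₀ + 2 * (σ : ℝ) ^ 2) * decayConst d / γ)) ((C₀ / (σ : ℝ) ^ 2) ^ 2 * C ^ 2)] with n hn hlt
  have hn0 : 0 < n := by omega
  have hn' : (0 : ℝ) < n := by exact_mod_cast hn0
  have hd' : (0 : ℝ) < d := by exact_mod_cast hd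
  have hpos := lam_pos_of_le hc₀ (hlo n hn)
  have hsub : {p : (Fin n → 𝓧) × (Fin n → ℝ) | ‖meanOf (Ψ n p.1 p.2) - f₀‖ ≤ M * ρ n p.1 p.2}
      ⊆ {p | (n : ℝ) ^ 2 / 4 < gramDefect φ (m n) p.1}
        ∪ {p | (n : ℝ) ^ 2 < ∑ i, p.2 i ^ 2} := by
    rintro ⟨x, y⟩ hp
    by_contra hnot
    simp only [Set.mem_union, Set.mem_ofPred_eq, not_or, not_lt] at hp hnot
    have hG := gramBounds_of_gramDefect_le hnot.1
    have h1 := lt_norm_meanOf_sub_sq hd hn hα (div_pos hs hd') hC hpos (hup n hn) (hΨ n hn x y)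
      (Nat.le_ceil _) hnot.2 hf
    have h2 := radius_sq_le_effDim hd hn hα hσ hγ0 hγ hC hC₀.le hpos (hup n hn) (hmJ n hn) hG
      (hΨ n hn x y) (hρ n hn x y)
    have h3 : ‖meanOf (Ψ n x y) - f₀‖ ^ 2 ≤ (M * ρ n x y) ^ 2 :=
      pow_le_pow_left₀ (norm_nonneg _) hp 2
    have h4 := mul_le_mul_of_nonneg_left h2 (sq_nonneg M)
    rw [mul_pow] at h3
    have h5 := (hlt.trans_le h1).trans_le (h3.trans h4)
    refine absurd h5 (not_lt.2 (le_of_eq ?_))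
    ring
  refine (measure_mono hsub).trans ((measure_union_le _ _).trans ?_)
  rw [ENNReal.ofReal_add (by positivity) (by positivity)]
  refine add_le_add (measure_gramDefect_le hφ hC hn0 f₀ (m n)) ?_
  refine (measure_lt_le_of_lintegral_le (by fun_prop) (by positivity)
    (lintegral_sum_sq_le f₀)).trans (ENNReal.ofReal_le_ofReal (le_of_eq ?_))
  rw [← hN]
  field_simp

end Oversmoothing

end VBGP

theorem corollary5p4
    -- the design distribution on a subset of `ℝ^d`
    {d : ℕ} (hd : 0 < d) (X : Set (EuclideanSpace ℝ (Fin d)))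
    (μ : Measure X) [IsProbabilityMeasure μ]
    -- noise level, credibility level
    (σ : ℝ≥0) (hσ : 0 < σ) (γ : ℝ) (hγ : γ ∈ Set.Ioo (0 : ℝ) 1)
    -- uniformly bounded eigenfunctions
    (φ : ℕ → X → ℝ) (e : HilbertBasis ℕ ℝ (VBGP.L2 μ)) (hφ : VBGP.IsBoundedEigenbasis φ e)
    -- eigenvalues of the order of `exp (-τ_n j^(1/d))`, uniformly in `n ≥ 2` and `j ≥ 1`
    (α : ℝ) (hα : 0 < α) (lam : ℕ → ℕ → ℝ≥0)
    (hlam : ∃ c C : ℝ, 0 < c ∧ 0 < C ∧ ∀ n : ℕ, 2 ≤ n → ∀ j : ℕ,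
      c * Real.exp (-VBGP.rescaling d α n * ((j : ℝ) + 1) ^ (1 / (d : ℝ))) ≤ lam n j ∧
      lam n j ≤ C * Real.exp (-VBGP.rescaling d α n * ((j : ℝ) + 1) ^ (1 / (d : ℝ))))
    -- the number of inducing variables, of the order of `n ^ r`
    (r : ℝ) (hr : r ∈ Set.Ioo (0 : ℝ) (1 / 2)) (m : ℕ → ℕ)
    (hm : ∃ c C : ℝ, 0 < c ∧ 0 < C ∧ ∀ n : ℕ, 2 ≤ n →
      c * (n : ℝ) ^ r ≤ m n ∧ (m n : ℝ) ≤ C * (n : ℝ) ^ r)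
    -- the variational posterior and the radius of its credible ball, as functions of the data
    (Ψ : ∀ n : ℕ, (Fin n → X) → (Fin n → ℝ) → Measure (VBGP.L2 μ))
    (hΨ : ∀ n : ℕ, 2 ≤ n → ∀ x y, VBGP.IsVariationalPosterior φ e (lam n) σ (m n) x y (Ψ n x y))
    (ρ : ∀ n : ℕ, (Fin n → X) → (Fin n → ℝ) → ℝ)
    (hρ : ∀ n : ℕ, 2 ≤ n → ∀ x y, VBGP.IsCredibleRadius γ (Ψ n x y) (ρ n x y)) :
    (∀ β : ℝ, (d : ℝ) / (d + 2 * α) ≤ r → α ≤ β →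
      ∀ f₀ ∈ VBGP.sobolev e d β, VBGP.IsBounded f₀ →
      ∀ M : ℕ → ℝ, Tendsto M atTop atTop →
        Tendsto (fun n => VBGP.dataLaw μ σ f₀ n
          {p | ‖VBGP.meanOf (Ψ n p.1 p.2) - f₀‖ ≤ M n * ρ n p.1 p.2}) atTop (𝓝 1)) ∧
    (r < (d : ℝ) / (d + 2 * α) →
      ∀ f₀ : VBGP.L2 μ, VBGP.IsBounded f₀ →
        Tendsto (fun n => VBGP.dataLaw μ σ f₀ n
          {p | ‖VBGP.meanOf (Ψ n p.1 p.2) - f₀‖ ≤ ρ n p.1 p.2}) atTop (𝓝 1)) ∧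
    (∀ β : ℝ, 0 < β → β < α →
      (∀ n : ℕ, 2 ≤ n → (n : ℝ) ^ ((d : ℝ) / (d + 2 * α)) ≤ m n) →
      ∃ f₀ ∈ VBGP.sobolev e d β, ∀ M : ℝ, 0 < M →
        Tendsto (fun n => VBGP.dataLaw μ σ f₀ n
          {p | ‖VBGP.meanOf (Ψ n p.1 p.2) - f₀‖ ≤ M * ρ n p.1 p.2}) atTop (𝓝 0)) := by
  obtain ⟨c₀, C₀, hc₀, hC₀, hlam⟩ := hlam
  obtain ⟨c₁, C₁, hc₁, hC₁, hm⟩ := hm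
  have hlo : ∀ n, 2 ≤ n → ∀ j, c₀ * VBGP.eigRate d α n j ≤ lam n j := fun n hn j => (hlam n hn j).1
  have hup : ∀ n, 2 ≤ n → ∀ j, lam n j ≤ C₀ * VBGP.eigRate d α n j := fun n hn j => (hlam n hn j).2
  have hmlo := fun n hn => (hm n hn).1
  have hmup := fun n hn => (hm n hn).2
  refine ⟨fun β hrα hβ f₀ hf₀ _ M hM => ?_, fun hrα f₀ _ => ?_, fun β hβ hβα hmJ => ?_⟩
  · exact VBGP.tendsto_coverage_of_smooth hd hσ hγ.2 hφ hα hc₀ hC₀ hlo hup hr.2 hrα hc₁ hmlo hmup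
      hΨ hρ (VBGP.sobolev_anti e d hβ hf₀) hM
  · exact VBGP.tendsto_coverage_of_few_features hd hσ hγ.2 hφ hc₀ hlo hup hr.1 hr.2 hrα hc₁ hC₁
      hmlo hmup hΨ hρ f₀
  -- The midpoint of `β` and `α`: above `β`, so that `f₀` is in the Sobolev space, and below `α`, so
  -- that the bias dominates. The choice does not involve `M`.
  · have hs : 0 < (α + β) / 2 := by linarith
    obtain ⟨f₀, hf₀⟩ := VBGP.exists_coords_eq_rpow e (div_pos hs (Nat.cast_pos.2 hd))
    exact ⟨f₀, VBGP.mem_sobolev_of_coords_eq_rpow hd (by linarith) hf₀, fun M _ =>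
      VBGP.tendsto_coverage_zero hd hσ hγ.1 hγ.2 hφ hα hc₀ hC₀ hlo hup hr.2 hmup hmJ hΨ hρ hs
        (by linarith) hf₀ M⟩
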